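/- On $L^2(\mathbb{R}_+)$, $\mathbb{R}_+=(0,\infty)$, let $H_0=-\frac{d^2}{dx^2}$ be the Laplacian with Neumann boundary condition (domain: $\psi\in L^2$ with $\psi,\psi'$ locally absolutely continuous on $[0,\infty)$, $\psi''\in L^2$, $\psi'(0)=0$), and let $A_0=\frac{1}{2i}\bigl(\frac{d}{dx}x+x\frac{d}{dx}\bigr)$ be the generator of dilations (domain: $\psi\in L^2$ locally absolutely continuous on $(0,\infty)$ with $x\psi'\in L^2$). For Borel functions $f:\mathbb{R}\to\mathbb{C}$ and $g$ on the half-line define $f(A_0)$ and $g(H_0)$ by the functional calculus, and set $$\|f\|^2=\int_{-\infty}^\infty |f(a)|^2\,da,\qquad |||g|||^2=\int_0^\infty |g(E)|^2\,\frac{dE}{2E}\qquad(\text{values in }[0,\infty]).$$ The product $g(H_0)f(A_0)$ has its natural domain $\{\psi\in D(f(A_0)) : f(A_0)\psi\in D(g(H_0))\}$; if it is densely defined and bounded it is identified with its bounded closure. Let $\|\cdot\|_2$ denote the Hilbert--Schmidt norm of this closure, with the value $\infty$ if the operator is not densely defined, not bounded or not Hilbert--Schmidt. (i) If at least one of the following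 holds: $\|f\|<\infty$, $|||g|||<\infty$, $f$ is bounded, $g$ is bounded, then $$\|g(H_0)f(A_0)\|_2=(2\pi)^{-1/2}\,|||g|||\cdot\|f\|$$ as an identity in $[0,\infty]$ (with $0\cdot\infty=0$). In particular $g(H_0)f(A_0)$ is densely defined and extends to a Hilbert--Schmidt operator whenever $\|f\|<\infty$ and $|||g|||<\infty$. (ii) Let $\|f\|<\infty$, and suppose that $g$ is continuous on $(0,\infty)$, that the ($L^2$-)Fourier transform $\hat f(t)=(2\pi)^{-1}\int e^{-i\lambda t}f(\lambda)\,d\lambda$ is (a.e. equal to) a continuous function, and that $g(H_0)f(A_0)$ is densely defined and bounded with trace class closure. Then $$\operatorname{tr}\bigl(g(H_0)f(A_0)\bigr)=\frac{1}{2\pi}\int_0^\infty g(E)\,\frac{dE}{2E}\cdot\int_{-\infty}^\infty f(a)\,da .$$ Here both integrals converge absolutely, unless $f$ or $g$ vanishes almost everywhere, in which case the operator is $0$ and the right hand side is read as $0$. -/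

import Mathlib

open MeasureTheory Set
open scoped ENNReal

noncomputable section

/-! ### Operators on a Hilbert space -/

section Operators

variable {H : Type} [NormedAddCommGroup H] [InnerProductSpace ℂ H]

/-- The product `S T` of two partially defined operators, on its natural domain
`{x ∈ dom T | T x ∈ dom S}`. -/
def opMul (S T : H →ₗ.[ℂ] H) : H →ₗ.[ℂ] H :=
  S.comp (T.domRestrict ((S.domain.comap T.toFun).map T.domain.subtype)) (by
    rintro ⟨x, hx⟩
    obtain ⟨⟨y, hy, rfl⟩, -⟩ := hx
    exact hy)

/-- The operator `U⁻¹ M U` for a unitary map `U : H → K`, with domain `U⁻¹ (dom M)`. -/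
def unitaryConj {K : Type} [NormedAddCommGroup K] [InnerProductSpace ℂ K]
    (U : H ≃ₗᵢ[ℂ] K) (M : K →ₗ.[ℂ] K) : H →ₗ.[ℂ] H where
  domain := M.domain.comap (U.toLinearEquiv : H →ₗ[ℂ] K)
  toFun := (U.symm.toLinearEquiv : K →ₗ[ℂ] H).comp
    (M.toFun.comp ((U.toLinearEquiv : H →ₗ[ℂ] K).restrict (fun _ hx => hx)))

/-- Multiplication by the function `m` on `L²(X, μ)`, with its maximal domain
`{ψ | m ψ ∈ L²}`. -/
def mulOp {X : Type} [MeasurableSpace X] (μ : Measure X) (m : X → ℂ) :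
    Lp ℂ 2 μ →ₗ.[ℂ] Lp ℂ 2 μ where
  domain :=
    { carrier := {ψ | MemLp (fun x => m x * ψ x) 2 μ}
      zero_mem' := by
        refine (MemLp.zero (p := 2) (μ := μ) (ε := ℂ)).ae_eq ?_
        filter_upwards [Lp.coeFn_zero ℂ 2 μ] with x hx
        simp only [hx, Pi.zero_apply, mul_zero]
      add_mem' := by
        intro φ ψ hφ hψ
        refine (MemLp.add hφ hψ).ae_eq ?_
        filter_upwards [Lp.coeFn_add φ ψ] with x hx
        simp only [hx, Pi.add_apply, mul_add]
      smul_mem' := by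
        intro c ψ hψ
        refine (MemLp.const_smul hψ c).ae_eq ?_
        filter_upwards [Lp.coeFn_smul c ψ] with x hx
        simp [hx, mul_left_comm] }
  toFun :=
    { toFun := fun ψ => MemLp.toLp (fun x => m x * (ψ : Lp ℂ 2 μ) x) ψ.2
      map_add' := by
        intro φ ψ
        rw [← MemLp.toLp_add, MemLp.toLp_eq_toLp_iff]
        filter_upwards [Lp.coeFn_add (φ : Lp ℂ 2 μ) (ψ : Lp ℂ 2 μ)] with x hx
        simp only [Submodule.coe_add, hx, Pi.add_apply, mul_add]
      map_smul' := by
        intro c ψ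
        rw [RingHom.id_apply, ← MemLp.toLp_const_smul, MemLp.toLp_eq_toLp_iff]
        filter_upwards [Lp.coeFn_smul c (ψ : Lp ℂ 2 μ)] with x hx
        simp [hx, mul_left_comm] }

/-- A spectral representation (spectral theorem in multiplication form) of an operator `T`:
a unitary map `U` onto some `L²(X, μ)` under which `T`, domain included, becomes multiplication by
a real measurable function `a`. -/
structure SpectralRepresentation (T : H →ₗ.[ℂ] H) where
  X : Type
  mX : MeasurableSpace X
  μ : Measure X
  a : X → ℝ
  measurable_a : Measurable a
  U : H ≃ₗᵢ[ℂ] Lp ℂ 2 μ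
  eq_conj : T = unitaryConj U (mulOp μ fun x => (a x : ℂ))

open Classical in
/-- The Borel functional calculus `f(T) = U⁻¹ (multiplication by f ∘ a) U` of a self-adjoint
operator `T`. By the spectral theorem a self-adjoint operator has a spectral representation, and
`f(T)` does not depend on which one is used. (An operator without a spectral representation, that
is, one which is not self-adjoint, gets the operator with domain `{0}`.) -/
def borelCalculus (T : H →ₗ.[ℂ] H) (f : ℝ → ℂ) : H →ₗ.[ℂ] H :=
  if h : Nonempty (SpectralRepresentation T) then
    let R := h.some
    letI := R.mX
    unitaryConj R.U (mulOp R.μ fun x => f (R.a x))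
  else ⊥

/-- `T` is densely defined and `B` is a bounded, everywhere defined operator which extends it;
such a `B` is unique, it is the closure of `T`. -/
def IsBoundedClosure (T : H →ₗ.[ℂ] H) (B : H →L[ℂ] H) : Prop :=
  Dense (T.domain : Set H) ∧ ∀ x : T.domain, T x = B x

variable (H) in
/-- The index set of `someBasis`. -/
def someBasisIndex [CompleteSpace H] : Set H := (exists_hilbertBasis ℂ H).choose

variable (H) in
/-- Some orthonormal basis of `H`. -/
def someBasis [CompleteSpace H] : HilbertBasis (someBasisIndex H) ℂ H :=
  (exists_hilbertBasis ℂ H).choose_spec.choose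

/-- The Hilbert-Schmidt norm `(∑ᵢ ‖B eᵢ‖²)^(1/2) ∈ [0, ∞]` of a bounded operator. (It does not
depend on the orthonormal basis.) -/
def hilbertSchmidtNorm [CompleteSpace H] (B : H →L[ℂ] H) : ℝ≥0∞ :=
  (∑' i, ‖B (someBasis H i)‖ₑ ^ 2) ^ (1 / 2 : ℝ)

/-- The Hilbert-Schmidt norm in `[0, ∞]` of a partially defined operator: the Hilbert-Schmidt norm
of its bounded closure (the infimum is over at most one `B`), and `∞` if it is not densely defined
and bounded. -/
def partialHilbertSchmidtNorm [CompleteSpace H] (T : H →ₗ.[ℂ] H) : ℝ≥0∞ :=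
  ⨅ (B : H →L[ℂ] H) (_ : IsBoundedClosure T B), hilbertSchmidtNorm B

/-- `B` is trace class: `tr |B| < ∞` with `|B| = (B* B)^(1/2)`. (The sum of nonnegative terms does
not depend on the orthonormal basis.) -/
def IsTraceClass [CompleteSpace H] (B : H →L[ℂ] H) : Prop :=
  ∑' i, ENNReal.ofReal (inner ℂ (someBasis H i) (CFC.abs B (someBasis H i))).re < ∞

/-- `tr B = c`: in every orthonormal basis the series `∑ᵢ ⟨eᵢ, B eᵢ⟩` converges, with sum `c`. -/
def HasTrace [CompleteSpace H] (B : H →L[ℂ] H) (c : ℂ) : Prop :=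
  ∀ (ι : Type) (b : HilbertBasis ι ℂ H), HasSum (fun i => inner ℂ (b i) (B (b i))) c

end Operators

/-! ### The half-line -/

/-- `L²(ℝ₊)` with Lebesgue measure. -/
abbrev HalfLineL2 : Type := Lp ℂ 2 (volume.restrict (Ioi (0 : ℝ)))

/-- On the interval `J` the function `u` is locally absolutely continuous with almost everywhere
derivative `v`, i.e. `v` is locally integrable and `u` is a primitive of `v`. -/
def HasACDerivOn (J : Set ℝ) (u v : ℝ → ℂ) : Prop :=
  ∀ a ∈ J, ∀ b ∈ J, IntervalIntegrable v volume a b ∧ ∫ x in a..b, v x = u b - u a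

lemma HasACDerivOn.zero (J : Set ℝ) : HasACDerivOn J 0 0 := by
  intro a _ b _
  refine ⟨by simp [Pi.zero_def], by simp⟩

lemma HasACDerivOn.add {J : Set ℝ} {u v u' v' : ℝ → ℂ} (h : HasACDerivOn J u v)
    (h' : HasACDerivOn J u' v') : HasACDerivOn J (u + u') (v + v') := by
  intro a ha b hb
  obtain ⟨h1, h2⟩ := h a ha b hb
  obtain ⟨h3, h4⟩ := h' a ha b hb
  refine ⟨h1.add h3, ?_⟩
  simp only [Pi.add_apply]
  rw [intervalIntegral.integral_add h1 h3, h2, h4]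
  ring

lemma HasACDerivOn.smul {J : Set ℝ} {u v : ℝ → ℂ} (h : HasACDerivOn J u v) (c : ℂ) :
    HasACDerivOn J (c • u) (c • v) := by
  intro a ha b hb
  obtain ⟨h1, h2⟩ := h a ha b hb
  refine ⟨h1.smul c, ?_⟩
  simp only [Pi.smul_apply]
  rw [intervalIntegral.integral_smul, h2, smul_sub]

lemma HasACDerivOn.continuousOn_Ioi {J : Set ℝ} (hJ : Ioi 0 ⊆ J) {u v : ℝ → ℂ}
    (h : HasACDerivOn J u v) : ContinuousOn u (Ioi 0) := by
  intro x hx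
  have hx : 0 < x := hx
  have ha : x / 2 ∈ J := hJ (by simp only [mem_Ioi]; linarith)
  have hb : 2 * x ∈ J := hJ (by simp only [mem_Ioi]; linarith)
  have hc := intervalIntegral.continuousOn_primitive_interval' (h _ ha _ hb).1 left_mem_uIcc
  have hle : x / 2 ≤ 2 * x := by linarith
  rw [uIcc_of_le hle] at hc
  have hn : Icc (x / 2) (2 * x) ∈ nhds x := Icc_mem_nhds (by linarith) (by linarith)
  have h1 : ContinuousAt (fun t => u (x / 2) + ∫ s in (x / 2)..t, v s) x :=
    continuousAt_const.add (hc.continuousAt hn)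
  refine (h1.congr ?_).continuousWithinAt
  filter_upwards [hn] with t ht
  rw [(h _ ha t (hJ (by simp only [mem_Ioi]; linarith [ht.1]))).2]
  ring

lemma HasACDerivOn.ae_eq_zero {J : Set ℝ} (hJ : Ioi 0 ⊆ J) {u v : ℝ → ℂ}
    (h : HasACDerivOn J u v) (hu : u =ᵐ[volume.restrict (Ioi 0)] 0) :
    v =ᵐ[volume.restrict (Ioi 0)] 0 := by
  have hu0 : EqOn u 0 (Ioi 0) :=
    Measure.eqOn_open_of_ae_eq hu isOpen_Ioi (h.continuousOn_Ioi hJ) continuousOn_const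
  have key : ∀ n : ℕ, ∀ᵐ x, x ∈ uIcc (1 / ((n : ℝ) + 1)) ((n : ℝ) + 1) →
      x ∈ Ioo (1 / ((n : ℝ) + 1)) ((n : ℝ) + 1) → v x = 0 := by
    intro n
    have hn : (0 : ℝ) < n + 1 := by positivity
    have hn' : 0 < 1 / ((n : ℝ) + 1) := by positivity
    have hi := (h _ (hJ hn') _ (hJ hn)).1
    filter_upwards [hi.ae_hasDerivAt_integral] with x hx hx1 hx2
    have h1 := hx hx1 _ left_mem_uIcc
    refine h1.unique ((hasDerivAt_const x (0 : ℂ)).congr_of_eventuallyEq ?_)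
    filter_upwards [isOpen_Ioo.mem_nhds hx2] with t ht
    have ht0 : (0 : ℝ) < t := hn'.trans ht.1
    rw [(h _ (hJ hn') t (hJ ht0)).2, hu0 hn', hu0 ht0]
    simp
  rw [Filter.EventuallyEq, ae_restrict_iff' measurableSet_Ioi]
  filter_upwards [ae_all_iff.2 key] with x hx hx0
  have hx0 : 0 < x := hx0
  obtain ⟨n, hn⟩ := exists_nat_gt (max x (1 / x))
  have h1 : x < (n : ℝ) + 1 := by linarith [le_max_left x (1 / x)]
  have h2 : 1 / ((n : ℝ) + 1) < x := by
    rw [div_lt_comm₀ (by positivity) hx0]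
    linarith [le_max_right x (1 / x)]
  exact hx n (Icc_subset_uIcc ⟨h2.le, h1.le⟩) ⟨h2, h1⟩

/-- The graph of the Neumann Laplacian `-d²/dx²`: pairs `(ψ, η)` such that `ψ` is (a.e. equal to)
a function `u` for which `u` and `u'` are locally absolutely continuous on `[0, ∞)`,
`u'(0) = 0` and `-u'' = η ∈ L²`. -/
def neumannGraph : Submodule ℂ (HalfLineL2 × HalfLineL2) where
  carrier := {p | ∃ u u₁ u₂ : ℝ → ℂ, u =ᵐ[volume.restrict (Ioi 0)] p.1 ∧
    HasACDerivOn (Ici 0) u u₁ ∧ HasACDerivOn (Ici 0) u₁ u₂ ∧ u₁ 0 = 0 ∧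
    p.2 =ᵐ[volume.restrict (Ioi 0)] fun x => -u₂ x}
  zero_mem' := by
    refine ⟨0, 0, 0, ?_, HasACDerivOn.zero _, HasACDerivOn.zero _, rfl, ?_⟩
    · exact (Lp.coeFn_zero ℂ 2 (volume.restrict (Ioi (0 : ℝ)))).symm
    · filter_upwards [Lp.coeFn_zero ℂ 2 (volume.restrict (Ioi (0 : ℝ)))] with x hx
      simp only [Prod.snd_zero, hx, Pi.zero_apply, neg_zero]
  add_mem' := by
    rintro p q ⟨u, u₁, u₂, hu, h1, h2, h0, h3⟩ ⟨v, v₁, v₂, hv, k1, k2, k0, k3⟩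
    refine ⟨u + v, u₁ + v₁, u₂ + v₂, ?_, h1.add k1, h2.add k2, by simp [h0, k0], ?_⟩
    · filter_upwards [hu, hv, Lp.coeFn_add p.1 q.1] with x e1 e2 e3
      simp only [Prod.fst_add, e3, Pi.add_apply, e1, e2]
    · filter_upwards [h3, k3, Lp.coeFn_add p.2 q.2] with x e1 e2 e3
      simp only [Prod.snd_add, e3, Pi.add_apply, e1, e2]
      ring
  smul_mem' := by
    rintro c p ⟨u, u₁, u₂, hu, h1, h2, h0, h3⟩
    refine ⟨c • u, c • u₁, c • u₂, ?_, h1.smul c, h2.smul c, by simp [h0], ?_⟩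
    · filter_upwards [hu, Lp.coeFn_smul c p.1] with x e1 e3
      simp [e1, e3]
    · filter_upwards [h3, Lp.coeFn_smul c p.2] with x e1 e3
      simp [e1, e3]

/-- The graph of the generator of dilations `(1/2i) (d/dx x + x d/dx)`: pairs `(ψ, η)` such that
`ψ` is (a.e. equal to) a locally absolutely continuous function `u` on `(0, ∞)`, with derivative
`v`, for which `(1/2i) ((x u)' + x u') = (1/2i) ((u + x v) + x v) = η ∈ L²`. -/
def dilationGraph : Submodule ℂ (HalfLineL2 × HalfLineL2) where
  carrier := {p | ∃ u v : ℝ → ℂ, u =ᵐ[volume.restrict (Ioi 0)] p.1 ∧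
    HasACDerivOn (Ioi 0) u v ∧
    p.2 =ᵐ[volume.restrict (Ioi 0)]
      fun x => 1 / (2 * Complex.I) * ((u x + x * v x) + x * v x)}
  zero_mem' := by
    refine ⟨0, 0, ?_, HasACDerivOn.zero _, ?_⟩
    · exact (Lp.coeFn_zero ℂ 2 (volume.restrict (Ioi (0 : ℝ)))).symm
    · filter_upwards [Lp.coeFn_zero ℂ 2 (volume.restrict (Ioi (0 : ℝ)))] with x hx
      simp only [Prod.snd_zero, hx, Pi.zero_apply, mul_zero, add_zero]
  add_mem' := by
    rintro p q ⟨u, u₁, hu, h1, h3⟩ ⟨v, v₁, hv, k1, k3⟩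
    refine ⟨u + v, u₁ + v₁, ?_, h1.add k1, ?_⟩
    · filter_upwards [hu, hv, Lp.coeFn_add p.1 q.1] with x e1 e2 e3
      simp only [Prod.fst_add, e3, Pi.add_apply, e1, e2]
    · filter_upwards [h3, k3, Lp.coeFn_add p.2 q.2] with x e1 e2 e3
      simp only [Prod.snd_add, e3, Pi.add_apply, e1, e2]
      ring
  smul_mem' := by
    rintro c p ⟨u, u₁, hu, h1, h3⟩
    refine ⟨c • u, c • u₁, ?_, h1.smul c, ?_⟩
    · filter_upwards [hu, Lp.coeFn_smul c p.1] with x e1 e3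
      simp [e1, e3]
    · filter_upwards [h3, Lp.coeFn_smul c p.2] with x e1 e3
      simp only [Prod.smul_snd, e3, Pi.smul_apply, e1, smul_eq_mul]
      ring

/-- The Neumann Laplacian `H₀` on `L²(ℝ₊)`. -/
def neumannLaplacian : HalfLineL2 →ₗ.[ℂ] HalfLineL2 := neumannGraph.toLinearPMap

/-- The generator of dilations `A₀` on `L²(ℝ₊)`. -/
def dilationGenerator : HalfLineL2 →ₗ.[ℂ] HalfLineL2 := dilationGraph.toLinearPMap

lemma mem_graph_neumannLaplacian (p : HalfLineL2 × HalfLineL2) :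
    p ∈ neumannLaplacian.graph ↔ p ∈ neumannGraph := by
  rw [neumannLaplacian, Submodule.toLinearPMap_graph_eq]
  rintro ⟨ψ, η⟩ ⟨u, u₁, u₂, hu, h1, h2, -, h3⟩ h0
  obtain rfl : ψ = 0 := h0
  have hz := Lp.coeFn_zero ℂ 2 (volume.restrict (Ioi (0 : ℝ)))
  have e := h2.ae_eq_zero Ioi_subset_Ici_self
    (h1.ae_eq_zero Ioi_subset_Ici_self (hu.trans hz))
  refine Lp.ext ?_
  filter_upwards [h3, e, hz] with x e1 e2 e3
  rw [e1, e2, e3]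
  simp

lemma mem_graph_dilationGenerator (p : HalfLineL2 × HalfLineL2) :
    p ∈ dilationGenerator.graph ↔ p ∈ dilationGraph := by
  rw [dilationGenerator, Submodule.toLinearPMap_graph_eq]
  rintro ⟨ψ, η⟩ ⟨u, v, hu, h1, h3⟩ h0
  obtain rfl : ψ = 0 := h0
  have hz := Lp.coeFn_zero ℂ 2 (volume.restrict (Ioi (0 : ℝ)))
  have e := h1.ae_eq_zero subset_rfl (hu.trans hz)
  refine Lp.ext ?_
  filter_upwards [h3, e, hu, hz] with x e1 e2 e3 e4
  rw [e1, e2, e3, e4]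
  simp

/-- The operator `g(H₀) f(A₀)` on `L²(ℝ₊)`. -/
def energyDilationProduct (g f : ℝ → ℂ) : HalfLineL2 →ₗ.[ℂ] HalfLineL2 :=
  opMul (borelCalculus neumannLaplacian g) (borelCalculus dilationGenerator f)

/-- The norm `|||g||| = (∫₀^∞ |g(E)|² dE/(2E))^(1/2) ∈ [0, ∞]`. -/
def energyNorm (g : ℝ → ℂ) : ℝ≥0∞ :=
  (∫⁻ E in Ioi (0 : ℝ), ‖g E‖ₑ ^ 2 / ENNReal.ofReal (2 * E)) ^ (1 / 2 : ℝ)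

/-- The norm `‖f‖ = (∫ |f(a)|² da)^(1/2) ∈ [0, ∞]`. -/
def lineNorm (f : ℝ → ℂ) : ℝ≥0∞ := (∫⁻ a, ‖f a‖ₑ ^ 2) ^ (1 / 2 : ℝ)

/-- The Fourier transform `f̂(t) = (2π)⁻¹ ∫ exp(-i λ t) f(λ) dλ` of a square integrable function,
in the `L²` sense. (Mathlib's `𝓕 f` is `ξ ↦ ∫ exp(-2π i λ ξ) f(λ) dλ`.) -/
def hatL2 (f : ℝ → ℂ) (hf : MemLp f 2 volume) (t : ℝ) : ℂ :=
  (2 * Real.pi : ℂ)⁻¹ *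
    (FourierTransform.fourier (hf.toLp f : Lp ℂ 2 (volume : Measure ℝ)) :
      Lp ℂ 2 (volume : Measure ℝ)) (t / (2 * Real.pi))

end

/-!
The operators `H₀` and `A₀` are diagonalised by explicit unitary maps. The cosine transform turns
the Neumann Laplacian into multiplication by `(2πk)²` on `L²(ℝ₊)` (`neumannLaplacian_eq`), and the
Mellin transform, which is the Fourier transform in the coordinate `y = log x`, turns the generator
of dilations into multiplication by `2πξ` (`dilationGenerator_eq`). The functional calculus does not
depend on the spectral representation (`mem_graph_borelCalculus`), so these two may be used. Only the
inclusion of the multiplication operator in the differential operator `T` has to be computed; equality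
follows since the former plus some `z` is onto and `T + z` is injective (`eq_of_graph_le`).

The cosine transform reverses dilations: after it, in the coordinate `y = log k`, the operator `H₀`
is multiplication by `(2π exp y)²` and `A₀` is a Fourier multiplier (`logCosine_lineTranslation`).
Hence `g(H₀) f(A₀)` is unitarily equivalent to the product `G · 𝓕⁻¹ h 𝓕` on `L²(ℝ)`, domain
included, with `G y = g((2π exp y)²)` and `h ξ = f(-2πξ)` (`mem_graph_energyDilationProduct`).

For square integrable `G` and `h` this product is an integral operator with kernel
`G(y) ȟ(y - y')`. Parseval's identity gives the Hilbert-Schmidt inner product of two such operators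
as a product of inner products (`hasSum_inner_kernelOp`). For general symbols, `G` and `h` are cut
off to bounded square integrable functions: under each of the four hypotheses the truncation of a
bounded closure `B` is the kernel operator of the truncated symbols, so that the norm of `B` is at
least the product of the `L²` norms by monotone convergence (`lintegral_mul_le_of_truncate`). In
the other direction, if that product is finite, then either both symbols are square integrable or
one of them vanishes, and the bounded closure is explicit (`exists_isProductClosure`). The
substitution `E = (2π exp y)²` produces the measure `dE/2E` and `a = -2πξ` the factor `1/2π`.

For the trace, `B` is paired with contractions `X` which are products of truncated multipliers; the
trace of `X* B` factorises by the same Parseval identity. Choosing the phases of `G` and `h` as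
multipliers bounds the product of the `L¹` norms by the trace norm
(`IsProductClosure.lintegral_mul_lt_top`), so both symbols are integrable unless one vanishes.
Removing the truncation, where `X* → 1` strongly, gives `tr B = ∫ G · ∫ h`
(`IsProductClosure.hasSum_trace`).
-/


open Filter Topology
open scoped NNReal

noncomputable section

/-! ### Graphs of partially defined operators -/

section Graphs

variable {H : Type} [NormedAddCommGroup H] [InnerProductSpace ℂ H]

lemma mem_graph_unitaryConj {K : Type} [NormedAddCommGroup K] [InnerProductSpace ℂ K]
    (U : H ≃ₗᵢ[ℂ] K) (M : K →ₗ.[ℂ] K) (p : H × H) :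
    p ∈ (unitaryConj U M).graph ↔ (U p.1, U p.2) ∈ M.graph := by
  rw [LinearPMap.mem_graph_iff, LinearPMap.mem_graph_iff]
  constructor
  · rintro ⟨y, hy1, hy2⟩
    refine ⟨⟨U y, y.2⟩, by simp [← hy1], ?_⟩
    rw [← hy2]
    exact (U.apply_symm_apply _).symm
  · rintro ⟨y, hy1, hy2⟩
    refine ⟨⟨p.1, ?_⟩, rfl, ?_⟩
    · change U p.1 ∈ M.domain
      have h := y.2
      rwa [hy1] at h
    · apply U.injective
      refine Eq.trans ((U.apply_symm_apply _).trans ?_) hy2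
      change M _ = M y
      congr 1
      exact Subtype.ext hy1.symm

lemma mem_graph_opMul (S T : H →ₗ.[ℂ] H) (p : H × H) :
    p ∈ (opMul S T).graph ↔ ∃ y, (p.1, y) ∈ T.graph ∧ (y, p.2) ∈ S.graph := by
  simp only [LinearPMap.mem_graph_iff]
  constructor
  · rintro ⟨⟨x, hx⟩, hx1, hx2⟩
    have hxT : x ∈ T.domain := hx.2
    obtain ⟨⟨z, hz, hzx⟩, -⟩ := id hx
    have hz' : z = ⟨x, hxT⟩ := Subtype.ext hzx
    subst hz'
    exact ⟨T ⟨x, hxT⟩, ⟨⟨x, hxT⟩, hx1, rfl⟩, ⟨⟨T ⟨x, hxT⟩, hz⟩, rfl, hx2⟩⟩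
  · rintro ⟨y, ⟨x, hx1, rfl⟩, ⟨z, hz1, hz2⟩⟩
    refine ⟨⟨x, ⟨⟨x, ?_, rfl⟩, x.2⟩⟩, hx1, ?_⟩
    · change T x ∈ S.domain
      exact hz1 ▸ z.2
    · rw [← hz2]
      change S _ = S z
      congr 1
      exact Subtype.ext hz1.symm

lemma isBoundedClosure_iff (T : H →ₗ.[ℂ] H) (B : H →L[ℂ] H) :
    IsBoundedClosure T B ↔
      Dense {x : H | ∃ z, (x, z) ∈ T.graph} ∧ ∀ x z, (x, z) ∈ T.graph → z = B x := by
  have hd : (T.domain : Set H) = {x : H | ∃ z, (x, z) ∈ T.graph} := by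
    ext x
    exact LinearPMap.mem_domain_iff
  rw [IsBoundedClosure, hd]
  refine and_congr_right fun _ => ⟨fun h x z hxz => ?_, fun h x => ?_⟩
  · obtain ⟨y, rfl, rfl⟩ := (LinearPMap.mem_graph_iff T).1 hxz
    exact h y
  · exact h _ _ (LinearPMap.mem_graph T x)

end Graphs

section Multiplication

variable {X : Type} [MeasurableSpace X] {μ : Measure X}

lemma mem_graph_mulOp (m : X → ℂ) (p : Lp ℂ 2 μ × Lp ℂ 2 μ) :
    p ∈ (mulOp μ m).graph ↔ p.2 =ᵐ[μ] fun x => m x * p.1 x := by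
  rw [LinearPMap.mem_graph_iff]
  constructor
  · rintro ⟨y, hy1, hy2⟩
    rw [← hy1, ← hy2]
    exact MemLp.coeFn_toLp (μ := μ) y.2
  · intro h
    have hm : MemLp (fun x => m x * p.1 x) 2 μ := (Lp.memLp p.2).ae_eq h
    refine ⟨⟨p.1, hm⟩, rfl, ?_⟩
    refine Lp.ext (EventuallyEq.trans ?_ h.symm)
    exact MemLp.coeFn_toLp hm

/-! ### Multiplication by bounded functions -/

lemma memLp_mul_of_bound {m : X → ℂ} (hm : Measurable m) {C : ℝ} (hC : ∀ x, ‖m x‖ ≤ C)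
    (φ : Lp ℂ 2 μ) : MemLp (fun x => m x * φ x) 2 μ := by
  refine (Lp.memLp φ).of_le_mul (c := C) (hm.aestronglyMeasurable.mul (Lp.aestronglyMeasurable φ))
    (Eventually.of_forall fun x => ?_)
  simp only [norm_mul]
  exact mul_le_mul_of_nonneg_right (hC x) (norm_nonneg _)

open Classical in
/-- Multiplication by a bounded measurable function, as a bounded operator on `L²`; it is `0` by
convention when the function is not measurable or not bounded. -/
def boundedMul (μ : Measure X) (m : X → ℂ) : Lp ℂ 2 μ →L[ℂ] Lp ℂ 2 μ :=
  if h : Measurable m ∧ ∃ C : ℝ, ∀ x, ‖m x‖ ≤ C then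
    LinearMap.mkContinuous
      { toFun := fun φ => MemLp.toLp (fun x => m x * φ x) (memLp_mul_of_bound h.1 h.2.choose_spec φ)
        map_add' := by
          intro φ ψ
          rw [← MemLp.toLp_add, MemLp.toLp_eq_toLp_iff]
          filter_upwards [Lp.coeFn_add φ ψ] with x hx
          simp only [hx, Pi.add_apply, mul_add]
        map_smul' := by
          intro c ψ
          rw [RingHom.id_apply, ← MemLp.toLp_const_smul, MemLp.toLp_eq_toLp_iff]
          filter_upwards [Lp.coeFn_smul c ψ] with x hx
          simp [hx, mul_left_comm] }
      h.2.choose (by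
        intro φ
        refine Lp.norm_le_mul_norm_of_ae_le_mul ?_
        filter_upwards [MemLp.coeFn_toLp (memLp_mul_of_bound h.1 h.2.choose_spec φ)] with x hx
        refine (congrArg norm hx).trans_le ?_
        rw [norm_mul]
        exact mul_le_mul_of_nonneg_right (h.2.choose_spec x) (norm_nonneg _))
  else 0

lemma coeFn_boundedMul {m : X → ℂ} (hm : Measurable m) {C : ℝ} (hC : ∀ x, ‖m x‖ ≤ C)
    (φ : Lp ℂ 2 μ) : boundedMul μ m φ =ᵐ[μ] fun x => m x * φ x := by
  have h : Measurable m ∧ ∃ C : ℝ, ∀ x, ‖m x‖ ≤ C := ⟨hm, C, hC⟩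
  rw [boundedMul, dif_pos h]
  exact MemLp.coeFn_toLp (memLp_mul_of_bound hm hC φ)

lemma norm_boundedMul_apply_le {m : X → ℂ} (hm : Measurable m) {C : ℝ} (hC : ∀ x, ‖m x‖ ≤ C)
    (φ : Lp ℂ 2 μ) : ‖boundedMul μ m φ‖ ≤ C * ‖φ‖ := by
  refine Lp.norm_le_mul_norm_of_ae_le_mul ?_
  filter_upwards [coeFn_boundedMul hm hC φ] with x hx
  rw [hx, norm_mul]
  exact mul_le_mul_of_nonneg_right (hC x) (norm_nonneg _)

lemma boundedMul_eq_of_ae {m : X → ℂ} (hm : Measurable m) {C : ℝ} (hC : ∀ x, ‖m x‖ ≤ C)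
    {φ χ : Lp ℂ 2 μ} (h : χ =ᵐ[μ] fun x => m x * φ x) : boundedMul μ m φ = χ :=
  Lp.ext ((coeFn_boundedMul hm hC φ).trans h.symm)

lemma Lp_two_norm_sq (φ : Lp ℂ 2 μ) : ‖φ‖ ^ 2 = ∫ x, ‖φ x‖ ^ 2 ∂μ := by
  have h := inner_self_eq_norm_sq_to_K (𝕜 := ℂ) φ
  rw [L2.inner_def] at h
  simp only [inner_self_eq_norm_sq_to_K] at h
  have h2 : ((∫ x, ‖φ x‖ ^ 2 ∂μ : ℝ) : ℂ) = ((‖φ‖ ^ 2 : ℝ) : ℂ) := by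
    rw [← integral_complex_ofReal]
    push_cast
    exact h
  exact_mod_cast h2.symm

lemma Lp_two_enorm_sq (φ : Lp ℂ 2 μ) : ‖φ‖ₑ ^ 2 = ∫⁻ x, ‖φ x‖ₑ ^ 2 ∂μ := by
  rw [Lp.enorm_def, eLpNorm_eq_lintegral_rpow_enorm_toReal (by norm_num) (by norm_num)]
  rw [← ENNReal.rpow_natCast, ← ENNReal.rpow_mul]
  norm_num

lemma Lp_two_integrable_norm_sq (φ : Lp ℂ 2 μ) : Integrable (fun x => ‖φ x‖ ^ 2) μ :=
  (Lp.memLp φ).integrable_norm_pow (by norm_num)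

/-- Bounded pointwise convergence of the multipliers gives strong convergence. -/
lemma tendsto_boundedMul {m : ℕ → X → ℂ} {m' : X → ℂ} (hm : ∀ n, Measurable (m n))
    (hm' : Measurable m') {C : ℝ} (hC : ∀ n x, ‖m n x‖ ≤ C) (hC' : ∀ x, ‖m' x‖ ≤ C)
    (hlim : ∀ x, Tendsto (fun n => m n x) atTop (𝓝 (m' x))) (φ : Lp ℂ 2 μ) :
    Tendsto (fun n => boundedMul μ (m n) φ) atTop (𝓝 (boundedMul μ m' φ)) := by
  rw [tendsto_iff_norm_sub_tendsto_zero]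
  have key : Tendsto (fun n => ‖boundedMul μ (m n) φ - boundedMul μ m' φ‖ ^ 2) atTop (𝓝 0) := by
    have h1 : ∀ n, ‖boundedMul μ (m n) φ - boundedMul μ m' φ‖ ^ 2
        = ∫ x, ‖(m n x - m' x) * φ x‖ ^ 2 ∂μ := by
      intro n
      rw [Lp_two_norm_sq]
      refine integral_congr_ae ?_
      filter_upwards [coeFn_boundedMul (hm n) (hC n) φ, coeFn_boundedMul hm' hC' φ,
        Lp.coeFn_sub (boundedMul μ (m n) φ) (boundedMul μ m' φ)] with x e1 e2 e3
      rw [e3, Pi.sub_apply, e1, e2, sub_mul]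
    simp only [h1]
    have h0 : (0 : ℝ) = ∫ x, (0 : ℝ) ∂μ := by simp
    rw [h0]
    refine tendsto_integral_of_dominated_convergence (fun x => (2 * C) ^ 2 * ‖φ x‖ ^ 2) ?_ ?_ ?_ ?_
    · intro n
      exact ((((hm n).sub hm').aestronglyMeasurable.mul (Lp.aestronglyMeasurable φ)).norm.pow 2)
    · exact (Lp_two_integrable_norm_sq φ).const_mul _
    · intro n
      refine Eventually.of_forall fun x => ?_
      rw [norm_pow, norm_norm, norm_mul, mul_pow]
      gcongr
      calc ‖m n x - m' x‖ ≤ ‖m n x‖ + ‖m' x‖ := norm_sub_le _ _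
        _ ≤ 2 * C := by linarith [hC n x, hC' x]
    · refine Eventually.of_forall fun x => ?_
      have h2 : Tendsto (fun n => ‖(m n x - m' x) * φ x‖ ^ 2) atTop
          (𝓝 (‖(m' x - m' x) * φ x‖ ^ 2)) :=
        ((((hlim x).sub_const _).mul_const _).norm).pow 2
      simpa using h2
  have h3 := key.sqrt
  simpa using h3

end Multiplication

/-! ### Independence of the functional calculus of the spectral representation -/

section SpectralMeasure

variable {X : Type} [MeasurableSpace X] {μ : Measure X}

/-- The spectral measure of the vector `φ` for multiplication by `a`: the distribution of `a` under
`|φ|² μ`. -/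
def spectralMeasure (μ : Measure X) (a : X → ℝ) (φ : Lp ℂ 2 μ) : Measure ℝ :=
  (μ.withDensity fun x => ((‖φ x‖₊ ^ 2 : ℝ≥0) : ℝ≥0∞)).map a

instance (a : X → ℝ) (φ : Lp ℂ 2 μ) : IsFiniteMeasure (spectralMeasure μ a φ) := by
  have : IsFiniteMeasure (μ.withDensity fun x => ((‖φ x‖₊ ^ 2 : ℝ≥0) : ℝ≥0∞)) := by
    refine isFiniteMeasure_withDensity ?_
    have h : ∫⁻ x, ((‖φ x‖₊ ^ 2 : ℝ≥0) : ℝ≥0∞) ∂μ = ‖φ‖ₑ ^ 2 := by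
      rw [Lp_two_enorm_sq]
      simp [enorm_eq_nnnorm]
    rw [h]
    exact ENNReal.pow_ne_top enorm_ne_top
  rw [spectralMeasure]
  infer_instance

lemma integral_spectralMeasure {a : X → ℝ} (ha : Measurable a) {f : ℝ → ℂ} (hf : Measurable f)
    {C : ℝ} (hC : ∀ x, ‖f x‖ ≤ C) (φ : Lp ℂ 2 μ) :
    ∫ x, f x ∂spectralMeasure μ a φ = inner ℂ φ (boundedMul μ (fun x => f (a x)) φ) := by
  have hφ : AEMeasurable (fun x => ‖φ x‖₊ ^ 2) μ :=
    (Lp.aestronglyMeasurable φ).aemeasurable.nnnorm.pow_const 2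
  rw [spectralMeasure, integral_map ha.aemeasurable hf.aestronglyMeasurable,
    integral_withDensity_eq_integral_smul₀ hφ, L2.inner_def]
  refine integral_congr_ae ?_
  filter_upwards [coeFn_boundedMul (hf.comp ha) (fun x => hC (a x)) φ] with x hx
  have hx' : (boundedMul μ (fun x => f (a x)) φ) x = f (a x) * φ x := hx
  rw [hx', ← smul_eq_mul (f (a x)), inner_smul_right, inner_self_eq_norm_sq_to_K, NNReal.smul_def]
  simp [mul_comm]

variable {X' : Type} [MeasurableSpace X'] {μ' : Measure X'}

/-- A unitary map which intertwines the unitary groups of two real multiplication operators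
intertwines all bounded functions of them: the characteristic functions of the spectral measures,
hence the spectral measures, agree. -/
lemma intertwine_boundedMul {a : X → ℝ} (ha : Measurable a) {a' : X' → ℝ} (ha' : Measurable a')
    (Q : Lp ℂ 2 μ ≃ₗᵢ[ℂ] Lp ℂ 2 μ')
    (hQ : ∀ (t : ℝ) φ, Q (boundedMul μ (fun x => Complex.exp (t * a x * Complex.I)) φ) =
      boundedMul μ' (fun x => Complex.exp (t * a' x * Complex.I)) (Q φ))
    {f : ℝ → ℂ} (hf : Measurable f) {C : ℝ} (hC : ∀ x, ‖f x‖ ≤ C) (φ : Lp ℂ 2 μ) :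
    Q (boundedMul μ (fun x => f (a x)) φ) = boundedMul μ' (fun x => f (a' x)) (Q φ) := by
  have hm : ∀ φ : Lp ℂ 2 μ, spectralMeasure μ a φ = spectralMeasure μ' a' (Q φ) := by
    intro φ
    refine Measure.ext_of_charFun (funext fun t => ?_)
    have hb : ∀ x : ℝ, ‖Complex.exp (t * x * Complex.I)‖ ≤ 1 := fun x => by
      rw [← Complex.ofReal_mul, Complex.norm_exp_ofReal_mul_I]
    have hmeas : Measurable fun x : ℝ => Complex.exp (t * x * Complex.I) := by fun_prop
    rw [charFun_apply_real, charFun_apply_real, integral_spectralMeasure ha hmeas hb,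
      integral_spectralMeasure ha' hmeas hb, ← hQ, Q.inner_map_map]
  -- equal spectral measures give equal quadratic forms, hence equal operators
  let S : Lp ℂ 2 μ →ₗ[ℂ] Lp ℂ 2 μ := (boundedMul μ (fun x => f (a x))).toLinearMap
  let T : Lp ℂ 2 μ →ₗ[ℂ] Lp ℂ 2 μ := (Q.symm.toLinearEquiv : Lp ℂ 2 μ' →ₗ[ℂ] Lp ℂ 2 μ).comp
    ((boundedMul μ' (fun x => f (a' x))).toLinearMap.comp
      (Q.toLinearEquiv : Lp ℂ 2 μ →ₗ[ℂ] Lp ℂ 2 μ'))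
  have hST : S = T := by
    refine (ext_inner_map S T).1 fun ψ => ?_
    have h1 : inner ℂ ψ (S ψ) = inner ℂ ψ (T ψ) := by
      have h2 : inner ℂ ψ (T ψ) = inner ℂ (Q ψ) (boundedMul μ' (fun x => f (a' x)) (Q ψ)) := by
        rw [← Q.inner_map_map]
        congr 1
        exact Q.apply_symm_apply _
      rw [h2, ← integral_spectralMeasure ha' hf hC, ← hm, integral_spectralMeasure ha hf hC]
      rfl
    rw [← inner_conj_symm, h1, inner_conj_symm]
  have h := congrArg Q (LinearMap.congr_fun hST φ)
  exact h.trans (Q.apply_symm_apply _)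

/-- A unitary map which intertwines the unitary groups of two real multiplication operators
intertwines all Borel functions of them, domains included. -/
lemma intertwine_mulOp {a : X → ℝ} (ha : Measurable a) {a' : X' → ℝ} (ha' : Measurable a')
    (Q : Lp ℂ 2 μ ≃ₗᵢ[ℂ] Lp ℂ 2 μ')
    (hQ : ∀ (t : ℝ) φ, Q (boundedMul μ (fun x => Complex.exp (t * a x * Complex.I)) φ) =
      boundedMul μ' (fun x => Complex.exp (t * a' x * Complex.I)) (Q φ))
    {f : ℝ → ℂ} (hf : Measurable f) {φ χ : Lp ℂ 2 μ} (h : χ =ᵐ[μ] fun x => f (a x) * φ x) :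
    Q χ =ᵐ[μ'] fun x => f (a' x) * Q φ x := by
  -- multiply both sides by the bounded function `p n ∘ a` of the operator, with `p n` supported where
  -- `|f| ≤ n`
  let s : ℕ → Set ℝ := fun n => {x | ‖f x‖ ≤ n}
  have hs : ∀ n, MeasurableSet (s n) := fun n => measurableSet_le hf.norm measurable_const
  let p : ℕ → ℝ → ℂ := fun n => (s n).indicator 1
  have hp : ∀ n, Measurable (p n) := fun n => measurable_one.indicator (hs n)
  have hpC : ∀ n x, ‖p n x‖ ≤ 1 := fun n x => by
    by_cases hx : x ∈ s n <;> simp [p, hx]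
  let q : ℕ → ℝ → ℂ := fun n x => p n x * f x
  have hq : ∀ n, Measurable (q n) := fun n => (hp n).mul hf
  have hqC : ∀ n x, ‖q n x‖ ≤ n := fun n x => by
    by_cases hx : x ∈ s n
    · have hqx : q n x = f x := by simp [q, p, hx]
      rw [hqx]
      exact hx
    · simp [q, p, hx]
  have key : ∀ n : ℕ, ∀ᵐ x ∂μ', p n (a' x) * Q χ x = q n (a' x) * Q φ x := by
    intro n
    have h1 : boundedMul μ (fun x => p n (a x)) χ = boundedMul μ (fun x => q n (a x)) φ := by
      refine boundedMul_eq_of_ae ((hp n).comp ha) (fun x => hpC n (a x)) ?_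
      filter_upwards [coeFn_boundedMul ((hq n).comp ha) (fun x => hqC n (a x)) φ, h] with x e1 e2
      refine Eq.trans e1 ?_
      rw [e2]
      simp only [q, Function.comp]
      ring
    have h2 := congrArg Q h1
    rw [intertwine_boundedMul ha ha' Q hQ (hp n) (hpC n),
      intertwine_boundedMul ha ha' Q hQ (hq n) (hqC n)] at h2
    filter_upwards [coeFn_boundedMul ((hp n).comp ha') (fun x => hpC n (a' x)) (Q χ),
      coeFn_boundedMul ((hq n).comp ha') (fun x => hqC n (a' x)) (Q φ)] with x e1 e2
    refine (e1.symm.trans ?_).trans e2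
    exact congrArg (fun ψ : Lp ℂ 2 μ' => ψ x) h2
  filter_upwards [ae_all_iff.2 key] with x hx
  obtain ⟨n, hn⟩ := exists_nat_ge ‖f (a' x)‖
  have hn' : a' x ∈ s n := hn
  simpa [q, p, hn'] using hx n

/-- A unitary map which intertwines two real multiplication operators, domains included, intertwines
the unitary groups they generate: `exp (i t a)` is the limit of the powers `(1 - i t a / n) ^ (-n)`
of the resolvent. -/
lemma intertwine_exp {a : X → ℝ} (ha : Measurable a) {a' : X' → ℝ} (ha' : Measurable a')
    (Q : Lp ℂ 2 μ ≃ₗᵢ[ℂ] Lp ℂ 2 μ')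
    (hQ : ∀ φ χ : Lp ℂ 2 μ, χ =ᵐ[μ] (fun x => (a x : ℂ) * φ x) →
      Q χ =ᵐ[μ'] fun x => (a' x : ℂ) * Q φ x) (t : ℝ) (φ : Lp ℂ 2 μ) :
    Q (boundedMul μ (fun x => Complex.exp (t * a x * Complex.I)) φ) =
      boundedMul μ' (fun x => Complex.exp (t * a' x * Complex.I)) (Q φ) := by
  -- the function `r s` of the operator is the resolvent `(1 - i s a)⁻¹`
  let r : ℝ → ℝ → ℂ := fun s y => (1 - s * y * Complex.I)⁻¹
  have hr1 : ∀ s y : ℝ, 1 ≤ ‖(1 - s * y * Complex.I : ℂ)‖ := fun s y => by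
    refine le_trans ?_ (Complex.abs_re_le_norm _)
    simp
  have hr0 : ∀ s y : ℝ, (1 - s * y * Complex.I : ℂ) ≠ 0 := fun s y h => by
    have := hr1 s y
    rw [h, norm_zero] at this
    linarith
  have hrC : ∀ s y, ‖r s y‖ ≤ 1 := fun s y => by
    rw [norm_inv]
    exact inv_le_one_of_one_le₀ (hr1 s y)
  have hrm : ∀ s, Measurable (r s) := fun s => by fun_prop
  have hres : ∀ (s : ℝ) (φ : Lp ℂ 2 μ), Q (boundedMul μ (fun x => r s (a x)) φ) =
      boundedMul μ' (fun x => r s (a' x)) (Q φ) := by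
    intro s φ
    rcases eq_or_ne s 0 with rfl | hs
    · have e1 : boundedMul μ (fun x => r 0 (a x)) φ = φ :=
        boundedMul_eq_of_ae ((hrm 0).comp ha) (fun x => hrC 0 (a x)) (by simp [r])
      have e2 : boundedMul μ' (fun x => r 0 (a' x)) (Q φ) = Q φ :=
        boundedMul_eq_of_ae ((hrm 0).comp ha') (fun x => hrC 0 (a' x)) (by simp [r])
      rw [e1, e2]
    · have hsc : (s : ℂ) ≠ 0 := by exact_mod_cast hs
      set χ := boundedMul μ (fun x => r s (a x)) φ with hχ
      have hχ' : χ =ᵐ[μ] fun x => r s (a x) * φ x :=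
        coeFn_boundedMul ((hrm s).comp ha) (fun x => hrC s (a x)) φ
      -- `a χ = (χ - φ) / (i s)` shows that `χ` is in the domain of multiplication by `a`
      have h1 := hQ χ ((s * Complex.I)⁻¹ • (χ - φ)) (by
        filter_upwards [hχ', Lp.coeFn_smul ((s * Complex.I : ℂ)⁻¹) (χ - φ), Lp.coeFn_sub χ φ]
          with x e1 e2 e3
        rw [e2, Pi.smul_apply, e3, Pi.sub_apply, e1, smul_eq_mul]
        rw [inv_mul_eq_iff_eq_mul₀ (mul_ne_zero hsc Complex.I_ne_zero)]
        have hw : (1 - s * a x * Complex.I) * r s (a x) = 1 := mul_inv_cancel₀ (hr0 s (a x))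
        linear_combination φ x * hw)
      symm
      refine boundedMul_eq_of_ae ((hrm s).comp ha') (fun x => hrC s (a' x)) ?_
      rw [map_smul, map_sub] at h1
      filter_upwards [h1, Lp.coeFn_smul ((s * Complex.I : ℂ)⁻¹) (Q χ - Q φ),
        Lp.coeFn_sub (Q χ) (Q φ)] with x e1 e2 e3
      rw [e2, Pi.smul_apply, e3, Pi.sub_apply, smul_eq_mul,
        inv_mul_eq_iff_eq_mul₀ (mul_ne_zero hsc Complex.I_ne_zero)] at e1
      have h0 := hr0 s (a' x)
      change _ = (1 - s * a' x * Complex.I)⁻¹ * _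
      rw [eq_inv_mul_iff_mul_eq₀ h0]
      linear_combination e1
  have hpC : ∀ (n : ℕ) s y, ‖r s y ^ n‖ ≤ 1 := fun n s y => by
    rw [norm_pow]
    exact pow_le_one₀ (norm_nonneg _) (hrC s y)
  have hpow : ∀ (n : ℕ) (s : ℝ), Q (boundedMul μ (fun x => r s (a x) ^ n) φ) =
      boundedMul μ' (fun x => r s (a' x) ^ n) (Q φ) := by
    intro n s
    have haux : ∀ {Y : Type} [MeasurableSpace Y] {ν : Measure Y} {b : Y → ℝ} (hb : Measurable b)
        (ψ : Lp ℂ 2 ν) (n : ℕ), boundedMul ν (fun x => r s (b x) ^ (n + 1)) ψ =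
          boundedMul ν (fun x => r s (b x)) (boundedMul ν (fun x => r s (b x) ^ n) ψ) := by
      intro Y _ ν b hb ψ n
      refine boundedMul_eq_of_ae (((hrm s).comp hb).pow_const (n + 1))
        (fun x => hpC (n + 1) s (b x)) ?_
      filter_upwards [coeFn_boundedMul ((hrm s).comp hb) (fun x => hrC s (b x))
        (boundedMul ν (fun x => r s (b x) ^ n) ψ),
        coeFn_boundedMul (((hrm s).comp hb).pow_const n) (fun x => hpC n s (b x)) ψ] with x e1 e2
      refine e1.trans ?_
      have e2' : (boundedMul ν (fun x => r s (b x) ^ n) ψ) x = r s (b x) ^ n * ψ x := e2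
      rw [e2', pow_succ]
      simp only [Function.comp]
      ring
    induction n with
    | zero =>
      have e1 : boundedMul μ (fun x => r s (a x) ^ 0) φ = φ :=
        boundedMul_eq_of_ae (C := 1) (by fun_prop) (by simp) (by simp)
      have e2 : boundedMul μ' (fun x => r s (a' x) ^ 0) (Q φ) = Q φ :=
        boundedMul_eq_of_ae (C := 1) (by fun_prop) (by simp) (by simp)
      rw [e1, e2]
    | succ n ih => rw [haux ha, haux ha', hres, ih]
  have hlim : ∀ y : ℝ, Tendsto (fun n : ℕ => r (t / n) y ^ n) atTop
      (𝓝 (Complex.exp (t * y * Complex.I))) := by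
    intro y
    have h := (Complex.tendsto_one_add_div_pow_exp (-(t * y * Complex.I))).inv₀
      (Complex.exp_ne_zero _)
    rw [← Complex.exp_neg, neg_neg] at h
    refine h.congr fun n => ?_
    simp only [r, inv_pow]
    congr 2
    push_cast
    ring
  have hE : ∀ y : ℝ, ‖Complex.exp (t * y * Complex.I)‖ ≤ 1 := fun y => by
    rw [← Complex.ofReal_mul, Complex.norm_exp_ofReal_mul_I]
  have l1 := tendsto_boundedMul (μ := μ) (m := fun n x => r (t / (n : ℕ)) (a x) ^ n)
    (fun n => ((hrm _).comp ha).pow_const n) (by fun_prop) (fun n x => hpC n _ (a x))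
    (fun x => hE (a x)) (fun x => hlim (a x)) φ
  have l2 := tendsto_boundedMul (μ := μ') (m := fun n x => r (t / (n : ℕ)) (a' x) ^ n)
    (fun n => ((hrm _).comp ha').pow_const n) (by fun_prop) (fun n x => hpC n _ (a' x))
    (fun x => hE (a' x)) (fun x => hlim (a' x)) (Q φ)
  refine tendsto_nhds_unique ((Q.continuous.tendsto _).comp l1) (l2.congr fun n => ?_)
  exact (hpow n _).symm

end SpectralMeasure

section BorelCalculus

variable {H : Type} [NormedAddCommGroup H] [InnerProductSpace ℂ H]

/-- If a unitary map to some `L²` space turns `T` into multiplication by `a`, then it turns `f(T)`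
into multiplication by `f ∘ a`. -/
theorem mem_graph_borelCalculus {X : Type} [MeasurableSpace X] {μ : Measure X} {a : X → ℝ}
    (ha : Measurable a) (U : H ≃ₗᵢ[ℂ] Lp ℂ 2 μ) {T : H →ₗ.[ℂ] H}
    (hT : T = unitaryConj U (mulOp μ fun x => (a x : ℂ))) {f : ℝ → ℂ} (hf : Measurable f)
    (p : H × H) :
    p ∈ (borelCalculus T f).graph ↔ U p.2 =ᵐ[μ] fun x => f (a x) * U p.1 x := by
  have hne : Nonempty (SpectralRepresentation T) := ⟨⟨X, inferInstance, μ, a, ha, U, hT⟩⟩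
  rw [borelCalculus, dif_pos hne]
  set R := hne.some
  let := R.mX
  change p ∈ (unitaryConj R.U (mulOp R.μ fun x => f (R.a x))).graph ↔ _
  rw [mem_graph_unitaryConj, mem_graph_mulOp]
  have hgr : ∀ q : H × H, (R.U q.2 =ᵐ[R.μ] fun x => (R.a x : ℂ) * R.U q.1 x) ↔
      U q.2 =ᵐ[μ] fun x => (a x : ℂ) * U q.1 x := by
    intro q
    have e : (unitaryConj R.U (mulOp R.μ fun x => (R.a x : ℂ))).graph =
        (unitaryConj U (mulOp μ fun x => (a x : ℂ))).graph :=
      congrArg LinearPMap.graph (R.eq_conj.symm.trans hT)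
    have h1 := mem_graph_unitaryConj R.U (mulOp R.μ fun x => (R.a x : ℂ)) q
    rw [e, mem_graph_unitaryConj, mem_graph_mulOp, mem_graph_mulOp] at h1
    exact h1.symm
  constructor
  · intro h
    have := intertwine_mulOp R.measurable_a ha (R.U.symm.trans U)
      (intertwine_exp R.measurable_a ha _ fun φ χ hφ => by
        have := (hgr (R.U.symm φ, R.U.symm χ)).1 (by simpa using hφ)
        simpa using this) hf h
    simpa using this
  · intro h
    have := intertwine_mulOp ha R.measurable_a (U.symm.trans R.U)
      (intertwine_exp ha R.measurable_a _ fun φ χ hφ => by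
        have := (hgr (U.symm φ, U.symm χ)).2 (by simpa using hφ)
        simpa using this) hf h
    simpa using this

end BorelCalculus

/-! ### The Fourier transform on `L²(ℝ)` -/

section LineFourier

open scoped FourierTransform

/-- `L²(ℝ)` with Lebesgue measure. -/
abbrev LineL2 : Type := Lp ℂ 2 (volume : Measure ℝ)

/-- The unitary Fourier transform of `L²(ℝ)`, with the kernel `exp (-2π i x ξ)`. -/
abbrev lineFourier : LineL2 ≃ₗᵢ[ℂ] LineL2 := Lp.fourierTransformₗᵢ ℝ ℂ

lemma integrable_fourier_swap {f g : ℝ → ℂ} (hf : Integrable f) (hg : Integrable g) :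
    ∫ x, 𝓕 f x • g x = ∫ x, f x • 𝓕 g x := by
  simpa using! VectorFourier.integral_fourierIntegral_smul_eq_flip (L := innerₗ ℝ)
    Real.continuous_fourierChar continuous_inner hf hg

lemma fourier_continuous_of_integrable {f : ℝ → ℂ} (hf : Integrable f) : Continuous (𝓕 f) :=
  VectorFourier.fourierIntegral_continuous Real.continuous_fourierChar continuous_inner hf

lemma fourierInv_continuous_of_integrable {f : ℝ → ℂ} (hf : Integrable f) :
    Continuous (𝓕⁻ f) := by
  have h : 𝓕⁻ f = fun x => 𝓕 f (-x) := funext fun x => Real.fourierInv_eq_fourier_neg f x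
  rw [h]
  exact (fourier_continuous_of_integrable hf).comp continuous_neg

open scoped ContDiff in
/-- On `L¹ ∩ L²` the Fourier transform is given by the Fourier integral. -/
lemma coeFn_lineFourier {φ : LineL2} (hφ : Integrable φ) : lineFourier φ =ᵐ[volume] 𝓕 (φ : ℝ → ℂ) := by
  refine ae_eq_of_integral_contDiff_smul_eq
    ((Lp.memLp (lineFourier φ)).locallyIntegrable (by norm_num))
    (fourier_continuous_of_integrable hφ).locallyIntegrable fun g hg hgc => ?_
  have hg₁ : HasCompactSupport (Complex.ofRealCLM ∘ g) := hgc.comp_left rfl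
  have hg₂ : ContDiff ℝ ∞ (Complex.ofRealCLM ∘ g) := by fun_prop
  set s := hg₁.toSchwartzMap hg₂ with hs
  have hsx : ∀ x, s x = g x := fun x => rfl
  have h1 : ∫ x, g x • lineFourier φ x = ∫ x, 𝓕 s x • φ x := by
    have h := congrArg (fun T => T s) (Lp.fourier_toTemperedDistribution_eq φ)
    simp only [TemperedDistribution.fourier_apply, Lp.toTemperedDistribution_apply] at h
    rw [h]
    rfl
  rw [h1, SchwartzMap.fourier_coe, integrable_fourier_swap s.integrable hφ]
  rfl

/-- Reflection `φ(x) ↦ φ(-x)` on `L²(ℝ)`. -/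
def lineReflection : LineL2 →L[ℂ] LineL2 :=
  (Lp.compMeasurePreservingₗᵢ ℂ (fun x : ℝ => -x)
    (Measure.measurePreserving_neg (volume : Measure ℝ))).toContinuousLinearMap

lemma coeFn_lineReflection (φ : LineL2) : lineReflection φ =ᵐ[volume] fun x => φ (-x) :=
  Lp.coeFn_compMeasurePreserving φ (Measure.measurePreserving_neg (volume : Measure ℝ))

/-- Translation `φ(x) ↦ φ(x + t)` on `L²(ℝ)`. -/
def lineTranslation (t : ℝ) : LineL2 →L[ℂ] LineL2 :=
  (Lp.compMeasurePreservingₗᵢ ℂ (fun x : ℝ => x + t)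
    (measurePreserving_add_right (volume : Measure ℝ) t)).toContinuousLinearMap

lemma coeFn_lineTranslation (t : ℝ) (φ : LineL2) :
    lineTranslation t φ =ᵐ[volume] fun x => φ (x + t) :=
  Lp.coeFn_compMeasurePreserving φ (measurePreserving_add_right (volume : Measure ℝ) t)

lemma lineReflection_lineReflection (φ : LineL2) : lineReflection (lineReflection φ) = φ := by
  refine Lp.ext ?_
  filter_upwards [coeFn_lineReflection (lineReflection φ),
    (Measure.measurePreserving_neg (volume : Measure ℝ)).quasiMeasurePreserving.ae_eq
      (coeFn_lineReflection φ)] with x e1 e2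
  rw [e1]
  refine Eq.trans e2 ?_
  simp

lemma eq_of_eqOn_schwartz {S T : LineL2 →L[ℂ] LineL2}
    (h : ∀ s : SchwartzMap ℝ ℂ, S (s.toLp 2) = T (s.toLp 2)) (φ : LineL2) : S φ = T φ := by
  have hd := SchwartzMap.denseRange_toLpCLM (E := ℝ) (F := ℂ) (p := 2)
    (μ := (volume : Measure ℝ)) ENNReal.ofNat_ne_top
  exact congrFun (hd.equalizer S.continuous T.continuous (funext h)) φ

lemma lineFourier_symm_eq (φ : LineL2) : lineFourier.symm φ = lineReflection (lineFourier φ) := by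
  refine eq_of_eqOn_schwartz (S := (lineFourier.symm : LineL2 →L[ℂ] LineL2))
    (T := lineReflection ∘L (lineFourier : LineL2 →L[ℂ] LineL2)) (fun s => ?_) φ
  have h1 : lineFourier.symm (s.toLp 2) = (𝓕⁻ s).toLp 2 := SchwartzMap.toLp_fourierInv_eq s
  have h2 : lineFourier (s.toLp 2) = (𝓕 s).toLp 2 := SchwartzMap.toLp_fourier_eq s
  change lineFourier.symm (s.toLp 2) = lineReflection (lineFourier (s.toLp 2))
  rw [h1, h2]
  refine Lp.ext ?_
  filter_upwards [coeFn_lineReflection ((𝓕 s).toLp 2), (𝓕⁻ s).coeFn_toLp 2 volume,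
    (Measure.measurePreserving_neg (volume : Measure ℝ)).quasiMeasurePreserving.ae_eq
      ((𝓕 s).coeFn_toLp 2 volume)] with x e1 e2 e3
  rw [e1, e2]
  refine Eq.trans ?_ e3.symm
  rw [SchwartzMap.fourierInv_coe, Real.fourierInv_eq_fourier_neg, Function.comp, SchwartzMap.fourier_coe]

lemma coeFn_lineFourier_symm {φ : LineL2} (hφ : Integrable φ) :
    lineFourier.symm φ =ᵐ[volume] 𝓕⁻ (φ : ℝ → ℂ) := by
  rw [lineFourier_symm_eq]
  filter_upwards [coeFn_lineReflection (lineFourier φ),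
    (Measure.measurePreserving_neg (volume : Measure ℝ)).quasiMeasurePreserving.ae_eq
      (coeFn_lineFourier hφ)] with x e1 e2
  rw [e1, Real.fourierInv_eq_fourier_neg]
  exact e2

lemma integrable_toLp (s : SchwartzMap ℝ ℂ) : Integrable (s.toLp 2 : LineL2) :=
  s.integrable.congr (s.coeFn_toLp 2 volume).symm

lemma lineFourier_lineReflection (φ : LineL2) :
    lineFourier (lineReflection φ) = lineFourier.symm φ := by
  refine eq_of_eqOn_schwartz (S := (lineFourier : LineL2 →L[ℂ] LineL2) ∘L lineReflection)
    (T := (lineFourier.symm : LineL2 →L[ℂ] LineL2)) (fun s => ?_) φ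
  have hi := integrable_toLp s
  have hc := coeFn_lineReflection (s.toLp 2)
  have hi' : Integrable (lineReflection (s.toLp 2)) := hi.comp_neg.congr hc.symm
  refine Lp.ext ((coeFn_lineFourier hi').trans (EventuallyEq.trans ?_ (coeFn_lineFourier_symm hi).symm))
  refine Eventually.of_forall fun x => ?_
  rw [Real.fourier_congr_ae hc, Real.fourierInv_eq_fourier_comp_neg]

lemma lineFourier_lineFourier (φ : LineL2) : lineFourier (lineFourier φ) = lineReflection φ := by
  have h := lineFourier_symm_eq (lineFourier φ)
  rw [LinearIsometryEquiv.symm_apply_apply] at h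
  have h2 := congrArg lineReflection h
  rw [lineReflection_lineReflection] at h2
  exact h2.symm

/-- The Fourier transform turns translations into multiplication by characters. -/
lemma lineFourier_lineTranslation (t : ℝ) (φ : LineL2) :
    lineFourier (lineTranslation t φ) =
      boundedMul volume (fun ξ : ℝ => Complex.exp (t * (2 * Real.pi * ξ : ℝ) * Complex.I))
        (lineFourier φ) := by
  have hC : ∀ x : ℝ, ‖Complex.exp (t * (2 * Real.pi * x : ℝ) * Complex.I)‖ ≤ 1 := fun x => by
    rw [← Complex.ofReal_mul, Complex.norm_exp_ofReal_mul_I]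
  refine eq_of_eqOn_schwartz (S := (lineFourier : LineL2 →L[ℂ] LineL2) ∘L lineTranslation t)
    (T := boundedMul volume _ ∘L (lineFourier : LineL2 →L[ℂ] LineL2)) (fun s => ?_) φ
  have hi := integrable_toLp s
  have hc := coeFn_lineTranslation t (s.toLp 2)
  have hi' : Integrable (lineTranslation t (s.toLp 2)) := (hi.comp_add_right t).congr hc.symm
  refine Lp.ext ((coeFn_lineFourier hi').trans ?_)
  filter_upwards [coeFn_boundedMul (μ := volume) (by fun_prop) hC (lineFourier (s.toLp 2)),
    coeFn_lineFourier hi] with ξ e1 e2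
  refine Eq.trans ?_ e1.symm
  rw [e2, Real.fourier_congr_ae hc, Real.fourier_real_eq_integral_exp_smul,
    Real.fourier_real_eq_integral_exp_smul, ← integral_const_mul]
  refine Eq.trans ?_ (integral_add_right_eq_self (fun x : ℝ =>
    Complex.exp (t * (2 * Real.pi * ξ : ℝ) * Complex.I) *
      (Complex.exp ((-2 * Real.pi * x * ξ : ℝ) * Complex.I) • (s.toLp 2 : LineL2) x)) t)
  refine integral_congr_ae (Eventually.of_forall fun x => ?_)
  simp only [smul_eq_mul]
  rw [← mul_assoc, ← Complex.exp_add]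
  congr 2
  push_cast
  ring

end LineFourier

/-! ### The cosine transform on `L²(ℝ₊)` -/

section CosineTransform

open scoped FourierTransform

/-- Restriction of functions from the line to the half-line. -/
def halfRestrict : LineL2 →L[ℂ] HalfLineL2 := LpToLpRestrictCLM ℝ ℂ ℂ volume 2 (Ioi 0)

lemma coeFn_halfRestrict (φ : LineL2) :
    halfRestrict φ =ᵐ[volume.restrict (Ioi 0)] φ :=
  LpToLpRestrictCLM_coeFn ℂ (Ioi 0) φ

/-- Extension by zero of functions from the half-line to the line, as the adjoint of
restriction. -/
def halfExtend : HalfLineL2 →L[ℂ] LineL2 := ContinuousLinearMap.adjoint halfRestrict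

lemma coeFn_halfExtend (φ : HalfLineL2) :
    halfExtend φ =ᵐ[volume] (Ioi (0 : ℝ)).indicator φ := by
  have hm : MemLp ((Ioi (0 : ℝ)).indicator φ) 2 volume :=
    (memLp_indicator_iff_restrict measurableSet_Ioi).2 (Lp.memLp φ)
  have h : halfExtend φ = hm.toLp := by
    refine ext_inner_right ℂ fun ψ => ?_
    rw [halfExtend, ContinuousLinearMap.adjoint_inner_left, L2.inner_def, L2.inner_def]
    rw [← integral_indicator measurableSet_Ioi]
    have h1 := (ae_restrict_iff' measurableSet_Ioi).1 (coeFn_halfRestrict ψ)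
    refine integral_congr_ae ?_
    filter_upwards [h1, hm.coeFn_toLp] with x e1 e2
    rw [e2]
    by_cases hx : x ∈ Ioi (0 : ℝ)
    · rw [indicator_of_mem hx, indicator_of_mem hx, e1 hx]
    · rw [indicator_of_notMem hx, indicator_of_notMem hx, inner_zero_left]
  rw [h]
  exact hm.coeFn_toLp

lemma halfRestrict_halfExtend (φ : HalfLineL2) : halfRestrict (halfExtend φ) = φ := by
  refine Lp.ext ?_
  filter_upwards [coeFn_halfRestrict (halfExtend φ), ae_restrict_of_ae (coeFn_halfExtend φ),
    ae_restrict_mem measurableSet_Ioi] with x e1 e2 hx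
  rw [e1, e2, indicator_of_mem hx]

lemma coeFn_halfExtend_halfRestrict (φ : LineL2) :
    halfExtend (halfRestrict φ) =ᵐ[volume] (Ioi (0 : ℝ)).indicator φ := by
  filter_upwards [coeFn_halfExtend (halfRestrict φ),
    (ae_restrict_iff' measurableSet_Ioi).1 (coeFn_halfRestrict φ)] with x e1 e2
  rw [e1]
  by_cases hx : x ∈ Ioi (0 : ℝ)
  · rw [indicator_of_mem hx, indicator_of_mem hx, e2 hx]
  · rw [indicator_of_notMem hx, indicator_of_notMem hx]

lemma halfRestrict_lineReflection_halfExtend (φ : HalfLineL2) :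
    halfRestrict (lineReflection (halfExtend φ)) = 0 := by
  refine Lp.ext ?_
  filter_upwards [coeFn_halfRestrict (lineReflection (halfExtend φ)),
    ae_restrict_of_ae (coeFn_lineReflection (halfExtend φ)),
    ae_restrict_of_ae ((Measure.measurePreserving_neg
      (volume : Measure ℝ)).quasiMeasurePreserving.ae_eq (coeFn_halfExtend φ)),
    ae_restrict_mem measurableSet_Ioi, Lp.coeFn_zero ℂ 2 (volume.restrict (Ioi (0 : ℝ)))]
    with x e1 e2 e3 hx e4
  rw [e1, e2, e4]
  refine Eq.trans e3 ?_
  have hx : 0 < x := hx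
  exact indicator_of_notMem (by simp only [mem_Ioi]; linarith) _

/-- Twice the even part of the Fourier transform of the extension by zero. -/
def evenFourier (φ : HalfLineL2) : LineL2 :=
  lineFourier (halfExtend φ) + lineFourier.symm (halfExtend φ)

lemma lineReflection_evenFourier (φ : HalfLineL2) :
    lineReflection (evenFourier φ) = evenFourier φ := by
  rw [evenFourier, map_add, lineFourier_symm_eq, lineReflection_lineReflection, add_comm]

/-- The cosine transform as a bounded operator. -/
def cosineOp : HalfLineL2 →L[ℂ] HalfLineL2 :=
  halfRestrict ∘L ((lineFourier : LineL2 →L[ℂ] LineL2) + (lineFourier.symm : LineL2 →L[ℂ] LineL2))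
    ∘L halfExtend

lemma cosineOp_apply (φ : HalfLineL2) : cosineOp φ = halfRestrict (evenFourier φ) := rfl

lemma cosineOp_cosineOp (φ : HalfLineL2) : cosineOp (cosineOp φ) = φ := by
  set e := evenFourier φ with he
  set p := halfExtend (cosineOp φ) with hp
  have hpe : p + lineReflection p = e := by
    have h1 : p =ᵐ[volume] (Ioi (0 : ℝ)).indicator e := coeFn_halfExtend_halfRestrict e
    have h2 : (e : ℝ → ℂ) =ᵐ[volume] fun x => e (-x) := by
      have := coeFn_lineReflection e
      rwa [he, lineReflection_evenFourier, ← he] at this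
    refine Lp.ext ?_
    filter_upwards [h1, h2, (Measure.measurePreserving_neg
      (volume : Measure ℝ)).quasiMeasurePreserving.ae_eq h1, coeFn_lineReflection p,
      Lp.coeFn_add p (lineReflection p), compl_mem_ae_iff.2 (measure_singleton (0 : ℝ))]
      with x e1 e2 e3 e4 e5 hx
    have e3' : p (-x) = (Ioi (0 : ℝ)).indicator e (-x) := e3
    rw [e5, Pi.add_apply, e4, e1, e3']
    rcases lt_trichotomy x 0 with h | h | h
    · rw [indicator_of_notMem (by simp only [mem_Ioi]; linarith),
        indicator_of_mem (by simp only [mem_Ioi]; linarith), ← e2, zero_add]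
    · exact absurd h hx
    · rw [indicator_of_mem (by simp only [mem_Ioi]; linarith),
        indicator_of_notMem (by simp only [mem_Ioi]; linarith), add_zero]
  have h3 : evenFourier (cosineOp φ) = lineFourier e := by
    rw [evenFourier, ← hp, ← lineFourier_lineReflection, ← map_add, hpe]
  rw [cosineOp_apply, h3, he, evenFourier, map_add, lineFourier_lineFourier,
    LinearIsometryEquiv.apply_symm_apply, map_add, halfRestrict_lineReflection_halfExtend,
    halfRestrict_halfExtend, zero_add]

lemma inner_cosineOp_left (φ ψ : HalfLineL2) :
    inner ℂ (cosineOp φ) ψ = inner ℂ φ (cosineOp ψ) := by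
  have hadj : ∀ x : LineL2, inner ℂ (halfRestrict x) ψ = inner ℂ x (halfExtend ψ) := fun x => by
    rw [halfExtend, ContinuousLinearMap.adjoint_inner_right]
  have hadj' : ∀ x : LineL2, inner ℂ φ (halfRestrict x) = inner ℂ (halfExtend φ) x := fun x => by
    rw [halfExtend, ContinuousLinearMap.adjoint_inner_left]
  rw [cosineOp_apply, cosineOp_apply, hadj, hadj', evenFourier, evenFourier, inner_add_left,
    inner_add_right, add_comm]
  congr 1
  · rw [← lineFourier.inner_map_map, LinearIsometryEquiv.apply_symm_apply]
  · rw [← lineFourier.inner_map_map (halfExtend φ), LinearIsometryEquiv.apply_symm_apply]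

/-- The cosine transform `φ ↦ (x ↦ 2 ∫₀^∞ cos (2π k x) φ(k) dk)` on `L²(ℝ₊)`, a unitary
involution. -/
def cosineTransform : HalfLineL2 ≃ₗᵢ[ℂ] HalfLineL2 where
  toLinearEquiv := LinearEquiv.ofInvolutive (cosineOp : HalfLineL2 →ₗ[ℂ] HalfLineL2)
    cosineOp_cosineOp
  norm_map' φ := by
    have h : inner ℂ (cosineOp φ) (cosineOp φ) = inner ℂ φ φ := by
      rw [inner_cosineOp_left, cosineOp_cosineOp]
    have h2 : ‖cosineOp φ‖ ^ 2 = ‖φ‖ ^ 2 := by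
      rw [inner_self_eq_norm_sq_to_K, inner_self_eq_norm_sq_to_K] at h
      exact_mod_cast h
    exact (sq_eq_sq₀ (norm_nonneg _) (norm_nonneg _)).1 h2

lemma cosineTransform_apply (φ : HalfLineL2) : cosineTransform φ = cosineOp φ := rfl

lemma cosineTransform_cosineTransform (φ : HalfLineL2) :
    cosineTransform (cosineTransform φ) = φ := cosineOp_cosineOp φ

lemma coeFn_cosineTransform {φ : HalfLineL2} (hφ : IntegrableOn φ (Ioi 0)) :
    cosineTransform φ =ᵐ[volume.restrict (Ioi 0)]
      fun x => ∫ k in Ioi (0 : ℝ), (2 * Real.cos (2 * Real.pi * k * x) : ℝ) * φ k := by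
  have hi : Integrable (halfExtend φ) :=
    ((integrable_indicator_iff measurableSet_Ioi).2 hφ).congr (coeFn_halfExtend φ).symm
  rw [cosineTransform_apply, cosineOp_apply]
  filter_upwards [coeFn_halfRestrict (evenFourier φ), ae_restrict_of_ae (coeFn_lineFourier hi),
    ae_restrict_of_ae (coeFn_lineFourier_symm hi), ae_restrict_of_ae (Lp.coeFn_add
      (lineFourier (halfExtend φ)) (lineFourier.symm (halfExtend φ)))] with x e1 e2 e3 e4
  rw [e1, evenFourier, e4, Pi.add_apply, e2, e3, Real.fourierInv_eq_fourier_neg,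
    Real.fourier_congr_ae (coeFn_halfExtend φ), Real.fourier_congr_ae (coeFn_halfExtend φ),
    Real.fourier_real_eq_integral_exp_smul, Real.fourier_real_eq_integral_exp_smul,
    ← integral_indicator measurableSet_Ioi, ← integral_add]
  · refine integral_congr_ae (Eventually.of_forall fun k => ?_)
    by_cases hk : k ∈ Ioi (0 : ℝ)
    · simp only [indicator_of_mem hk, smul_eq_mul]
      rw [← add_mul]
      congr 1
      push_cast
      rw [Complex.two_cos, add_comm]
      congr 2 <;> ring
    · simp only [indicator_of_notMem hk, smul_zero, add_zero]
  all_goals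
    refine Integrable.bdd_mul (c := 1) ((integrable_indicator_iff measurableSet_Ioi).2 hφ)
      (by fun_prop) (Eventually.of_forall fun k => ?_)
    rw [Complex.norm_exp_ofReal_mul_I]

end CosineTransform

/-! ### Logarithmic coordinates -/

section LogCoordinates

open scoped FourierTransform

lemma lintegral_Ioi_eq_lintegral_exp (h : ℝ → ℝ≥0∞) :
    ∫⁻ x in Ioi (0 : ℝ), h x = ∫⁻ y, ENNReal.ofReal (Real.exp y) * h (Real.exp y) := by
  have := lintegral_image_eq_lintegral_abs_deriv_mul (s := univ) (f := Real.exp) (f' := Real.exp)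
    MeasurableSet.univ (fun x _ => (Real.hasDerivAt_exp x).hasDerivWithinAt)
    Real.exp_injective.injOn h
  simpa [Real.range_exp, abs_of_pos (Real.exp_pos _)] using this

lemma integral_Ioi_eq_integral_exp (h : ℝ → ℂ) :
    ∫ x in Ioi (0 : ℝ), h x = ∫ y, Real.exp y * h (Real.exp y) := by
  have := integral_image_eq_integral_abs_deriv_smul (s := univ) (f := Real.exp) (f' := Real.exp)
    MeasurableSet.univ (fun x _ => (Real.hasDerivAt_exp x).hasDerivWithinAt)
    Real.exp_injective.injOn h
  simpa [Real.range_exp, abs_of_pos (Real.exp_pos _)] using this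

lemma integrableOn_Ioi_iff_integrable_exp (h : ℝ → ℂ) :
    IntegrableOn h (Ioi (0 : ℝ)) ↔ Integrable fun y => (Real.exp y : ℂ) * h (Real.exp y) := by
  have := integrableOn_image_iff_integrableOn_abs_deriv_smul (s := univ) (f := Real.exp)
    (f' := Real.exp) MeasurableSet.univ (fun x _ => (Real.hasDerivAt_exp x).hasDerivWithinAt)
    Real.exp_injective.injOn h
  simpa [Real.range_exp, abs_of_pos (Real.exp_pos _)] using this

lemma quasiMeasurePreserving_exp :
    Measure.QuasiMeasurePreserving Real.exp volume (volume.restrict (Ioi (0 : ℝ))) := by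
  refine ⟨Real.measurable_exp, Measure.AbsolutelyContinuous.mk fun s hs h => ?_⟩
  rw [Measure.map_apply Real.measurable_exp hs]
  rw [← lintegral_indicator_one hs, lintegral_Ioi_eq_lintegral_exp,
    lintegral_eq_zero_iff (by
      have : Measurable (s.indicator (1 : ℝ → ℝ≥0∞)) := measurable_one.indicator hs
      fun_prop)] at h
  rw [measure_eq_zero_iff_ae_notMem]
  filter_upwards [h] with y hy hys
  have hys' : Real.exp y ∈ s := hys
  simp [hys'] at hy
  exact absurd hy (not_le.2 (Real.exp_pos y))

lemma quasiMeasurePreserving_log :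
    Measure.QuasiMeasurePreserving Real.log (volume.restrict (Ioi (0 : ℝ))) volume := by
  refine ⟨Real.measurable_log, Measure.AbsolutelyContinuous.mk fun s hs h => ?_⟩
  rw [Measure.map_apply Real.measurable_log hs,
    ← lintegral_indicator_one (Real.measurable_log hs), lintegral_Ioi_eq_lintegral_exp]
  refine (lintegral_congr_ae ?_).trans lintegral_zero
  filter_upwards [measure_eq_zero_iff_ae_notMem.1 h] with y hy
  simp [indicator, hy]

lemma memLp_two_iff_lintegral {X : Type} [MeasurableSpace X] {μ : Measure X} {f : X → ℂ}
    (hf : AEStronglyMeasurable f μ) : MemLp f 2 μ ↔ ∫⁻ x, ‖f x‖ₑ ^ 2 ∂μ < ∞ := by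
  rw [MemLp, and_iff_right hf,
    eLpNorm_lt_top_iff_lintegral_rpow_enorm_lt_top (by norm_num) (by norm_num)]
  norm_num

lemma lintegral_exp_half (ψ : ℝ → ℂ) :
    ∫⁻ y, ‖(Real.exp (y / 2) : ℂ) * ψ (Real.exp y)‖ₑ ^ 2 = ∫⁻ x in Ioi (0 : ℝ), ‖ψ x‖ₑ ^ 2 := by
  rw [lintegral_Ioi_eq_lintegral_exp]
  refine lintegral_congr fun y => ?_
  rw [enorm_mul, mul_pow]
  congr 1
  rw [← ofReal_norm, Complex.norm_real, Real.norm_of_nonneg (Real.exp_pos _).le,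
    ← ENNReal.ofReal_pow (Real.exp_pos _).le, ← Real.exp_nat_mul]
  congr 2
  push_cast
  ring

lemma memLp_exp_half (ψ : HalfLineL2) :
    MemLp (fun y => (Real.exp (y / 2) : ℂ) * ψ (Real.exp y)) 2 volume := by
  have hm : AEStronglyMeasurable (fun y => (Real.exp (y / 2) : ℂ) * ψ (Real.exp y)) volume := by
    refine AEStronglyMeasurable.mul (by fun_prop) ?_
    exact (Lp.aestronglyMeasurable ψ).comp_quasiMeasurePreserving quasiMeasurePreserving_exp
  rw [memLp_two_iff_lintegral hm, lintegral_exp_half, ← Lp_two_enorm_sq]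
  exact ENNReal.pow_lt_top enorm_lt_top

lemma memLp_log_half (φ : LineL2) :
    MemLp (fun x => (Real.exp (-Real.log x / 2) : ℂ) * φ (Real.log x)) 2
      (volume.restrict (Ioi (0 : ℝ))) := by
  have hm : AEStronglyMeasurable (fun x => (Real.exp (-Real.log x / 2) : ℂ) * φ (Real.log x))
      (volume.restrict (Ioi (0 : ℝ))) := by
    refine AEStronglyMeasurable.mul
      (Measurable.aestronglyMeasurable (by fun_prop)) ?_
    exact (Lp.aestronglyMeasurable φ).comp_quasiMeasurePreserving quasiMeasurePreserving_log
  rw [memLp_two_iff_lintegral hm, ← lintegral_exp_half]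
  have h : ∀ y : ℝ, (Real.exp (y / 2) : ℂ) * ((Real.exp (-Real.log (Real.exp y) / 2) : ℂ) *
      φ (Real.log (Real.exp y))) = φ y := fun y => by
    rw [Real.log_exp, ← mul_assoc, ← Complex.ofReal_mul, ← Real.exp_add]
    simp [neg_div]
  simp only [h]
  rw [← Lp_two_enorm_sq]
  exact ENNReal.pow_lt_top enorm_lt_top

/-- The unitary map `ψ ↦ (y ↦ exp (y / 2) ψ(exp y))` from `L²(ℝ₊)` to `L²(ℝ)`. -/
def logUnitary : HalfLineL2 ≃ₗᵢ[ℂ] LineL2 where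
  toFun ψ := (memLp_exp_half ψ).toLp _
  invFun φ := (memLp_log_half φ).toLp _
  map_add' ψ ψ' := by
    rw [← MemLp.toLp_add, MemLp.toLp_eq_toLp_iff]
    filter_upwards [quasiMeasurePreserving_exp.ae_eq (Lp.coeFn_add ψ ψ')] with y hy
    have hy' : (ψ + ψ') (Real.exp y) = ψ (Real.exp y) + ψ' (Real.exp y) := hy
    simp only [Pi.add_apply, hy', mul_add]
  map_smul' c ψ := by
    rw [RingHom.id_apply, ← MemLp.toLp_const_smul, MemLp.toLp_eq_toLp_iff]
    filter_upwards [quasiMeasurePreserving_exp.ae_eq (Lp.coeFn_smul c ψ)] with y hy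
    have hy' : (c • ψ : HalfLineL2) (Real.exp y) = c * ψ (Real.exp y) := hy
    simp only [Pi.smul_apply, hy', smul_eq_mul]
    ring
  left_inv ψ := by
    refine Lp.ext ?_
    filter_upwards [(memLp_log_half ((memLp_exp_half ψ).toLp _)).coeFn_toLp,
      quasiMeasurePreserving_log.ae_eq (memLp_exp_half ψ).coeFn_toLp,
      ae_restrict_mem measurableSet_Ioi] with x e1 e2 hx
    have hx : 0 < x := hx
    have e2' : ((memLp_exp_half ψ).toLp _ : LineL2) (Real.log x) =
      (Real.exp (Real.log x / 2) : ℂ) * ψ (Real.exp (Real.log x)) := e2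
    rw [e1, e2', Real.exp_log hx, ← mul_assoc, ← Complex.ofReal_mul, ← Real.exp_add]
    simp [neg_div]
  right_inv φ := by
    refine Lp.ext ?_
    filter_upwards [(memLp_exp_half ((memLp_log_half φ).toLp _)).coeFn_toLp,
      quasiMeasurePreserving_exp.ae_eq (memLp_log_half φ).coeFn_toLp] with y e1 e2
    have e2' : ((memLp_log_half φ).toLp _ : HalfLineL2) (Real.exp y) =
      (Real.exp (-Real.log (Real.exp y) / 2) : ℂ) * φ (Real.log (Real.exp y)) := e2
    rw [e1, e2', Real.log_exp, ← mul_assoc, ← Complex.ofReal_mul, ← Real.exp_add]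
    simp [neg_div]
  norm_map' ψ := by
    have h : ‖(memLp_exp_half ψ).toLp _‖ₑ ^ 2 = ‖ψ‖ₑ ^ 2 := by
      rw [Lp_two_enorm_sq, Lp_two_enorm_sq, ← lintegral_exp_half]
      refine lintegral_congr_ae ?_
      filter_upwards [(memLp_exp_half ψ).coeFn_toLp] with y hy
      rw [hy]
    have h2 : ‖(memLp_exp_half ψ).toLp _‖ₑ = ‖ψ‖ₑ := (ENNReal.pow_right_strictMono two_ne_zero).injective h
    exact enorm_eq_iff_norm_eq.1 h2

lemma coeFn_logUnitary (ψ : HalfLineL2) :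
    logUnitary ψ =ᵐ[volume] fun y => (Real.exp (y / 2) : ℂ) * ψ (Real.exp y) :=
  (memLp_exp_half ψ).coeFn_toLp

lemma coeFn_logUnitary_symm (φ : LineL2) :
    logUnitary.symm φ =ᵐ[volume.restrict (Ioi 0)]
      fun x => (Real.exp (-Real.log x / 2) : ℂ) * φ (Real.log x) :=
  (memLp_log_half φ).coeFn_toLp

/-- The cosine transform in logarithmic coordinates. -/
def logCosine : LineL2 ≃ₗᵢ[ℂ] LineL2 :=
  logUnitary.symm.trans (cosineTransform.trans logUnitary)

/-- In logarithmic coordinates the integral kernel of the cosine transform depends on `y + y'`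
only. -/
lemma coeFn_logCosine {φ : LineL2} (hφ : Integrable fun y => (Real.exp (y / 2) : ℂ) * φ y) :
    logCosine φ =ᵐ[volume] fun y => ∫ y', (2 * Real.exp ((y + y') / 2) *
      Real.cos (2 * Real.pi * Real.exp (y + y')) : ℝ) * φ y' := by
  have hs : ∀ᵐ y, logUnitary.symm φ (Real.exp y) = (Real.exp (-y / 2) : ℂ) * φ y := by
    filter_upwards [quasiMeasurePreserving_exp.ae_eq (coeFn_logUnitary_symm φ)] with y hy
    refine Eq.trans hy ?_
    simp only [Function.comp, Real.log_exp]
  have hhalf : ∀ y : ℝ, (Real.exp y : ℂ) * (Real.exp (-y / 2) : ℂ) = (Real.exp (y / 2) : ℂ) := by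
    intro y
    rw [← Complex.ofReal_mul, ← Real.exp_add]
    congr 2
    ring
  have hi : IntegrableOn (logUnitary.symm φ) (Ioi 0) := by
    rw [integrableOn_Ioi_iff_integrable_exp]
    refine hφ.congr ?_
    filter_upwards [hs] with y hy
    rw [hy, ← mul_assoc, hhalf]
  change logUnitary (cosineTransform (logUnitary.symm φ)) =ᵐ[volume] _
  filter_upwards [coeFn_logUnitary (cosineTransform (logUnitary.symm φ)),
    quasiMeasurePreserving_exp.ae_eq (coeFn_cosineTransform hi)] with y e1 e2
  have e2' : cosineTransform (logUnitary.symm φ) (Real.exp y) = ∫ k in Ioi (0 : ℝ),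
    (2 * Real.cos (2 * Real.pi * k * Real.exp y) : ℝ) * logUnitary.symm φ k := e2
  rw [e1, e2', integral_Ioi_eq_integral_exp, ← integral_const_mul]
  refine integral_congr_ae ?_
  filter_upwards [hs] with y' hy'
  rw [hy']
  have h2 : Real.exp ((y + y') / 2) = Real.exp (y / 2) * (Real.exp y' * Real.exp (-y' / 2)) := by
    rw [← Real.exp_add, ← Real.exp_add]
    congr 1
    ring
  rw [h2, Real.exp_add, mul_assoc (2 * Real.pi), mul_comm (Real.exp y) (Real.exp y')]
  push_cast
  ring

/-- The truncations `φ · 1_{|y| ≤ n}` converge to `φ`. -/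
lemma tendsto_truncation (φ : LineL2) :
    Tendsto (fun n : ℕ => boundedMul volume ((Icc (-n : ℝ) n).indicator 1) φ) atTop (𝓝 φ) := by
  have h1 : boundedMul volume (fun _ : ℝ => (1 : ℂ)) φ = φ :=
    boundedMul_eq_of_ae (C := 1) measurable_const (by simp) (by simp)
  have h := tendsto_boundedMul (μ := (volume : Measure ℝ))
    (m := fun n : ℕ => (Icc (-n : ℝ) n).indicator 1) (m' := fun _ => 1) (C := 1)
    (fun n => measurable_one.indicator measurableSet_Icc) measurable_const
    (fun n x => by
      by_cases hx : x ∈ Icc (-n : ℝ) n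
      · simp [indicator_of_mem hx]
      · simp [indicator_of_notMem hx]) (by simp) (fun x => by
      obtain ⟨N, hN⟩ := exists_nat_ge |x|
      refine tendsto_const_nhds.congr' ?_
      filter_upwards [eventually_ge_atTop N] with n hn
      have : (N : ℝ) ≤ n := by exact_mod_cast hn
      rw [indicator_of_mem]
      · rfl
      · exact abs_le.1 (hN.trans this)) φ
  rwa [h1] at h

/-- The cosine transform exchanges dilations with the inverse dilations. -/
lemma logCosine_lineTranslation (t : ℝ) (φ : LineL2) :
    logCosine (lineTranslation t φ) = lineTranslation (-t) (logCosine φ) := by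
  -- where the integral formula holds, the kernel `k(y + y')` turns a shift of `y'` into one of `y`
  have key : ∀ φ : LineL2, Integrable (fun y => (Real.exp (y / 2) : ℂ) * φ y) →
      logCosine (lineTranslation t φ) = lineTranslation (-t) (logCosine φ) := by
    intro φ hφ
    have hc := coeFn_lineTranslation t φ
    have hi : Integrable fun y => (Real.exp (y / 2) : ℂ) * lineTranslation t φ y := by
      refine ((hφ.comp_add_right t).const_mul (Real.exp (-t / 2) : ℂ)).congr ?_
      filter_upwards [hc] with y hy
      rw [hy, ← mul_assoc, ← Complex.ofReal_mul, ← Real.exp_add]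
      congr 3
      ring
    refine Lp.ext ((coeFn_logCosine hi).trans ?_)
    filter_upwards [coeFn_lineTranslation (-t) (logCosine φ),
      (measurePreserving_add_right (volume : Measure ℝ) (-t)).quasiMeasurePreserving.ae_eq
        (coeFn_logCosine hφ)] with y e1 e2
    rw [e1]
    refine Eq.trans ?_ e2.symm
    simp only [Function.comp]
    refine Eq.trans ?_ (integral_add_right_eq_self (fun y' => (2 * Real.exp ((y + -t + y') / 2) *
      Real.cos (2 * Real.pi * Real.exp (y + -t + y')) : ℝ) * φ y') t)
    refine integral_congr_ae ?_
    filter_upwards [hc] with y' hy'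
    rw [hy']
    have h3 : y + -t + (y' + t) = y + y' := by ring
    rw [h3]
  -- the truncations of `φ` satisfy the integrability condition
  have l1 := tendsto_truncation φ
  refine tendsto_nhds_unique (((logCosine : LineL2 →L[ℂ] LineL2) ∘L
    lineTranslation t).continuous.tendsto _ |>.comp l1)
    ((((lineTranslation (-t)) ∘L (logCosine : LineL2 →L[ℂ] LineL2)).continuous.tendsto _
      |>.comp l1).congr fun n => ?_)
  refine (key _ ?_).symm
  have hb : ∀ x, ‖(Icc (-n : ℝ) n).indicator (1 : ℝ → ℂ) x‖ ≤ 1 := fun x => by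
    by_cases hx : x ∈ Icc (-n : ℝ) n
    · simp [indicator_of_mem hx]
    · simp [indicator_of_notMem hx]
  have hI : IntegrableOn (fun y => (Real.exp (y / 2) : ℂ) * φ y) (Icc (-n : ℝ) n) := by
    refine IntegrableOn.continuousOn_mul (by fun_prop) ?_ isCompact_Icc
    exact ((Lp.memLp φ).locallyIntegrable (by norm_num)).integrableOn_isCompact isCompact_Icc
  refine ((integrable_indicator_iff measurableSet_Icc).2 hI).congr ?_
  filter_upwards [coeFn_boundedMul (measurable_one.indicator measurableSet_Icc) hb φ] with y hy
  rw [hy]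
  by_cases hx : y ∈ Icc (-n : ℝ) n
  · simp [indicator_of_mem hx]
  · simp [indicator_of_notMem hx]

end LogCoordinates

/-! ### The spectral representations of the two operators -/

section SpectralRepresentations

open scoped FourierTransform

/-- If `S ⊆ T`, `S + z` is onto and `T + z` is injective, then `S = T`. -/
lemma eq_of_graph_le {H : Type} [NormedAddCommGroup H] [InnerProductSpace ℂ H] {S T : H →ₗ.[ℂ] H}
    (z : ℂ) (hle : ∀ p ∈ S.graph, p ∈ T.graph)
    (hsurj : ∀ θ, ∃ x y, (x, y) ∈ S.graph ∧ y + z • x = θ)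
    (hinj : ∀ x, (x, -(z • x)) ∈ T.graph → x = 0) : T = S := by
  refine LinearPMap.eq_of_eq_graph (le_antisymm ?_ hle)
  rintro ⟨x, y⟩ hxy
  obtain ⟨x', y', h1, h2⟩ := hsurj (y + z • x)
  have h3 : (x - x', y - y') ∈ T.graph := T.graph.sub_mem hxy (hle _ h1)
  have h4 : y - y' = -(z • (x - x')) := by
    rw [smul_sub, neg_sub, sub_eq_sub_iff_add_eq_add, ← h2, add_comm]
  rw [h4] at h3
  have h5 := sub_eq_zero.1 (hinj _ h3)
  have h6 : y = y' := by
    rw [h5, sub_self, smul_zero, neg_zero, sub_eq_zero] at h4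
    exact h4
  rw [h5, h6]
  exact h1

/-- `a + z` maps the domain of multiplication by `a` onto `L²` when `(a + z)⁻¹` and `a (a + z)⁻¹`
are bounded. -/
lemma mulOp_add_surjective {X : Type} [MeasurableSpace X] {μ : Measure X} {a : X → ℝ}
    (ha : Measurable a) {z : ℂ} {C D : ℝ} (h0 : ∀ x, (a x : ℂ) + z ≠ 0)
    (hC : ∀ x, ‖((a x : ℂ) + z)⁻¹‖ ≤ C) (hD : ∀ x, ‖(a x : ℂ) * ((a x : ℂ) + z)⁻¹‖ ≤ D)
    (θ : Lp ℂ 2 μ) :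
    ∃ φ χ, (φ, χ) ∈ (mulOp μ fun x => (a x : ℂ)).graph ∧ χ + z • φ = θ := by
  have hm1 : Measurable fun x => ((a x : ℂ) + z)⁻¹ := by fun_prop
  have hm2 : Measurable fun x => (a x : ℂ) * ((a x : ℂ) + z)⁻¹ := by fun_prop
  refine ⟨boundedMul μ (fun x => ((a x : ℂ) + z)⁻¹) θ,
    boundedMul μ (fun x => (a x : ℂ) * ((a x : ℂ) + z)⁻¹) θ, ?_, ?_⟩
  · rw [mem_graph_mulOp]
    filter_upwards [coeFn_boundedMul hm1 hC θ, coeFn_boundedMul hm2 hD θ] with x e1 e2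
    simp only [e1, e2, mul_assoc]
  · refine Lp.ext ?_
    filter_upwards [coeFn_boundedMul hm1 hC θ, coeFn_boundedMul hm2 hD θ,
      Lp.coeFn_add (boundedMul μ (fun x => (a x : ℂ) * ((a x : ℂ) + z)⁻¹) θ)
        (z • boundedMul μ (fun x => ((a x : ℂ) + z)⁻¹) θ),
      Lp.coeFn_smul z (boundedMul μ (fun x => ((a x : ℂ) + z)⁻¹) θ)] with x e1 e2 e3 e4
    rw [e3, Pi.add_apply, e4, Pi.smul_apply, e1, e2, smul_eq_mul]
    have := h0 x
    field_simp

lemma unitaryConj_add_surjective {H K : Type} [NormedAddCommGroup H] [InnerProductSpace ℂ H]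
    [NormedAddCommGroup K] [InnerProductSpace ℂ K] (U : H ≃ₗᵢ[ℂ] K) {M : K →ₗ.[ℂ] K} {z : ℂ}
    (hM : ∀ θ, ∃ x y, (x, y) ∈ M.graph ∧ y + z • x = θ) (θ : H) :
    ∃ x y, (x, y) ∈ (unitaryConj U M).graph ∧ y + z • x = θ := by
  obtain ⟨x, y, h1, h2⟩ := hM (U θ)
  refine ⟨U.symm x, U.symm y, ?_, ?_⟩
  · rw [mem_graph_unitaryConj]
    simpa using h1
  · rw [← map_smul, ← map_add, h2, U.symm_apply_apply]

lemma hasACDerivOn_of_le {J : Set ℝ} {u v : ℝ → ℂ}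
    (h : ∀ a ∈ J, ∀ b ∈ J, a ≤ b → IntervalIntegrable v volume a b ∧
      ∫ x in a..b, v x = u b - u a) : HasACDerivOn J u v := by
  intro a ha b hb
  rcases le_total a b with hab | hab
  · exact h a ha b hb hab
  · obtain ⟨h1, h2⟩ := h b hb a ha hab
    refine ⟨h1.symm, ?_⟩
    rw [intervalIntegral.integral_symm, h2, neg_sub]

lemma halfLineL2_const_eq_zero {ψ : HalfLineL2} {c : ℂ}
    (h : ∀ᵐ x ∂volume.restrict (Ioi (0 : ℝ)), ‖c‖ ≤ ‖ψ x‖) : c = 0 := by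
  have hm : MemLp (fun _ : ℝ => c) 2 (volume.restrict (Ioi (0 : ℝ))) :=
    (Lp.memLp ψ).mono aestronglyMeasurable_const h
  rw [memLp_const_iff (by norm_num) (by norm_num)] at hm
  simpa using hm

lemma halfLineL2_intervalIntegrable (η : HalfLineL2) {a b : ℝ} (ha : 0 ≤ a) (hab : a ≤ b) :
    IntervalIntegrable η volume a b := by
  rw [intervalIntegrable_iff_integrableOn_Ioc_of_le hab]
  have hsub : Ioc a b ⊆ Ioi 0 := fun x hx => lt_of_le_of_lt ha hx.1
  have : MemLp η 2 (volume.restrict (Ioc a b)) :=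
    (Lp.memLp η).mono_measure (Measure.restrict_mono hsub le_rfl)
  exact this.integrable (by norm_num)

lemma memLp_halfLine_indicator {a b : ℝ} {w : ℝ → ℝ} (hw : ContinuousOn w (Icc a b)) :
    MemLp ((Ioc a b).indicator fun x => (w x : ℂ)) 2 (volume.restrict (Ioi (0 : ℝ))) := by
  refine (memLp_indicator_iff_restrict measurableSet_Ioc).2 ?_
  obtain ⟨C, hC⟩ := isCompact_Icc.exists_bound_of_continuousOn hw
  have hle : ((volume.restrict (Ioi (0 : ℝ))).restrict (Ioc a b)) ≤ volume.restrict (Ioc a b) :=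
    Measure.restrict_mono_measure Measure.restrict_le_self _
  have hfin : IsFiniteMeasure (volume.restrict (Ioc a b)) := inferInstance
  have h : MemLp (fun x => (w x : ℂ)) 2 (volume.restrict (Ioc a b)) := by
    refine MemLp.of_bound ?_ C ?_
    · exact ((Complex.continuous_ofReal.comp_continuousOn hw).mono
        Ioc_subset_Icc_self).aestronglyMeasurable measurableSet_Ioc
    · filter_upwards [ae_restrict_mem measurableSet_Ioc] with x hx
      rw [Complex.norm_real]
      exact hC x (Ioc_subset_Icc_self hx)
  exact h.mono_measure hle

lemma inner_indicator_eq_intervalIntegral {a b : ℝ} (ha : 0 ≤ a) (hab : a ≤ b) {w : ℝ → ℝ}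
    (hw : ContinuousOn w (Icc a b)) (χ : HalfLineL2) :
    inner ℂ ((memLp_halfLine_indicator hw).toLp _ : HalfLineL2) χ = ∫ x in a..b, (w x : ℂ) * χ x := by
  have hsub : Ioc a b ⊆ Ioi 0 := fun x hx => lt_of_le_of_lt ha hx.1
  rw [L2.inner_def, intervalIntegral.integral_of_le hab]
  have h : ∫ x in Ioc a b, (w x : ℂ) * χ x =
      ∫ x in Ioi (0 : ℝ), (Ioc a b).indicator (fun x => (w x : ℂ) * χ x) x := by
    rw [setIntegral_indicator measurableSet_Ioc, inter_eq_self_of_subset_right hsub]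
  rw [h]
  refine integral_congr_ae ?_
  filter_upwards [(memLp_halfLine_indicator hw).coeFn_toLp] with x hx
  rw [hx]
  by_cases hxab : x ∈ Ioc a b
  · simp [indicator_of_mem hxab, mul_comm]
  · simp [indicator_of_notMem hxab]

/-! ### The generator of dilations -/

/-- A function in the domain of multiplication by `2π ξ` is integrable, because `(2π ξ + i)⁻¹` is
square integrable. -/
lemma integrable_of_mul_memLp {φ χ : LineL2}
    (h : χ =ᵐ[volume] fun ξ => ((2 * Real.pi * ξ : ℝ) : ℂ) * φ ξ) : Integrable φ := by
  have h0 : ∀ ξ : ℝ, ((2 * Real.pi * ξ : ℝ) : ℂ) + Complex.I ≠ 0 := fun ξ hξ => by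
    have := congrArg Complex.im hξ
    simp at this
  have hm : MemLp (fun ξ : ℝ => (((2 * Real.pi * ξ : ℝ) : ℂ) + Complex.I)⁻¹) 2 volume := by
    rw [memLp_two_iff_integrable_sq_norm (by fun_prop)]
    have hn : ∀ ξ : ℝ, ‖(((2 * Real.pi * ξ : ℝ) : ℂ) + Complex.I)⁻¹‖ ^ 2 =
        (1 + (2 * Real.pi * ξ) ^ 2)⁻¹ := fun ξ => by
      rw [norm_inv, inv_pow, ← Complex.normSq_eq_norm_sq, Complex.normSq_apply]
      congr 1
      simp
      ring
    simp only [hn]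
    exact integrable_inv_one_add_sq.comp_mul_left' (by positivity)
  have hg : MemLp (fun ξ => χ ξ + Complex.I * φ ξ) 2 volume :=
    (Lp.memLp χ).add ((Lp.memLp φ).const_mul Complex.I)
  refine (hm.integrable_mul hg).congr ?_
  filter_upwards [h] with ξ hξ
  simp only [Pi.mul_apply]
  rw [hξ, ← add_mul, inv_mul_cancel_left₀ (h0 ξ)]

/-- The integral of the Mellin kernel in the logarithmic variable; the exponent never vanishes because
its real part is `-1/2`. -/
lemma exp_kernel_integral (ξ : ℝ) (a b : ℝ) :
    (∫ y in a..b, Complex.exp ((2 * Real.pi * ξ * Complex.I - 1 / 2) * y)) *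
      (2 * Real.pi * ξ * Complex.I - 1 / 2) =
    Complex.exp ((2 * Real.pi * ξ * Complex.I - 1 / 2) * b) -
      Complex.exp ((2 * Real.pi * ξ * Complex.I - 1 / 2) * a) := by
  have h0 : (2 * Real.pi * ξ * Complex.I - 1 / 2 : ℂ) ≠ 0 := fun h => by
    have := congrArg Complex.re h
    simp at this
  rw [integral_exp_mul_complex h0, div_mul_cancel₀ _ h0]

/-- The unitary map which diagonalizes the generator of dilations (the Mellin transform). -/
def mellinUnitary : HalfLineL2 ≃ₗᵢ[ℂ] LineL2 := logUnitary.trans lineFourier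

/-- The pointwise inversion formula for the Mellin transform, with kernel `x ^ (2π i ξ - 1/2)`. -/
lemma fourierInv_log_eq (φ : ℝ → ℂ) (x : ℝ) :
    (Real.exp (-Real.log x / 2) : ℂ) * 𝓕⁻ φ (Real.log x) =
      ∫ ξ : ℝ, Complex.exp ((2 * Real.pi * ξ * Complex.I - 1 / 2) * Real.log x) * φ ξ := by
  rw [Real.fourierInv_eq', ← integral_const_mul]
  refine integral_congr_ae (Eventually.of_forall fun ξ => ?_)
  simp only [smul_eq_mul]
  rw [← mul_assoc, Complex.ofReal_exp, ← Complex.exp_add]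
  congr 2
  simp
  ring

lemma integrable_exp_kernel {φ : ℝ → ℂ} (hφ : Integrable φ) (x : ℝ) :
    Integrable fun ξ : ℝ => Complex.exp ((2 * Real.pi * ξ * Complex.I - 1 / 2) * x) * φ ξ := by
  refine hφ.bdd_mul (c := Real.exp (-x / 2)) (by fun_prop) (Eventually.of_forall fun ξ => ?_)
  rw [Complex.norm_exp]
  apply le_of_eq
  congr 1
  simp
  ring

/-- The Mellin transform of `x ↦ 1 / x` on `(a, b]`. -/
lemma coeFn_mellinUnitary_indicator {a b : ℝ} (ha : 0 < a) (hab : a ≤ b)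
    (hw : ContinuousOn (fun x : ℝ => x⁻¹) (Icc a b)) :
    mellinUnitary ((memLp_halfLine_indicator hw).toLp _) =ᵐ[volume] fun ξ =>
      starRingEnd ℂ (∫ y in Real.log a..Real.log b,
        Complex.exp ((2 * Real.pi * ξ * Complex.I - 1 / 2) * y)) := by
  set κ : HalfLineL2 := (memLp_halfLine_indicator hw).toLp _ with hκ
  have hb : 0 < b := ha.trans_le hab
  have h1 : logUnitary κ =ᵐ[volume]
      (Ioc (Real.log a) (Real.log b)).indicator fun y => (Real.exp (-y / 2) : ℂ) := by
    filter_upwards [coeFn_logUnitary κ,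
      quasiMeasurePreserving_exp.ae_eq (memLp_halfLine_indicator hw).coeFn_toLp] with y e1 e2
    have e2' : κ (Real.exp y) = (Ioc a b).indicator (fun x => ((x⁻¹ : ℝ) : ℂ)) (Real.exp y) := e2
    rw [e1, e2']
    by_cases hy : y ∈ Ioc (Real.log a) (Real.log b)
    · have hy' : Real.exp y ∈ Ioc a b :=
        ⟨(Real.log_lt_iff_lt_exp ha).1 hy.1, (Real.le_log_iff_exp_le hb).1 hy.2⟩
      rw [indicator_of_mem hy, indicator_of_mem hy', ← Complex.ofReal_mul, ← Real.exp_neg,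
        ← Real.exp_add]
      congr 2
      ring
    · have hy' : Real.exp y ∉ Ioc a b := fun h =>
        hy ⟨(Real.log_lt_iff_lt_exp ha).2 h.1, (Real.le_log_iff_exp_le hb).2 h.2⟩
      rw [indicator_of_notMem hy, indicator_of_notMem hy', mul_zero]
  have hi : Integrable (logUnitary κ) := by
    refine Integrable.congr ?_ h1.symm
    rw [integrable_indicator_iff measurableSet_Ioc]
    exact (Continuous.integrableOn_Icc (by fun_prop)).mono_set Ioc_subset_Icc_self
  refine (coeFn_lineFourier hi).trans (Eventually.of_forall fun ξ => ?_)
  change _ = starRingEnd ℂ _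
  rw [Real.fourier_congr_ae h1, Real.fourier_real_eq_integral_exp_smul,
    intervalIntegral.integral_of_le (Real.log_le_log ha hab), ← integral_conj,
    ← integral_indicator measurableSet_Ioc]
  refine integral_congr_ae (Eventually.of_forall fun y => ?_)
  by_cases hy : y ∈ Ioc (Real.log a) (Real.log b)
  · simp only [indicator_of_mem hy, smul_eq_mul]
    rw [Complex.ofReal_exp, ← Complex.exp_add, ← Complex.exp_conj]
    congr 1
    have h2 : starRingEnd ℂ 2 = 2 := map_ofNat _ 2
    simp [Complex.conj_ofReal, h2]
    ring
  · simp only [indicator_of_notMem hy, smul_zero]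

/-- Multiplication by `2π ξ` in the Mellin representation is contained in the generator of dilations:
the inverse Mellin transform of the integrable function `mellinUnitary ψ` is a primitive of
`(i η - ψ / 2) / x`, by pairing with the function `1 / x` on intervals. -/
lemma mem_dilationGraph_of_mellin {ψ η : HalfLineL2}
    (h : mellinUnitary η =ᵐ[volume] fun ξ => ((2 * Real.pi * ξ : ℝ) : ℂ) * mellinUnitary ψ ξ) :
    (ψ, η) ∈ dilationGraph := by
  set φ := mellinUnitary ψ with hφ
  have hi : Integrable φ := integrable_of_mul_memLp h
  set u : ℝ → ℂ := fun x => (Real.exp (-Real.log x / 2) : ℂ) * 𝓕⁻ (φ : ℝ → ℂ) (Real.log x) with hu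
  have hWψ : logUnitary ψ = lineFourier.symm φ := by
    rw [LinearIsometryEquiv.eq_symm_apply]
    rfl
  have huψ : u =ᵐ[volume.restrict (Ioi 0)] ψ := by
    have h1 : ψ = logUnitary.symm (lineFourier.symm φ) := by
      rw [← hWψ, LinearIsometryEquiv.symm_apply_apply]
    rw [h1]
    filter_upwards [coeFn_logUnitary_symm (lineFourier.symm φ),
      quasiMeasurePreserving_log.ae_eq (coeFn_lineFourier_symm hi)] with x e1 e2
    have e2' : lineFourier.symm φ (Real.log x) = 𝓕⁻ (φ : ℝ → ℂ) (Real.log x) := e2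
    rw [e1, e2']
  refine ⟨u, fun x => (Complex.I * η x - u x / 2) / x, huψ, ?_, ?_⟩
  · refine hasACDerivOn_of_le fun a ha b hb hab => ?_
    have ha : 0 < a := ha
    have hb : 0 < b := hb
    set χ : HalfLineL2 := Complex.I • η - (1 / 2 : ℂ) • ψ with hχ
    have hχae : ∀ᵐ x ∂volume.restrict (Ioi (0 : ℝ)), χ x = Complex.I * η x - u x / 2 := by
      filter_upwards [huψ, Lp.coeFn_sub (Complex.I • η) ((1 / 2 : ℂ) • ψ),
        Lp.coeFn_smul Complex.I η, Lp.coeFn_smul (1 / 2 : ℂ) ψ] with x e1 e2 e3 e4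
      rw [e2, Pi.sub_apply, e3, e4, Pi.smul_apply, Pi.smul_apply, e1, smul_eq_mul, smul_eq_mul]
      ring
    have hw : ContinuousOn (fun x : ℝ => x⁻¹) (Icc a b) :=
      continuousOn_inv₀.mono fun x hx => (ha.trans_le hx.1).ne'
    have hcongr : ∀ᵐ x ∂volume.restrict (Ioc a b),
        ((x⁻¹ : ℝ) : ℂ) * χ x = (Complex.I * η x - u x / 2) / x := by
      have := ae_restrict_of_ae_restrict_of_subset
        (fun x (hx : x ∈ Ioc a b) => (ha.trans hx.1 : x ∈ Ioi 0)) hχae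
      filter_upwards [this] with x hx
      rw [hx]
      push_cast
      ring
    constructor
    · rw [intervalIntegrable_iff_integrableOn_Ioc_of_le hab]
      have := (halfLineL2_intervalIntegrable χ ha.le hab).continuousOn_mul
        (g := fun x => ((x⁻¹ : ℝ) : ℂ)) (by
          rw [uIcc_of_le hab]
          exact Complex.continuous_ofReal.comp_continuousOn hw)
      rw [intervalIntegrable_iff_integrableOn_Ioc_of_le hab] at this
      exact this.congr hcongr
    · have h1 : ∫ x in a..b, (Complex.I * η x - u x / 2) / x =
          ∫ x in a..b, ((x⁻¹ : ℝ) : ℂ) * χ x := by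
        rw [intervalIntegral.integral_of_le hab, intervalIntegral.integral_of_le hab]
        exact integral_congr_ae (hcongr.mono fun x hx => hx.symm)
      -- Parseval's identity moves the integral over `(a, b]` to the Mellin side
      rw [h1, ← inner_indicator_eq_intervalIntegral ha.le hab hw, ← mellinUnitary.inner_map_map,
        L2.inner_def]
      have hu' : ∀ x, u x = ∫ ξ : ℝ, Complex.exp ((2 * Real.pi * ξ * Complex.I - 1 / 2) *
        Real.log x) * φ ξ := fun x => fourierInv_log_eq φ x
      rw [hu' a, hu' b, ← integral_sub (integrable_exp_kernel hi _) (integrable_exp_kernel hi _)]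
      refine integral_congr_ae ?_
      have hχ' : mellinUnitary χ = Complex.I • mellinUnitary η - (1 / 2 : ℂ) • φ := by
        rw [hχ, map_sub, map_smul, map_smul]
      filter_upwards [coeFn_mellinUnitary_indicator ha hab hw, h,
        Lp.coeFn_sub (Complex.I • mellinUnitary η) ((1 / 2 : ℂ) • φ),
        Lp.coeFn_smul Complex.I (mellinUnitary η), Lp.coeFn_smul (1 / 2 : ℂ) φ] with ξ e1 e2 e3 e4 e5
      rw [e1, hχ', e3, Pi.sub_apply, e4, e5, Pi.smul_apply, Pi.smul_apply, e2, ← sub_mul,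
        ← exp_kernel_integral ξ]
      simp only [RCLike.inner_apply, smul_eq_mul, Complex.conj_conj]
      push_cast
      ring
  · filter_upwards [ae_restrict_mem measurableSet_Ioi] with x hx
    have hx : (x : ℂ) ≠ 0 := by exact_mod_cast (show (0 : ℝ) < x from hx).ne'
    have hI := Complex.I_ne_zero
    field_simp
    ring

/-- `-i/2` is not an eigenvalue of the generator of dilations: an eigenfunction would satisfy `x u' = 0`,
and constants are not square integrable. -/
lemma dilationGraph_injective {ψ : HalfLineL2}
    (h : (ψ, -((Complex.I / 2) • ψ)) ∈ dilationGraph) : ψ = 0 := by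
  obtain ⟨u, v, hu, hac, hη⟩ := h
  have hv : ∀ᵐ x ∂volume.restrict (Ioi (0 : ℝ)), v x = 0 := by
    filter_upwards [hu, hη, Lp.coeFn_neg ((Complex.I / 2) • ψ), Lp.coeFn_smul (Complex.I / 2) ψ,
      ae_restrict_mem measurableSet_Ioi] with x e1 e2 e3 e4 hx
    have hx : (x : ℂ) ≠ 0 := by exact_mod_cast (show (0 : ℝ) < x from hx).ne'
    replace e2 : (-((Complex.I / 2) • ψ) : HalfLineL2) x =
      1 / (2 * Complex.I) * ((u x + x * v x) + x * v x) := e2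
    rw [e3, Pi.neg_apply, e4, Pi.smul_apply, ← e1, smul_eq_mul] at e2
    have hI : (2 * Complex.I : ℂ) ≠ 0 := by simp
    have h2 : x * v x = 0 := by
      have h3 := congrArg (fun c => (2 * Complex.I) * c) e2
      rw [← mul_assoc, mul_one_div_cancel hI, one_mul] at h3
      linear_combination -(1 / 2) * h3 - (1 / 2) * u x * Complex.I_sq
    exact (mul_eq_zero.1 h2).resolve_left hx
  have hconst : ∀ x ∈ Ioi (0 : ℝ), u x = u 1 := by
    intro x hx
    have h1 := (hac 1 (by simp) x hx).2
    have h2 : ∫ t in (1 : ℝ)..x, v t = 0 := by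
      refine intervalIntegral.integral_zero_ae ?_
      filter_upwards [(ae_restrict_iff' measurableSet_Ioi).1 hv] with t ht htx
      refine ht ?_
      have hx : 0 < x := hx
      rcases mem_uIoc.1 htx with h | h
      · exact lt_trans one_pos h.1
      · exact lt_trans hx h.1
    rw [h2] at h1
    exact (sub_eq_zero.1 h1.symm)
  have hae : ∀ᵐ x ∂volume.restrict (Ioi (0 : ℝ)), ψ x = u 1 := by
    filter_upwards [hu, ae_restrict_mem measurableSet_Ioi] with x e1 hx
    rw [← e1, hconst x hx]
  have h0 : u 1 = 0 := halfLineL2_const_eq_zero (hae.mono fun x hx => by rw [hx])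
  refine Lp.ext ?_
  filter_upwards [hae, Lp.coeFn_zero ℂ 2 (volume.restrict (Ioi (0 : ℝ)))] with x e1 e2
  rw [e1, e2, h0, Pi.zero_apply]

/-- The Mellin transform turns the generator of dilations into multiplication by `2π ξ`. -/
theorem dilationGenerator_eq : dilationGenerator =
    unitaryConj mellinUnitary (mulOp volume fun ξ : ℝ => ((2 * Real.pi * ξ : ℝ) : ℂ)) := by
  have him : ∀ ξ : ℝ, (((2 * Real.pi * ξ : ℝ) : ℂ) + Complex.I / 2).im = 1 / 2 := fun ξ => by simp
  have h0 : ∀ ξ : ℝ, ((2 * Real.pi * ξ : ℝ) : ℂ) + Complex.I / 2 ≠ 0 := fun ξ h => by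
    have := him ξ
    rw [h] at this
    norm_num at this
  have hC : ∀ ξ : ℝ, ‖(((2 * Real.pi * ξ : ℝ) : ℂ) + Complex.I / 2)⁻¹‖ ≤ 2 := fun ξ => by
    rw [norm_inv]
    refine inv_le_of_inv_le₀ (by norm_num) ?_
    have := Complex.abs_im_le_norm (((2 * Real.pi * ξ : ℝ) : ℂ) + Complex.I / 2)
    rw [him, abs_of_pos (by norm_num)] at this
    linarith
  refine eq_of_graph_le (Complex.I / 2) ?_ (unitaryConj_add_surjective _
    (mulOp_add_surjective (D := 1) (by fun_prop) h0 hC fun ξ => ?_)) ?_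
  · rintro ⟨ψ, η⟩ hp
    rw [mem_graph_unitaryConj, mem_graph_mulOp] at hp
    rw [mem_graph_dilationGenerator]
    exact mem_dilationGraph_of_mellin hp
  · rw [norm_mul, norm_inv, ← div_eq_mul_inv, div_le_one (norm_pos_iff.2 (h0 ξ))]
    have := Complex.abs_re_le_norm (((2 * Real.pi * ξ : ℝ) : ℂ) + Complex.I / 2)
    rw [Complex.norm_real, Real.norm_eq_abs]
    simpa using this
  · intro ψ hψ
    rw [mem_graph_dilationGenerator] at hψ
    exact dilationGraph_injective hψ

end SpectralRepresentations

/-! ### The Neumann Laplacian -/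

section NeumannLaplacian

open scoped FourierTransform

lemma inv_one_add_sq_memLp :
    MemLp (fun k : ℝ => (1 + (2 * Real.pi * k) ^ 2)⁻¹) 2 (volume.restrict (Ioi (0 : ℝ))) := by
  have h1 : Integrable (fun k : ℝ => (1 + (2 * Real.pi * k) ^ 2)⁻¹) :=
    integrable_inv_one_add_sq.comp_mul_left' (by positivity)
  refine MemLp.restrict _ ((memLp_two_iff_integrable_sq (by fun_prop)).2 ?_)
  refine h1.mono (by fun_prop) (Eventually.of_forall fun k => ?_)
  have h2 : 0 ≤ (1 + (2 * Real.pi * k) ^ 2)⁻¹ := by positivity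
  have h3 : (1 + (2 * Real.pi * k) ^ 2)⁻¹ ≤ 1 := inv_le_one_of_one_le₀ (by nlinarith [sq_nonneg (2 * Real.pi * k)])
  rw [Real.norm_of_nonneg (by positivity), Real.norm_of_nonneg h2]
  nlinarith

lemma mul_inv_one_add_sq_memLp :
    MemLp (fun k : ℝ => (2 * Real.pi * k) * (1 + (2 * Real.pi * k) ^ 2)⁻¹) 2
      (volume.restrict (Ioi (0 : ℝ))) := by
  have h1 : Integrable (fun k : ℝ => (1 + (2 * Real.pi * k) ^ 2)⁻¹) :=
    integrable_inv_one_add_sq.comp_mul_left' (by positivity)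
  refine MemLp.restrict _ ((memLp_two_iff_integrable_sq (by fun_prop)).2 ?_)
  refine h1.mono (by fun_prop) (Eventually.of_forall fun k => ?_)
  rw [Real.norm_of_nonneg (by positivity), Real.norm_of_nonneg (by positivity)]
  rw [mul_pow, inv_pow, ← div_eq_mul_inv, div_le_iff₀ (by positivity), pow_two (1 + _),
    inv_mul_cancel_left₀ (by positivity)]
  linarith

/-- If `ψ` is in the domain of multiplication by `(2π k)²`, then `ψ` and `k ψ` are integrable. -/
lemma integrable_of_sq_mul {φ χ : HalfLineL2}
    (h : χ =ᵐ[volume.restrict (Ioi (0 : ℝ))] fun k => (((2 * Real.pi * k) ^ 2 : ℝ) : ℂ) * φ k) :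
    IntegrableOn φ (Ioi 0) ∧ IntegrableOn (fun k => ((2 * Real.pi * k : ℝ) : ℂ) * φ k) (Ioi 0) := by
  have hg : MemLp (fun k => φ k + χ k) 2 (volume.restrict (Ioi (0 : ℝ))) :=
    (Lp.memLp φ).add (Lp.memLp χ)
  have h0 : ∀ k : ℝ, ((1 + (2 * Real.pi * k) ^ 2 : ℝ) : ℂ) ≠ 0 := fun k => by
    have : 1 + (2 * Real.pi * k) ^ 2 ≠ 0 := by positivity
    exact_mod_cast this
  constructor
  · refine (MemLp.integrable_mul inv_one_add_sq_memLp.ofReal hg).congr ?_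
    filter_upwards [h] with k hk
    simp only [Pi.mul_apply]
    rw [hk]
    have := h0 k
    push_cast at this ⊢
    linear_combination φ k * inv_mul_cancel₀ this
  · refine (MemLp.integrable_mul mul_inv_one_add_sq_memLp.ofReal hg).congr ?_
    filter_upwards [h] with k hk
    simp only [Pi.mul_apply]
    rw [hk]
    have := h0 k
    push_cast at this ⊢
    linear_combination (2 * Real.pi * k) * φ k * inv_mul_cancel₀ this

/-- The cosine transform of the indicator function of `(a, b]`. -/
lemma coeFn_cosineTransform_indicator {a b : ℝ} (ha : 0 ≤ a) (hab : a ≤ b)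
    (hw : ContinuousOn (fun _ : ℝ => (1 : ℝ)) (Icc a b)) :
    cosineTransform ((memLp_halfLine_indicator hw).toLp _) =ᵐ[volume.restrict (Ioi (0 : ℝ))]
      fun k => (((2 * Real.sin (2 * Real.pi * k * b) - 2 * Real.sin (2 * Real.pi * k * a)) /
        (2 * Real.pi * k) : ℝ) : ℂ) := by
  set κ : HalfLineL2 := (memLp_halfLine_indicator hw).toLp _ with hκ
  have hκae := (memLp_halfLine_indicator hw).coeFn_toLp
  have hsub : Ioc a b ⊆ Ioi 0 := fun x hx => lt_of_le_of_lt ha hx.1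
  have hi : IntegrableOn κ (Ioi 0) := by
    refine Integrable.congr ?_ hκae.symm
    rw [integrable_indicator_iff measurableSet_Ioc]
    refine Integrable.mono_measure (ν := volume.restrict (Ioc a b)) ?_
      (Measure.restrict_mono_measure Measure.restrict_le_self _)
    exact integrable_const _
  filter_upwards [coeFn_cosineTransform hi, ae_restrict_mem measurableSet_Ioi] with k hk hk0
  have hk0 : 0 < k := hk0
  have hpk : (2 * Real.pi * k) ≠ 0 := by positivity
  rw [hk]
  have h1 : ∫ x in Ioi (0 : ℝ), (2 * Real.cos (2 * Real.pi * x * k) : ℝ) * κ x =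
      ∫ x in a..b, ((2 * Real.cos (2 * Real.pi * k * x) : ℝ) : ℂ) := by
    rw [intervalIntegral.integral_of_le hab]
    have h2 : ∫ x in Ioc a b, ((2 * Real.cos (2 * Real.pi * k * x) : ℝ) : ℂ) =
        ∫ x in Ioi (0 : ℝ), (Ioc a b).indicator
          (fun x => ((2 * Real.cos (2 * Real.pi * k * x) : ℝ) : ℂ)) x := by
      rw [setIntegral_indicator measurableSet_Ioc, inter_eq_self_of_subset_right hsub]
    rw [h2]
    refine integral_congr_ae ?_
    filter_upwards [hκae] with x hx
    rw [hx]
    by_cases hxab : x ∈ Ioc a b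
    · rw [indicator_of_mem hxab, indicator_of_mem hxab, Complex.ofReal_one, mul_one, mul_right_comm]
    · rw [indicator_of_notMem hxab, indicator_of_notMem hxab, mul_zero]
  rw [h1, intervalIntegral.integral_ofReal]
  congr 1
  rw [intervalIntegral.integral_const_mul,
    intervalIntegral.integral_comp_mul_left (fun x => Real.cos x) hpk, integral_cos, smul_eq_mul]
  field_simp

lemma integrable_cos_mul {φ : ℝ → ℂ} (hφ : IntegrableOn φ (Ioi 0)) (x : ℝ) :
    IntegrableOn (fun k => ((2 * Real.cos (2 * Real.pi * k * x) : ℝ) : ℂ) * φ k) (Ioi 0) := by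
  refine Integrable.bdd_mul (c := 2) hφ (by fun_prop) (Eventually.of_forall fun k => ?_)
  rw [Complex.norm_real, norm_mul, Real.norm_of_nonneg zero_le_two, Real.norm_eq_abs]
  linarith [Real.abs_cos_le_one (2 * Real.pi * k * x)]

lemma norm_sin_mul_le (k x : ℝ) (z : ℂ) :
    ‖((-2 * Real.sin (2 * Real.pi * k * x) : ℝ) : ℂ) * z‖ ≤ 2 * ‖z‖ := by
  rw [norm_mul, Complex.norm_real, norm_mul, norm_neg, Real.norm_of_nonneg zero_le_two,
    Real.norm_eq_abs]
  refine mul_le_mul_of_nonneg_right ?_ (norm_nonneg _)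
  linarith [Real.abs_sin_le_one (2 * Real.pi * k * x)]

lemma integrable_sin_mul {φ : ℝ → ℂ} (hφ : IntegrableOn φ (Ioi 0)) (x : ℝ) :
    IntegrableOn (fun k => ((-2 * Real.sin (2 * Real.pi * k * x) : ℝ) : ℂ) * φ k) (Ioi 0) :=
  (hφ.norm.const_mul 2).mono' (AEStronglyMeasurable.mul (by fun_prop) hφ.aestronglyMeasurable)
    (Eventually.of_forall fun k => norm_sin_mul_le k x (φ k))

/-- Multiplication by `(2π k)²` in the cosine representation is contained in the Neumann Laplacian: the
inverse cosine transform may be differentiated once under the integral sign, and the increments of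
the derivative are computed by pairing with indicator functions of intervals. -/
lemma mem_neumannGraph_of_cosine {ψ η : HalfLineL2}
    (h : cosineTransform η =ᵐ[volume.restrict (Ioi (0 : ℝ))]
      fun k => (((2 * Real.pi * k) ^ 2 : ℝ) : ℂ) * cosineTransform ψ k) :
    (ψ, η) ∈ neumannGraph := by
  set φ := cosineTransform ψ with hφ
  obtain ⟨hi, hi'⟩ := integrable_of_sq_mul h
  set u : ℝ → ℂ := fun x => ∫ k in Ioi (0 : ℝ), (2 * Real.cos (2 * Real.pi * k * x) : ℝ) * φ k
    with hu
  set u₁ : ℝ → ℂ := fun x => ∫ k in Ioi (0 : ℝ), (-2 * Real.sin (2 * Real.pi * k * x) : ℝ) *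
    (((2 * Real.pi * k : ℝ) : ℂ) * φ k) with hu₁
  have huψ : u =ᵐ[volume.restrict (Ioi 0)] ψ := by
    have h1 := coeFn_cosineTransform hi
    rw [hφ, cosineTransform_cosineTransform] at h1
    exact h1.symm
  have hcont : Continuous u₁ := by
    refine continuous_of_dominated (bound := fun k => 2 * ‖((2 * Real.pi * k : ℝ) : ℂ) * φ k‖)
      (fun x => (integrable_sin_mul hi' x).aestronglyMeasurable)
      (fun x => Eventually.of_forall fun k => norm_sin_mul_le k x _) (hi'.norm.const_mul 2)
      (Eventually.of_forall fun k => by fun_prop)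
  have hderiv : ∀ x, HasDerivAt u (u₁ x) x := by
    intro x
    refine (hasDerivAt_integral_of_dominated_loc_of_deriv_le (s := univ)
      (F := fun x k => ((2 * Real.cos (2 * Real.pi * k * x) : ℝ) : ℂ) * φ k)
      (F' := fun x k => ((-2 * Real.sin (2 * Real.pi * k * x) : ℝ) : ℂ) *
        (((2 * Real.pi * k : ℝ) : ℂ) * φ k))
      (bound := fun k => 2 * ‖((2 * Real.pi * k : ℝ) : ℂ) * φ k‖) univ_mem
      (Eventually.of_forall fun x => (integrable_cos_mul hi x).aestronglyMeasurable)
      (integrable_cos_mul hi x) (integrable_sin_mul hi' x).aestronglyMeasurable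
      (Eventually.of_forall fun k x _ => norm_sin_mul_le k x _) (hi'.norm.const_mul 2)
      (Eventually.of_forall fun k x _ => ?_)).2
    have h1 : HasDerivAt (fun x : ℝ => 2 * Real.cos (2 * Real.pi * k * x))
        (2 * (-Real.sin (2 * Real.pi * k * x) * (2 * Real.pi * k))) x := by
      have h2 : HasDerivAt (fun x : ℝ => 2 * Real.pi * k * x) (2 * Real.pi * k) x := by
        simpa using (hasDerivAt_id x).const_mul (2 * Real.pi * k)
      exact (h2.cos).const_mul 2
    refine (h1.ofReal_comp.mul_const (φ k)).congr_deriv ?_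
    push_cast
    ring
  refine ⟨u, u₁, fun x => -η x, huψ, ?_, ?_, ?_, ?_⟩
  · intro a _ b _
    refine ⟨hcont.intervalIntegrable a b, ?_⟩
    exact intervalIntegral.integral_eq_sub_of_hasDerivAt (fun x _ => hderiv x)
      (hcont.intervalIntegrable a b)
  · refine hasACDerivOn_of_le fun a ha b hb hab => ?_
    have ha : 0 ≤ a := ha
    refine ⟨(halfLineL2_intervalIntegrable η ha hab).neg, ?_⟩
    have hw : ContinuousOn (fun _ : ℝ => (1 : ℝ)) (Icc a b) := continuousOn_const
    have h1 : inner ℂ ((memLp_halfLine_indicator hw).toLp _ : HalfLineL2) η = ∫ x in a..b, η x := by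
      rw [inner_indicator_eq_intervalIntegral ha hab hw]
      simp only [Complex.ofReal_one, one_mul]
    rw [intervalIntegral.integral_neg, ← h1, ← cosineTransform.inner_map_map, L2.inner_def,
      ← integral_sub (integrable_sin_mul hi' b) (integrable_sin_mul hi' a), ← integral_neg]
    refine integral_congr_ae ?_
    filter_upwards [coeFn_cosineTransform_indicator ha hab hw, h, ae_restrict_mem measurableSet_Ioi]
      with k e1 e2 hk
    have hk : (2 * Real.pi * k : ℂ) ≠ 0 := by
      have : 0 < 2 * Real.pi * k := mul_pos (by positivity) hk
      exact_mod_cast this.ne'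
    rw [e1, e2]
    simp only [RCLike.inner_apply, Complex.conj_ofReal]
    push_cast
    field_simp
    ring
  · simp [hu₁]
  · exact Eventually.of_forall fun x => by simp

lemma HasACDerivOn.continuousOn_Ici {u v : ℝ → ℂ} (h : HasACDerivOn (Ici 0) u v) :
    ContinuousOn u (Ici 0) := by
  intro x hx
  have hx : 0 ≤ x := hx
  have hx1 : (0 : ℝ) ≤ x + 1 := by linarith
  have hc := intervalIntegral.continuousOn_primitive_interval'
    (h 0 self_mem_Ici _ hx1).1 left_mem_uIcc
  rw [uIcc_of_le hx1] at hc
  have h1 : ContinuousOn u (Icc 0 (x + 1)) := by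
    refine (continuousOn_const (c := u 0) |>.add hc).congr fun t ht => ?_
    simp only [Pi.add_apply]
    rw [(h 0 self_mem_Ici t ht.1).2]
    ring
  refine (h1 x ⟨hx, by linarith⟩).mono_of_mem_nhdsWithin ?_
  rw [← Ici_inter_Iic]
  exact inter_mem self_mem_nhdsWithin (mem_nhdsWithin_of_mem_nhds (Iic_mem_nhds (by linarith)))

/-- On the half-line `u' = c u` has only exponential solutions. -/
lemma eq_exp_of_hasACDerivOn {u v : ℝ → ℂ} {c : ℝ} (h : HasACDerivOn (Ici 0) u v)
    (hv : v =ᵐ[volume.restrict (Ioi 0)] fun x => c * u x) {x : ℝ} (hx : 0 ≤ x) :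
    u x = u 0 * Real.exp (c * x) := by
  have hU : Continuous fun x : ℝ => c * u (max x 0) :=
    continuous_const.mul (h.continuousOn_Ici.comp_continuous (by fun_prop)
      fun x => le_max_right x 0)
  set w : ℝ → ℂ := fun x => u 0 + ∫ t in (0 : ℝ)..x, c * u (max t 0) with hw
  have hwu : ∀ x, 0 ≤ x → w x = u x := by
    intro x hx
    have h1 := (h 0 self_mem_Ici x hx).2
    have h2 : ∫ t in (0 : ℝ)..x, v t = ∫ t in (0 : ℝ)..x, c * u (max t 0) := by
      refine intervalIntegral.integral_congr_ae ?_
      filter_upwards [(ae_restrict_iff' measurableSet_Ioi).1 hv] with t ht htx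
      rw [uIoc_of_le hx] at htx
      rw [ht htx.1, max_eq_left htx.1.le]
    rw [hw]
    simp only
    rw [← h2, h1]
    ring
  have hdw : ∀ x, HasDerivAt w (c * u (max x 0)) x := fun x =>
    (hU.integral_hasStrictDerivAt 0 x).hasDerivAt.const_add _
  have hde : ∀ x : ℝ, HasDerivAt (fun x : ℝ => ((Real.exp (-c * x) : ℝ) : ℂ))
      ((Real.exp (-c * x) * -c : ℝ) : ℂ) x := fun x => by
    have h1 : HasDerivAt (fun x : ℝ => -c * x) (-c) x := by
      simpa using (hasDerivAt_id x).const_mul (-c)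
    exact h1.exp.ofReal_comp
  have hconst := constant_of_has_deriv_right_zero (a := 0) (b := x)
    (f := fun x => w x * ((Real.exp (-c * x) : ℝ) : ℂ))
    (fun y _ => ((hdw y).continuousAt.mul (hde y).continuousAt).continuousWithinAt)
    (fun y hy => by
      have h1 := ((hdw y).mul (hde y)).hasDerivWithinAt (s := Ici y)
      refine HasDerivWithinAt.congr_deriv h1 ?_
      rw [hwu y hy.1, max_eq_left hy.1]
      push_cast
      ring) x ⟨hx, le_rfl⟩
  simp only [mul_zero, Real.exp_zero, Complex.ofReal_one, mul_one] at hconst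
  rw [hwu x hx, hwu 0 le_rfl] at hconst
  rw [← hconst, mul_assoc, ← Complex.ofReal_mul, ← Real.exp_add]
  simp

/-- `-1` is not an eigenvalue of the Neumann Laplacian: the solution of `u'' = u` with `u'(0) = 0` is
`u(0) cosh x`. -/
lemma neumannGraph_injective {ψ : HalfLineL2} (h : (ψ, -((1 : ℂ) • ψ)) ∈ neumannGraph) :
    ψ = 0 := by
  obtain ⟨u, u₁, u₂, hu, h1, h2, h0, hη⟩ := h
  have hu₂ : ∀ᵐ x ∂volume.restrict (Ioi (0 : ℝ)), u₂ x = u x := by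
    rw [one_smul] at hη
    filter_upwards [hu, hη, Lp.coeFn_neg ψ] with x e1 e2 e3
    replace e2 : (-ψ : HalfLineL2) x = -u₂ x := e2
    rw [e3, Pi.neg_apply, ← e1] at e2
    exact (neg_injective e2).symm
  -- `u ± u'` solve first order equations
  have hs : ∀ x : ℝ, 0 ≤ x → u x + u₁ x = u 0 * Real.exp x := by
    intro x hx
    have := eq_exp_of_hasACDerivOn (c := 1) (h1.add h2) (by
      filter_upwards [hu₂] with x hx
      simp only [Pi.add_apply, hx]
      push_cast
      ring) hx
    simpa [h0] using this
  have hd : ∀ x : ℝ, 0 ≤ x → u x - u₁ x = u 0 * Real.exp (-x) := by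
    intro x hx
    have := eq_exp_of_hasACDerivOn (c := -1) (h1.add (h2.smul (-1))) (by
      filter_upwards [hu₂] with x hx
      simp only [Pi.add_apply, Pi.smul_apply, hx, smul_eq_mul]
      push_cast
      ring) hx
    simpa [h0, sub_eq_add_neg] using this
  have hc : ∀ x : ℝ, 0 ≤ x → u x = u 0 * Real.cosh x := by
    intro x hx
    have h3 := hs x hx
    have h4 := hd x hx
    rw [Real.cosh_eq]
    push_cast at h3 h4 ⊢
    linear_combination (1 / 2) * h3 + (1 / 2) * h4
  have h3 : u 0 = 0 := by
    refine halfLineL2_const_eq_zero (ψ := ψ) ?_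
    filter_upwards [hu, ae_restrict_mem measurableSet_Ioi] with x e1 hx
    rw [← e1, hc x (le_of_lt hx), norm_mul, Complex.norm_real,
      Real.norm_of_nonneg (Real.cosh_pos x).le]
    exact le_mul_of_one_le_right (norm_nonneg _) (Real.one_le_cosh x)
  refine Lp.ext ?_
  filter_upwards [hu, ae_restrict_mem measurableSet_Ioi,
    Lp.coeFn_zero ℂ 2 (volume.restrict (Ioi (0 : ℝ)))] with x e1 hx e2
  rw [← e1, e2, hc x (le_of_lt hx), h3, zero_mul, Pi.zero_apply]

/-- The cosine transform turns the Neumann Laplacian into multiplication by `(2π k)²`. -/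
theorem neumannLaplacian_eq : neumannLaplacian =
    unitaryConj cosineTransform (mulOp (volume.restrict (Ioi (0 : ℝ)))
      fun k : ℝ => (((2 * Real.pi * k) ^ 2 : ℝ) : ℂ)) := by
  have h1 : ∀ k : ℝ, (((2 * Real.pi * k) ^ 2 : ℝ) : ℂ) + 1 = (((2 * Real.pi * k) ^ 2 + 1 : ℝ) : ℂ) :=
    fun k => by push_cast; ring
  have hpos : ∀ k : ℝ, 0 < (2 * Real.pi * k) ^ 2 + 1 := fun k => by positivity
  refine eq_of_graph_le 1 ?_ (unitaryConj_add_surjective _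
    (mulOp_add_surjective (C := 1) (D := 1) (by fun_prop) (fun k => ?_) (fun k => ?_)
      fun k => ?_)) ?_
  · rintro ⟨ψ, η⟩ hp
    rw [mem_graph_unitaryConj, mem_graph_mulOp] at hp
    rw [mem_graph_neumannLaplacian]
    exact mem_neumannGraph_of_cosine hp
  · rw [h1]
    exact_mod_cast (hpos k).ne'
  · rw [h1, norm_inv, Complex.norm_real, Real.norm_of_nonneg (hpos k).le]
    exact inv_le_one_of_one_le₀ (by linarith [sq_nonneg (2 * Real.pi * k)])
  · rw [h1, ← Complex.ofReal_inv, ← Complex.ofReal_mul, Complex.norm_real,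
      Real.norm_of_nonneg (by positivity), ← div_eq_mul_inv, div_le_one (hpos k)]
    linarith
  · intro ψ hψ
    rw [mem_graph_neumannLaplacian] at hψ
    exact neumannGraph_injective hψ

end NeumannLaplacian

/-! ### The product in the energy representation -/

section EnergyRepresentation

open scoped FourierTransform

/-- The unitary map to `L²(ℝ)` which turns `H₀` into multiplication by `(2π exp y)²` and `A₀` into
`-1/i d/dy`. -/
def energyUnitary : HalfLineL2 ≃ₗᵢ[ℂ] LineL2 := cosineTransform.trans logUnitary

lemma logUnitary_ae_mul_iff (m : ℝ → ℂ) (φ χ : HalfLineL2) :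
    logUnitary χ =ᵐ[volume] (fun y => m (Real.exp y) * logUnitary φ y) ↔
      χ =ᵐ[volume.restrict (Ioi (0 : ℝ))] fun x => m x * φ x := by
  constructor
  · intro h
    rw [← logUnitary.symm_apply_apply χ, ← logUnitary.symm_apply_apply φ]
    filter_upwards [coeFn_logUnitary_symm (logUnitary χ), coeFn_logUnitary_symm (logUnitary φ),
      quasiMeasurePreserving_log.ae_eq h, ae_restrict_mem measurableSet_Ioi] with x e1 e2 e3 hx
    have e3' : logUnitary χ (Real.log x) =
      m (Real.exp (Real.log x)) * logUnitary φ (Real.log x) := e3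
    rw [e1, e2, e3', Real.exp_log hx]
    ring
  · intro h
    filter_upwards [coeFn_logUnitary χ, coeFn_logUnitary φ, quasiMeasurePreserving_exp.ae_eq h]
      with y e1 e2 e3
    have e3' : χ (Real.exp y) = m (Real.exp y) * φ (Real.exp y) := e3
    rw [e1, e2, e3']
    ring

lemma mem_graph_borelCalculus_neumannLaplacian {g : ℝ → ℂ} (hg : Measurable g)
    (p : HalfLineL2 × HalfLineL2) : p ∈ (borelCalculus neumannLaplacian g).graph ↔
      energyUnitary p.2 =ᵐ[volume]
        fun y => g ((2 * Real.pi * Real.exp y) ^ 2) * energyUnitary p.1 y := by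
  rw [mem_graph_borelCalculus (by fun_prop) cosineTransform neumannLaplacian_eq hg]
  exact (logUnitary_ae_mul_iff (fun k => g ((2 * Real.pi * k) ^ 2)) (cosineTransform p.1)
    (cosineTransform p.2)).symm

/-- The unitary map from the Mellin representation to the Fourier transform of the energy
representation. It intertwines multiplication by `2π ξ` with multiplication by `-2π ξ`. -/
def mellinReversal : LineL2 ≃ₗᵢ[ℂ] LineL2 :=
  lineFourier.symm.trans (logCosine.trans lineFourier)

lemma mellinReversal_mellinUnitary (ψ : HalfLineL2) :
    mellinReversal (mellinUnitary ψ) = lineFourier (energyUnitary ψ) := by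
  simp [mellinReversal, mellinUnitary, logCosine, energyUnitary]

lemma mellinReversal_exp (t : ℝ) (φ : LineL2) :
    mellinReversal (boundedMul volume
      (fun ξ : ℝ => Complex.exp (t * (2 * Real.pi * ξ : ℝ) * Complex.I)) φ) =
    boundedMul volume (fun ξ : ℝ => Complex.exp (t * (-(2 * Real.pi * ξ) : ℝ) * Complex.I))
      (mellinReversal φ) := by
  have h1 := lineFourier_lineTranslation t (lineFourier.symm φ)
  rw [LinearIsometryEquiv.apply_symm_apply] at h1
  rw [← h1]
  have h2 := lineFourier_lineTranslation (-t) (logCosine (lineFourier.symm φ))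
  rw [← logCosine_lineTranslation] at h2
  have h3 : ∀ ξ : ℝ, ((-t : ℝ) : ℂ) * (2 * Real.pi * ξ : ℝ) * Complex.I =
      t * (-(2 * Real.pi * ξ) : ℝ) * Complex.I := fun ξ => by push_cast; ring
  simp only [h3] at h2
  simpa [mellinReversal] using h2

lemma mem_graph_borelCalculus_dilationGenerator {f : ℝ → ℂ} (hf : Measurable f)
    (p : HalfLineL2 × HalfLineL2) : p ∈ (borelCalculus dilationGenerator f).graph ↔
      lineFourier (energyUnitary p.2) =ᵐ[volume]
        fun ξ => f (-(2 * Real.pi * ξ)) * lineFourier (energyUnitary p.1) ξ := by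
  rw [mem_graph_borelCalculus (by fun_prop) mellinUnitary dilationGenerator_eq hf,
    ← mellinReversal_mellinUnitary, ← mellinReversal_mellinUnitary]
  constructor
  · intro h
    exact intertwine_mulOp (by fun_prop) (by fun_prop) mellinReversal mellinReversal_exp hf h
  · intro h
    have := intertwine_mulOp (a := fun ξ : ℝ => -(2 * Real.pi * ξ))
      (a' := fun ξ : ℝ => 2 * Real.pi * ξ) (by fun_prop) (by fun_prop) mellinReversal.symm
      (fun t φ => by
        rw [LinearIsometryEquiv.symm_apply_eq, mellinReversal_exp,
          LinearIsometryEquiv.apply_symm_apply]) hf h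
    simpa using this

/-- In the energy representation `g(H₀) f(A₀)` is the product of a multiplication operator and a
Fourier multiplier. -/
theorem mem_graph_energyDilationProduct {f g : ℝ → ℂ} (hf : Measurable f) (hg : Measurable g)
    (φ χ : LineL2) :
    (energyUnitary.symm φ, energyUnitary.symm χ) ∈ (energyDilationProduct g f).graph ↔
      ∃ y : LineL2, lineFourier y =ᵐ[volume] (fun ξ => f (-(2 * Real.pi * ξ)) * lineFourier φ ξ) ∧
        χ =ᵐ[volume] fun x => g ((2 * Real.pi * Real.exp x) ^ 2) * y x := by
  rw [energyDilationProduct, mem_graph_opMul]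
  constructor
  · rintro ⟨y, h1, h2⟩
    rw [mem_graph_borelCalculus_dilationGenerator hf] at h1
    rw [mem_graph_borelCalculus_neumannLaplacian hg] at h2
    refine ⟨energyUnitary y, ?_, ?_⟩
    · simpa using h1
    · simpa using h2
  · rintro ⟨y, h1, h2⟩
    refine ⟨energyUnitary.symm y, ?_, ?_⟩
    · rw [mem_graph_borelCalculus_dilationGenerator hf]
      simpa using h1
    · rw [mem_graph_borelCalculus_neumannLaplacian hg]
      simpa using h2

end EnergyRepresentation

/-! ### Hilbert-Schmidt and trace class operators -/

section HilbertSchmidt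

lemma tsum_norm_sq_eq_toReal {ι E : Type} [NormedAddCommGroup E] (v : ι → E) :
    ∑' i, ‖v i‖ ^ 2 = (∑' i, ‖v i‖ₑ ^ 2).toReal := by
  rw [ENNReal.tsum_toReal_eq fun i => ENNReal.pow_ne_top enorm_ne_top]
  simp

lemma tsum_enorm_sq_ne_top_iff {ι E : Type} [NormedAddCommGroup E] (v : ι → E) :
    ∑' i, ‖v i‖ₑ ^ 2 ≠ ∞ ↔ Summable fun i => ‖v i‖ ^ 2 := by
  have h : ∀ i, ‖v i‖ₑ ^ 2 = ((‖v i‖₊ ^ 2 : ℝ≥0) : ℝ≥0∞) := fun i => by simp [enorm_eq_nnnorm]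
  simp_rw [h]
  rw [ENNReal.tsum_coe_ne_top_iff_summable, ← NNReal.summable_coe]
  simp

variable {H : Type} [NormedAddCommGroup H] [InnerProductSpace ℂ H]

lemma HilbertBasis.hasSum_norm_sq {ι : Type} (b : HilbertBasis ι ℂ H) (x : H) :
    HasSum (fun i => ‖inner ℂ (b i) x‖ ^ 2) (‖x‖ ^ 2) := by
  have h := b.hasSum_inner_mul_inner x x
  rw [inner_self_eq_norm_sq_to_K] at h
  have h2 : (fun i => inner ℂ x (b i) * inner ℂ (b i) x) =
      fun i => ((‖inner ℂ (b i) x‖ ^ 2 : ℝ) : ℂ) := funext fun i => by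
    rw [← inner_conj_symm, ← Complex.normSq_eq_conj_mul_self, Complex.normSq_eq_norm_sq]
  rw [h2] at h
  refine Complex.hasSum_ofReal.1 ?_
  rw [Complex.ofReal_pow]
  exact h

lemma HilbertBasis.tsum_enorm_sq {ι : Type} (b : HilbertBasis ι ℂ H) (x : H) :
    ∑' i, ‖inner ℂ (b i) x‖ₑ ^ 2 = ‖x‖ₑ ^ 2 := by
  have h := b.hasSum_norm_sq x
  have h1 := ENNReal.ofReal_tsum_of_nonneg (fun i => sq_nonneg ‖inner ℂ (b i) x‖) h.summable
  rw [h.tsum_eq] at h1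
  simpa [ENNReal.ofReal_pow] using h1.symm

lemma enorm_apply_le_of_norm_le_one {X : H →L[ℂ] H} (hX : ‖X‖ ≤ 1) (x : H) : ‖X x‖ₑ ≤ ‖x‖ₑ :=
  enorm_le_iff_norm_le.2 (X.le_of_opNorm_le_of_le hX le_rfl |>.trans (one_mul _).le)

/-- The Cauchy-Schwarz inequality for the Hilbert-Schmidt inner product. -/
lemma summable_inner_of_summable_sq {ι : Type} {v w : ι → H} (hv : Summable fun i => ‖v i‖ ^ 2)
    (hw : Summable fun i => ‖w i‖ ^ 2) : (Summable fun i => inner ℂ (v i) (w i)) ∧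
      ‖∑' i, inner ℂ (v i) (w i)‖ ≤ √(∑' i, ‖v i‖ ^ 2) * √(∑' i, ‖w i‖ ^ 2) := by
  have h1 := Real.summable_and_inner_le_Lp_mul_Lq_tsum_of_nonneg (f := fun i => ‖v i‖) (g := fun i => ‖w i‖)
    Real.HolderConjugate.two_two (fun i => norm_nonneg _) (fun i => norm_nonneg _)
    (by simpa using hv) (by simpa using hw)
  have h2 : Summable fun i => ‖inner ℂ (v i) (w i)‖ :=
    Summable.of_nonneg_of_le (fun i => norm_nonneg _) (fun i => norm_inner_le_norm _ _) h1.1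
  refine ⟨h2.of_norm, (norm_tsum_le_tsum_norm h2).trans ?_⟩
  refine (h2.tsum_le_tsum (fun i => norm_inner_le_norm _ _) h1.1).trans ?_
  simpa [Real.sqrt_eq_rpow] using h1.2

variable [CompleteSpace H]

lemma tsum_enorm_sq_adjoint {ι ι' : Type} (b : HilbertBasis ι ℂ H) (b' : HilbertBasis ι' ℂ H)
    (B : H →L[ℂ] H) :
    ∑' i, ‖B (b i)‖ₑ ^ 2 = ∑' j, ‖ContinuousLinearMap.adjoint B (b' j)‖ₑ ^ 2 := by
  simp_rw [← b'.tsum_enorm_sq (B _), ← b.tsum_enorm_sq (ContinuousLinearMap.adjoint B _)]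
  rw [ENNReal.tsum_comm]
  refine tsum_congr fun j => tsum_congr fun i => ?_
  rw [ContinuousLinearMap.adjoint_inner_right, ← ofReal_norm, ← ofReal_norm, norm_inner_symm]

lemma tsum_enorm_sq_basis {ι ι' : Type} (b : HilbertBasis ι ℂ H) (b' : HilbertBasis ι' ℂ H)
    (B : H →L[ℂ] H) : ∑' i, ‖B (b i)‖ₑ ^ 2 = ∑' j, ‖B (b' j)‖ₑ ^ 2 := by
  rw [tsum_enorm_sq_adjoint b b', tsum_enorm_sq_adjoint b' b',
    ContinuousLinearMap.adjoint_adjoint]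

lemma hilbertSchmidtNorm_eq {ι : Type} (b : HilbertBasis ι ℂ H) (B : H →L[ℂ] H) :
    hilbertSchmidtNorm B = (∑' i, ‖B (b i)‖ₑ ^ 2) ^ (1 / 2 : ℝ) := by
  rw [hilbertSchmidtNorm, tsum_enorm_sq_basis (someBasis H) b]

lemma tsum_enorm_sq_comp_le {ι : Type} (b : HilbertBasis ι ℂ H) (B : H →L[ℂ] H) {X : H →L[ℂ] H}
    (hX : ‖X‖ ≤ 1) : ∑' i, ‖B (X (b i))‖ₑ ^ 2 ≤ ∑' i, ‖B (b i)‖ₑ ^ 2 := by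
  have h := tsum_enorm_sq_adjoint b b (B ∘L X)
  simp only [ContinuousLinearMap.comp_apply] at h
  rw [h, tsum_enorm_sq_adjoint b b B]
  refine ENNReal.tsum_le_tsum fun i => ?_
  rw [ContinuousLinearMap.adjoint_comp]
  gcongr
  exact enorm_apply_le_of_norm_le_one
    ((LinearIsometryEquiv.norm_map ContinuousLinearMap.adjoint X).trans_le hX) _

/-- The absolute value of a trace class operator is the square of a Hilbert-Schmidt operator, so by
the polar decomposition a trace class operator is a product of two Hilbert-Schmidt operators. -/
lemma IsTraceClass.exists_factorization {B : H →L[ℂ] H} (hB : IsTraceClass B) {ι : Type}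
    (b : HilbertBasis ι ℂ H) : ∃ R S : H →L[ℂ] H, B = R ∘L S ∧
      (Summable fun i => ‖R (b i)‖ ^ 2) ∧ Summable fun i => ‖S (b i)‖ ^ 2 := by
  set A := CFC.abs B with hA
  have hA0 : 0 ≤ A := CFC.abs_nonneg B
  have hAsa : IsSelfAdjoint A := hA0.isSelfAdjoint
  have hAA : A * A = star B * B := CFC.abs_mul_abs B
  have hnorm : ∀ x, ‖A x‖ = ‖B x‖ := by
    intro x
    have h1 : inner ℂ (A x) (A x) = inner ℂ (B x) (B x) := by
      rw [← ContinuousLinearMap.adjoint_inner_right, ← ContinuousLinearMap.adjoint_inner_right,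
        ← ContinuousLinearMap.star_eq_adjoint, ← ContinuousLinearMap.star_eq_adjoint,
        hAsa.star_eq, ← mul_apply_eq_comp, ← mul_apply_eq_comp, hAA]
    have h2 : ‖A x‖ ^ 2 = ‖B x‖ ^ 2 := by
      rw [inner_self_eq_norm_sq_to_K, inner_self_eq_norm_sq_to_K] at h1
      exact_mod_cast h1
    exact (sq_eq_sq₀ (norm_nonneg _) (norm_nonneg _)).1 h2
  set S := CFC.sqrt A with hS
  have hSS : S * S = A := CFC.sqrt_mul_sqrt_self A hA0
  have hSsa : IsSelfAdjoint S := (CFC.sqrt_nonneg A).isSelfAdjoint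
  have hSsum : ∑' i, ‖S (b i)‖ₑ ^ 2 ≠ ∞ := by
    have h1 : ∀ x, ENNReal.ofReal (inner ℂ x (A x)).re = ‖S x‖ₑ ^ 2 := by
      intro x
      have h2 : inner ℂ x (A x) = inner ℂ (S x) (S x) := by
        rw [← hSS, mul_apply_eq_comp, ← ContinuousLinearMap.adjoint_inner_left,
          ← ContinuousLinearMap.star_eq_adjoint, hSsa.star_eq]
      rw [h2, inner_self_eq_norm_sq_to_K, ← ofReal_norm, ← ENNReal.ofReal_pow (norm_nonneg _)]
      congr 1
      exact (congrArg Complex.re (Complex.ofReal_pow ‖S x‖ 2)).symm.trans (Complex.ofReal_re _)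
    rw [tsum_enorm_sq_basis b (someBasis H)]
    have h2 : ∑' i, ENNReal.ofReal (inner ℂ (someBasis H i) (A (someBasis H i))).re < ∞ := hB
    simp_rw [h1] at h2
    exact h2.ne
  -- the partial isometry of the polar decomposition
  set K : Submodule ℂ H := (LinearMap.range (A : H →ₗ[ℂ] H)).topologicalClosure with hK
  have : CompleteSpace K := (Submodule.isClosed_topologicalClosure _).completeSpace_coe
  set e : H →ₗ[ℂ] K := (A : H →ₗ[ℂ] H).codRestrict K
    (fun x => Submodule.le_topologicalClosure _ (LinearMap.mem_range_self _ x)) with he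
  have hdense : DenseRange e := by
    intro ⟨x, hx⟩
    rw [closure_subtype]
    have h1 : Subtype.val '' (range e) = (LinearMap.range (A : H →ₗ[ℂ] H) : Set H) := by
      ext y
      constructor
      · rintro ⟨_, ⟨z, rfl⟩, rfl⟩
        exact ⟨z, rfl⟩
      · rintro ⟨z, rfl⟩
        exact ⟨e z, ⟨z, rfl⟩, rfl⟩
    rw [h1]
    exact hx
  set U₀ : K →L[ℂ] H := LinearMap.extendOfNorm (B : H →ₗ[ℂ] H) e with hU₀
  have hU₀e : ∀ x, U₀ (e x) = B x := fun x =>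
    LinearMap.extendOfNorm_eq hdense ⟨1, fun x => by
      rw [one_mul]
      exact (hnorm x).ge⟩ x
  set U : H →L[ℂ] H := U₀ ∘L K.orthogonalProjectionOnto with hU
  have hUA : ∀ x, U (A x) = B x := by
    intro x
    have h1 : K.orthogonalProjectionOnto (A x) = e x :=
      Submodule.orthogonalProjectionOnto_mem_subspace_eq_self (e x)
    rw [hU, ContinuousLinearMap.comp_apply, h1, hU₀e]
  have hSs := (tsum_enorm_sq_ne_top_iff _).1 hSsum
  refine ⟨U ∘L S, S, ?_, ?_, hSs⟩
  · ext x
    rw [← hUA, ← hSS]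
    rfl
  · refine Summable.of_nonneg_of_le (fun i => sq_nonneg _) (fun i => ?_) (hSs.mul_left (‖U‖ ^ 2))
    rw [← mul_pow]
    gcongr
    exact U.le_opNorm _

/-- The pairing `tr (X* R S)` of contractions `X` with a product of Hilbert-Schmidt operators is
bounded. -/
lemma exists_norm_tsum_inner_le {ι : Type} (b : HilbertBasis ι ℂ H) {R S : H →L[ℂ] H}
    (hR : Summable fun i => ‖R (b i)‖ ^ 2) (hS : Summable fun i => ‖S (b i)‖ ^ 2) :
    ∃ C : ℝ, ∀ X : H →L[ℂ] H, ‖X‖ ≤ 1 → ‖∑' i, inner ℂ (X (b i)) ((R ∘L S) (b i))‖ ≤ C := by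
  have hR' : ∑' i, ‖ContinuousLinearMap.adjoint R (b i)‖ₑ ^ 2 ≠ ∞ := by
    rw [← tsum_enorm_sq_adjoint b b]
    exact (tsum_enorm_sq_ne_top_iff _).2 hR
  refine ⟨√(∑' i, ‖ContinuousLinearMap.adjoint R (b i)‖ₑ ^ 2).toReal * √(∑' i, ‖S (b i)‖ ^ 2),
    fun X hX => ?_⟩
  have hle := tsum_enorm_sq_comp_le b (ContinuousLinearMap.adjoint R) hX
  have h1 := (tsum_enorm_sq_ne_top_iff _).1 (ne_top_of_le_ne_top hR' hle)
  have h2 : ∀ i, inner ℂ (X (b i)) ((R ∘L S) (b i)) =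
      inner ℂ (ContinuousLinearMap.adjoint R (X (b i))) (S (b i)) := fun i => by
    rw [ContinuousLinearMap.adjoint_inner_left]
    rfl
  simp_rw [h2]
  refine (summable_inner_of_summable_sq h1 hS).2.trans ?_
  gcongr
  rw [tsum_norm_sq_eq_toReal]
  exact ENNReal.toReal_mono hR' hle

/-- The trace of a product `R S` of Hilbert-Schmidt operators is the limit of the traces of
`Xₙ* R S` for contractions `Xₙ` such that `Xₙ*` converges strongly to the identity. -/
lemma hasSum_inner_comp_of_tendsto {ι : Type} (b : HilbertBasis ι ℂ H) {R S : H →L[ℂ] H}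
    (hR : Summable fun i => ‖R (b i)‖ ^ 2) (hS : Summable fun i => ‖S (b i)‖ ^ 2)
    {X : ℕ → H →L[ℂ] H} (hX : ∀ n, ‖X n‖ ≤ 1)
    (hX' : ∀ x, Tendsto (fun n => ContinuousLinearMap.adjoint (X n) x) atTop (𝓝 x))
    {s : ℕ → ℂ} (hs : ∀ n, HasSum (fun i => inner ℂ (X n (b i)) ((R ∘L S) (b i))) (s n)) {c : ℂ}
    (hc : Tendsto s atTop (𝓝 c)) : HasSum (fun i => inner ℂ (b i) ((R ∘L S) (b i))) c := by
  set Y : ℕ → H →L[ℂ] H := fun n => ContinuousLinearMap.id ℂ H - X n with hY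
  have hY2 : ∀ n, ‖ContinuousLinearMap.adjoint (Y n)‖ ≤ 2 := fun n => by
    rw [LinearIsometryEquiv.norm_map]
    refine (norm_sub_le _ _).trans ?_
    linarith [hX n, ContinuousLinearMap.norm_id_le (𝕜 := ℂ) (E := H)]
  have hYlim : ∀ x, Tendsto (fun n => ContinuousLinearMap.adjoint (Y n) x) atTop (𝓝 0) := by
    intro x
    have h1 : ∀ n, ContinuousLinearMap.adjoint (Y n) x =
        x - ContinuousLinearMap.adjoint (X n) x := fun n => by
      rw [hY, map_sub, ContinuousLinearMap.adjoint_id]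
      rfl
    simp_rw [h1]
    simpa using (tendsto_const_nhds (x := x)).sub (hX' x)
  -- the Hilbert-Schmidt norms of `R* Yₙ` tend to zero
  have hbound : ∀ n i, ‖ContinuousLinearMap.adjoint (Y n) (R (b i))‖ ^ 2 ≤
      2 ^ 2 * ‖R (b i)‖ ^ 2 := fun n i => by
    rw [← mul_pow]
    gcongr
    exact ContinuousLinearMap.le_of_opNorm_le _ (hY2 n) _
  have ha : Tendsto (fun n => ∑' i, ‖ContinuousLinearMap.adjoint (Y n) (R (b i))‖ ^ 2) atTop
      (𝓝 0) := by
    have h1 := tendsto_tsum_of_dominated_convergence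
      (f := fun n i => ‖ContinuousLinearMap.adjoint (Y n) (R (b i))‖ ^ 2) (g := fun _ => (0 : ℝ))
      (bound := fun i => 2 ^ 2 * ‖R (b i)‖ ^ 2) (hR.mul_left _)
      (fun i => by simpa using ((hYlim (R (b i))).norm.pow 2))
      (Eventually.of_forall fun n i => by
        rw [Real.norm_of_nonneg (sq_nonneg _)]
        exact hbound n i)
    simpa using h1
  have hsw : ∀ n, ∑' i, ‖ContinuousLinearMap.adjoint R (Y n (b i))‖ₑ ^ 2 =
      ∑' i, ‖ContinuousLinearMap.adjoint (Y n) (R (b i))‖ₑ ^ 2 := fun n => by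
    have h := tsum_enorm_sq_adjoint b b (ContinuousLinearMap.adjoint R ∘L Y n)
    rw [ContinuousLinearMap.adjoint_comp, ContinuousLinearMap.adjoint_adjoint] at h
    exact h
  have hYR : ∀ n, Summable fun i => ‖ContinuousLinearMap.adjoint (Y n) (R (b i))‖ ^ 2 := fun n =>
    Summable.of_nonneg_of_le (fun i => sq_nonneg _) (hbound n) (hR.mul_left _)
  have hRY : ∀ n, Summable fun i => ‖ContinuousLinearMap.adjoint R (Y n (b i))‖ ^ 2 := fun n => by
    rw [← tsum_enorm_sq_ne_top_iff, hsw, tsum_enorm_sq_ne_top_iff]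
    exact hYR n
  have hin : ∀ (Z : H →L[ℂ] H) i, inner ℂ (Z (b i)) ((R ∘L S) (b i)) =
      inner ℂ (ContinuousLinearMap.adjoint R (Z (b i))) (S (b i)) := fun Z i => by
    rw [ContinuousLinearMap.adjoint_inner_left]
    rfl
  have hYs : ∀ n, Summable (fun i => inner ℂ (Y n (b i)) ((R ∘L S) (b i))) ∧
      ‖∑' i, inner ℂ (Y n (b i)) ((R ∘L S) (b i))‖ ≤
        √(∑' i, ‖ContinuousLinearMap.adjoint (Y n) (R (b i))‖ ^ 2) * √(∑' i, ‖S (b i)‖ ^ 2) := by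
    intro n
    simp_rw [hin]
    have h := summable_inner_of_summable_sq (hRY n) hS
    rwa [tsum_norm_sq_eq_toReal, hsw, ← tsum_norm_sq_eq_toReal] at h
  have hsum : ∀ n, HasSum (fun i => inner ℂ (b i) ((R ∘L S) (b i)))
      (s n + ∑' i, inner ℂ (Y n (b i)) ((R ∘L S) (b i))) := by
    intro n
    have h := (hs n).add (hYs n).1.hasSum
    refine h.congr_fun ?_ |> id
    intro i
    rw [← inner_add_left]
    simp [hY]
  have hlim : Tendsto (fun n => s n + ∑' i, inner ℂ (Y n (b i)) ((R ∘L S) (b i))) atTop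
      (𝓝 (c + 0)) := by
    refine hc.add (squeeze_zero_norm (fun n => (hYs n).2) ?_)
    simpa using (ha.sqrt).mul_const (√(∑' i, ‖S (b i)‖ ^ 2))
  rw [add_zero] at hlim
  have hconst : ∀ n, s n + ∑' i, inner ℂ (Y n (b i)) ((R ∘L S) (b i)) =
      s 0 + ∑' i, inner ℂ (Y 0 (b i)) ((R ∘L S) (b i)) := fun n => (hsum n).unique (hsum 0)
  have h0 := hsum 0
  rwa [tendsto_nhds_unique (tendsto_const_nhds.congr fun n => (hconst n).symm) hlim] at h0

end HilbertSchmidt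

/-! ### Products of a multiplication operator and a Fourier multiplier -/

section KernelOperators

open scoped FourierTransform

/-- The vector `k_y` for which `⟨k_y, φ⟩` is the value at `y` of the inverse Fourier transform of
`h · φ̂`. -/
def kernelVec (h : LineL2) (y : ℝ) : LineL2 :=
  lineFourier.symm (boundedMul volume
    (fun ξ : ℝ => Complex.exp ((-(2 * Real.pi * ξ * y) : ℝ) * Complex.I)) (star h))

lemma norm_char_le (y ξ : ℝ) :
    ‖Complex.exp ((-(2 * Real.pi * ξ * y) : ℝ) * Complex.I)‖ ≤ 1 := by
  rw [Complex.norm_exp_ofReal_mul_I]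

lemma coeFn_char_mul (h : LineL2) (y : ℝ) : boundedMul volume
    (fun ξ : ℝ => Complex.exp ((-(2 * Real.pi * ξ * y) : ℝ) * Complex.I)) (star h) =ᵐ[volume]
      fun ξ => Complex.exp ((-(2 * Real.pi * ξ * y) : ℝ) * Complex.I) * starRingEnd ℂ (h ξ) := by
  filter_upwards [coeFn_boundedMul (μ := volume) (by fun_prop) (norm_char_le y) (star h),
    Lp.coeFn_star h] with ξ e1 e2
  rw [e1, e2]
  rfl

lemma fourierInv_mul_eq_inner (h φ : LineL2) (y : ℝ) :
    𝓕⁻ (fun ξ => h ξ * lineFourier φ ξ) y = inner ℂ (kernelVec h y) φ := by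
  rw [kernelVec, ← lineFourier.inner_map_map, LinearIsometryEquiv.apply_symm_apply, L2.inner_def,
    Real.fourierInv_eq']
  refine integral_congr_ae ?_
  filter_upwards [coeFn_char_mul h y] with ξ e1
  have h1 : inner ℝ ξ y = ξ * y := by simp [mul_comm]
  have h2 : starRingEnd ℂ ((-(2 * Real.pi * ξ * y) : ℝ) * Complex.I) =
      (2 * Real.pi * (ξ * y) : ℝ) * Complex.I := by
    rw [map_mul, Complex.conj_ofReal, Complex.conj_I]
    push_cast
    ring
  rw [e1, h1]
  simp only [RCLike.inner_apply, map_mul (starRingEnd ℂ), Complex.conj_conj, smul_eq_mul]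
  rw [← Complex.exp_conj, h2]
  ring

lemma inner_kernelVec (h₁ h₂ : LineL2) (y : ℝ) :
    inner ℂ (kernelVec h₁ y) (kernelVec h₂ y) = inner ℂ h₂ h₁ := by
  rw [kernelVec, kernelVec, LinearIsometryEquiv.inner_map_map, L2.inner_def, L2.inner_def]
  refine integral_congr_ae ?_
  filter_upwards [coeFn_char_mul h₁ y, coeFn_char_mul h₂ y] with ξ e1 e2
  rw [e1, e2]
  simp only [RCLike.inner_apply, map_mul, Complex.conj_conj]
  have h3 : Complex.exp ((-(2 * Real.pi * ξ * y) : ℝ) * Complex.I) *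
      starRingEnd ℂ (Complex.exp ((-(2 * Real.pi * ξ * y) : ℝ) * Complex.I)) = 1 := by
    rw [Complex.mul_conj, Complex.normSq_eq_norm_sq, Complex.norm_exp_ofReal_mul_I]
    simp
  linear_combination starRingEnd ℂ (h₂ ξ) * h₁ ξ * h3

lemma norm_kernelVec (h : LineL2) (y : ℝ) : ‖kernelVec h y‖ = ‖h‖ := by
  have h1 := inner_kernelVec h h y
  have h2 : ‖kernelVec h y‖ ^ 2 = ‖h‖ ^ 2 := by
    rw [inner_self_eq_norm_sq_to_K, inner_self_eq_norm_sq_to_K] at h1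
    exact_mod_cast h1
  exact (sq_eq_sq₀ (norm_nonneg _) (norm_nonneg _)).1 h2

lemma integrable_mul_lineFourier (h φ : LineL2) :
    Integrable fun ξ => h ξ * lineFourier φ ξ :=
  (Lp.memLp h).integrable_mul (Lp.memLp (lineFourier φ))

lemma continuous_inner_kernelVec (h φ : LineL2) : Continuous fun y => inner ℂ (kernelVec h y) φ := by
  simp_rw [← fourierInv_mul_eq_inner]
  exact fourierInv_continuous_of_integrable (integrable_mul_lineFourier h φ)

lemma norm_inner_kernelVec_le (h φ : LineL2) (y : ℝ) :
    ‖inner ℂ (kernelVec h y) φ‖ ≤ ‖h‖ * ‖φ‖ := by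
  rw [← norm_kernelVec h y]
  exact norm_inner_le_norm _ _

/-- The Fourier multiplier `h` applied to `φ`, evaluated pointwise. -/
lemma ae_eq_inner_kernelVec {h φ y : LineL2}
    (hy : lineFourier y =ᵐ[volume] fun ξ => h ξ * lineFourier φ ξ) :
    y =ᵐ[volume] fun x => inner ℂ (kernelVec h x) φ := by
  have hi : Integrable (lineFourier y) := (integrable_mul_lineFourier h φ).congr hy.symm
  have h1 := coeFn_lineFourier_symm hi
  rw [LinearIsometryEquiv.symm_apply_apply] at h1
  filter_upwards [h1] with x hx
  rw [hx, ← fourierInv_mul_eq_inner]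
  exact congrFun (funext fun x => Real.fourierInv_congr_ae hy x) x

lemma memLp_mul_inner_kernelVec (G h φ : LineL2) :
    MemLp (fun y => G y * inner ℂ (kernelVec h y) φ) 2 volume := by
  refine (Lp.memLp G).of_le_mul (c := ‖h‖ * ‖φ‖) ((Lp.aestronglyMeasurable G).mul
    (continuous_inner_kernelVec h φ).aestronglyMeasurable) (Eventually.of_forall fun y => ?_)
  rw [norm_mul, mul_comm]
  exact mul_le_mul_of_nonneg_right (norm_inner_kernelVec_le h φ y) (norm_nonneg _)

/-- The integral operator `φ ↦ G · 𝓕⁻¹ (h · 𝓕 φ)` for square integrable `G` and `h`. -/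
def kernelOp (G h : LineL2) : LineL2 →L[ℂ] LineL2 :=
  LinearMap.mkContinuous
    { toFun := fun φ => (memLp_mul_inner_kernelVec G h φ).toLp _
      map_add' := by
        intro φ ψ
        rw [← MemLp.toLp_add, MemLp.toLp_eq_toLp_iff]
        refine Eventually.of_forall fun y => ?_
        simp only [Pi.add_apply, inner_add_right, mul_add]
      map_smul' := by
        intro c φ
        rw [RingHom.id_apply, ← MemLp.toLp_const_smul, MemLp.toLp_eq_toLp_iff]
        refine Eventually.of_forall fun y => ?_
        simp only [Pi.smul_apply, inner_smul_right, smul_eq_mul]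
        ring }
    (‖h‖ * ‖G‖) (by
      intro φ
      have : ‖h‖ * ‖G‖ * ‖φ‖ = (‖h‖ * ‖φ‖) * ‖G‖ := by ring
      rw [this]
      refine Lp.norm_le_mul_norm_of_ae_le_mul ?_
      filter_upwards [(memLp_mul_inner_kernelVec G h φ).coeFn_toLp] with y hy
      refine (congrArg norm hy).trans_le ?_
      rw [norm_mul, mul_comm]
      exact mul_le_mul_of_nonneg_right (norm_inner_kernelVec_le h φ y) (norm_nonneg _))

lemma coeFn_kernelOp (G h φ : LineL2) :
    kernelOp G h φ =ᵐ[volume] fun y => G y * inner ℂ (kernelVec h y) φ :=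
  (memLp_mul_inner_kernelVec G h φ).coeFn_toLp

lemma HilbertBasis.countable {H ι : Type} [NormedAddCommGroup H] [InnerProductSpace ℂ H]
    [TopologicalSpace.SeparableSpace H] (b : HilbertBasis ι ℂ H) : Countable ι := by
  -- distinct basis vectors have distance `√2`
  refine Pairwise.countable_of_isOpen_disjoint (s := fun i => Metric.ball (b i) (1 / 2)) ?_
    (fun i => Metric.isOpen_ball) fun i => ⟨b i, Metric.mem_ball_self (by norm_num)⟩
  intro i j hij
  refine Metric.ball_disjoint_ball ?_
  have h1 : ‖b i - b j‖ ^ 2 = 2 := by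
    rw [@norm_sub_sq ℂ, b.orthonormal.2 hij, b.orthonormal.1, b.orthonormal.1]
    norm_num
  rw [dist_eq_norm]
  nlinarith [norm_nonneg (b i - b j)]

instance : TopologicalSpace.SeparableSpace LineL2 := by
  have : Fact ((2 : ℝ≥0∞) ≠ ∞) := ⟨by norm_num⟩
  infer_instance

/-- The Hilbert-Schmidt inner product of two kernel operators, by Parseval's identity for the
vectors `k_y`. -/
lemma hasSum_inner_kernelOp {ι : Type} (b : HilbertBasis ι ℂ LineL2) (G₁ h₁ G₂ h₂ : LineL2) :
    HasSum (fun i => inner ℂ (kernelOp G₁ h₁ (b i)) (kernelOp G₂ h₂ (b i)))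
      (inner ℂ G₁ G₂ * inner ℂ h₁ h₂) := by
  have := b.countable
  rw [L2.inner_def G₁ G₂, ← integral_mul_const]
  have hG : Integrable fun y => ‖G₁ y‖ * ‖G₂ y‖ :=
    (Lp.memLp G₁).norm.integrable_mul (Lp.memLp G₂).norm
  simp_rw [L2.inner_def (kernelOp _ _ _)]
  have hpars : ∀ (h : LineL2) (y : ℝ), HasSum (fun i => ‖inner ℂ (kernelVec h y) (b i)‖ ^ 2)
      (‖h‖ ^ 2) := fun h y => by
    rw [← norm_kernelVec h y]
    refine (b.hasSum_norm_sq (kernelVec h y)).congr_fun ?_ |> id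
    intro i
    rw [norm_inner_symm]
  have hbs : ∀ y, HasSum (fun i => ‖G₁ y‖ * ‖G₂ y‖ * ((‖inner ℂ (kernelVec h₁ y) (b i)‖ ^ 2 +
      ‖inner ℂ (kernelVec h₂ y) (b i)‖ ^ 2) / 2)) (‖G₁ y‖ * ‖G₂ y‖ * ((‖h₁‖ ^ 2 + ‖h₂‖ ^ 2) / 2)) :=
    fun y => (((hpars h₁ y).add (hpars h₂ y)).div_const 2).mul_left _
  have hae : ∀ i, ∀ᵐ y, inner ℂ (kernelOp G₁ h₁ (b i) y) (kernelOp G₂ h₂ (b i) y) =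
      inner ℂ (G₁ y) (G₂ y) *
        (inner ℂ (kernelVec h₂ y) (b i) * inner ℂ (b i) (kernelVec h₁ y)) := fun i => by
    filter_upwards [coeFn_kernelOp G₁ h₁ (b i), coeFn_kernelOp G₂ h₂ (b i)] with y e1 e2
    rw [e1, e2, ← inner_conj_symm (b i) (kernelVec h₁ y)]
    simp only [RCLike.inner_apply, map_mul]
    ring
  refine hasSum_integral_of_dominated_convergence
    (fun i y => ‖G₁ y‖ * ‖G₂ y‖ * ((‖inner ℂ (kernelVec h₁ y) (b i)‖ ^ 2 +
      ‖inner ℂ (kernelVec h₂ y) (b i)‖ ^ 2) / 2)) (fun i => ?_) (fun i => ?_) ?_ ?_ ?_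
  · exact (Lp.aestronglyMeasurable _).inner (Lp.aestronglyMeasurable _)
  · filter_upwards [hae i] with y hy
    rw [hy, norm_mul, norm_mul, norm_inner_symm (b i)]
    have h1 : ‖inner ℂ (G₁ y) (G₂ y)‖ ≤ ‖G₁ y‖ * ‖G₂ y‖ := norm_inner_le_norm _ _
    gcongr
    nlinarith [sq_nonneg (‖inner ℂ (kernelVec h₁ y) (b i)‖ - ‖inner ℂ (kernelVec h₂ y) (b i)‖)]
  · exact Eventually.of_forall fun y => (hbs y).summable
  · simp_rw [(hbs _).tsum_eq]
    exact hG.mul_const _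
  · filter_upwards [ae_all_iff.2 hae] with y hy
    simp_rw [hy]
    refine HasSum.mul_left _ ?_
    rw [← inner_kernelVec h₂ h₁ y]
    exact b.hasSum_inner_mul_inner _ _

lemma tsum_enorm_sq_kernelOp {ι : Type} (b : HilbertBasis ι ℂ LineL2) (G h : LineL2) :
    ∑' i, ‖kernelOp G h (b i)‖ₑ ^ 2 = ‖G‖ₑ ^ 2 * ‖h‖ₑ ^ 2 := by
  have h1 := hasSum_inner_kernelOp b G h G h
  have h2 : HasSum (fun i => ‖kernelOp G h (b i)‖ ^ 2) (‖G‖ ^ 2 * ‖h‖ ^ 2) := by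
    refine Complex.hasSum_ofReal.1 ?_
    simp only [inner_self_eq_norm_sq_to_K] at h1
    push_cast
    exact h1
  have h3 := ENNReal.ofReal_tsum_of_nonneg (fun i => sq_nonneg ‖kernelOp G h (b i)‖) h2.summable
  rw [h2.tsum_eq] at h3
  simpa [ENNReal.ofReal_pow, ENNReal.ofReal_mul] using h3.symm

end KernelOperators

/-! ### Truncation -/

section Truncation

variable {X : Type} [MeasurableSpace X] {μ : Measure X}

lemma norm_boundedMul_le {m : X → ℂ} (hm : Measurable m) (hC : ∀ x, ‖m x‖ ≤ 1) :
    ‖boundedMul μ m‖ ≤ 1 :=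
  ContinuousLinearMap.opNorm_le_bound _ zero_le_one fun φ => norm_boundedMul_apply_le hm hC φ

lemma inner_boundedMul_left {m : X → ℂ} (hm : Measurable m) {C : ℝ} (hC : ∀ x, ‖m x‖ ≤ C)
    (φ ψ : Lp ℂ 2 μ) : inner ℂ (boundedMul μ m φ) ψ =
      inner ℂ φ (boundedMul μ (fun x => starRingEnd ℂ (m x)) ψ) := by
  rw [L2.inner_def, L2.inner_def]
  refine integral_congr_ae ?_
  filter_upwards [coeFn_boundedMul hm hC φ, coeFn_boundedMul (m := fun x => starRingEnd ℂ (m x))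
    (Complex.continuous_conj.measurable.comp hm) (C := C) (by simpa using hC) ψ] with x e1 e2
  rw [e1, e2]
  simp only [RCLike.inner_apply, map_mul]
  ring

/-- The Fourier multiplier with the bounded symbol `q`. -/
def fourierMul (q : ℝ → ℂ) : LineL2 →L[ℂ] LineL2 :=
  (lineFourier.symm : LineL2 →L[ℂ] LineL2) ∘L boundedMul volume q ∘L
    (lineFourier : LineL2 →L[ℂ] LineL2)

lemma lineFourier_fourierMul (q : ℝ → ℂ) (φ : LineL2) :
    lineFourier (fourierMul q φ) = boundedMul volume q (lineFourier φ) :=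
  lineFourier.apply_symm_apply _

lemma norm_fourierMul_le {q : ℝ → ℂ} (hq : Measurable q) (hC : ∀ x, ‖q x‖ ≤ 1) :
    ‖fourierMul q‖ ≤ 1 := by
  refine ContinuousLinearMap.opNorm_le_bound _ zero_le_one fun φ => ?_
  rw [← lineFourier.norm_map, lineFourier_fourierMul, ← lineFourier.norm_map φ]
  exact norm_boundedMul_apply_le hq hC _

lemma inner_fourierMul_left {q : ℝ → ℂ} (hq : Measurable q) {C : ℝ} (hC : ∀ x, ‖q x‖ ≤ C)
    (φ ψ : LineL2) : inner ℂ (fourierMul q φ) ψ =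
      inner ℂ φ (fourierMul (fun x => starRingEnd ℂ (q x)) ψ) := by
  rw [← lineFourier.inner_map_map, lineFourier_fourierMul, inner_boundedMul_left hq hC,
    ← lineFourier_fourierMul, lineFourier.inner_map_map]

/-- The characteristic function of the set where both `|x|` and `|m x|` are at most `n`. -/
def cutoff (m : ℝ → ℂ) (n : ℕ) : ℝ → ℂ := {x : ℝ | |x| ≤ n ∧ ‖m x‖ ≤ n}.indicator 1

variable {m : ℝ → ℂ}

lemma cutoff_of_mem {n : ℕ} {x : ℝ} (h : |x| ≤ n ∧ ‖m x‖ ≤ n) : cutoff m n x = 1 :=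
  indicator_of_mem (s := {x : ℝ | |x| ≤ n ∧ ‖m x‖ ≤ n}) h 1

lemma cutoff_of_not_mem {n : ℕ} {x : ℝ} (h : ¬ (|x| ≤ n ∧ ‖m x‖ ≤ n)) : cutoff m n x = 0 :=
  indicator_of_notMem (s := {x : ℝ | |x| ≤ n ∧ ‖m x‖ ≤ n}) h 1

lemma cutoff_eq_zero_or_one (m : ℝ → ℂ) (n : ℕ) (x : ℝ) : cutoff m n x = 0 ∨ cutoff m n x = 1 := by
  by_cases h : |x| ≤ n ∧ ‖m x‖ ≤ n
  · exact Or.inr (cutoff_of_mem h)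
  · exact Or.inl (cutoff_of_not_mem h)

lemma measurable_cutoff (hm : Measurable m) (n : ℕ) : Measurable (cutoff m n) := by
  exact measurable_one.indicator ((measurableSet_le (f := fun x : ℝ => |x|) (by fun_prop)
    measurable_const).inter (measurableSet_le hm.norm measurable_const))

lemma norm_cutoff_le (m : ℝ → ℂ) (n : ℕ) (x : ℝ) : ‖cutoff m n x‖ ≤ 1 := by
  rcases cutoff_eq_zero_or_one m n x with h | h <;> simp [h]

lemma conj_cutoff (m : ℝ → ℂ) (n : ℕ) (x : ℝ) : starRingEnd ℂ (cutoff m n x) = cutoff m n x := by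
  rcases cutoff_eq_zero_or_one m n x with h | h <;> simp [h]

lemma cutoff_mul_self (m : ℝ → ℂ) (n : ℕ) (x : ℝ) : cutoff m n x * cutoff m n x = cutoff m n x := by
  rcases cutoff_eq_zero_or_one m n x with h | h <;> simp [h]

lemma eventually_cutoff_eq (m : ℝ → ℂ) (x : ℝ) : ∀ᶠ n in atTop, cutoff m n x = 1 := by
  obtain ⟨N, hN⟩ := exists_nat_ge (max |x| ‖m x‖)
  filter_upwards [eventually_ge_atTop N] with n hn
  have h1 : (N : ℝ) ≤ n := by exact_mod_cast hn
  exact cutoff_of_mem ⟨(le_max_left _ _).trans (hN.trans h1), (le_max_right _ _).trans (hN.trans h1)⟩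

lemma tendsto_cutoff (m : ℝ → ℂ) (x : ℝ) : Tendsto (fun n => cutoff m n x) atTop (𝓝 1) :=
  tendsto_const_nhds.congr' ((eventually_cutoff_eq m x).mono fun _ h => h.symm)

lemma monotone_enorm_cutoff (m : ℝ → ℂ) (x : ℝ) : Monotone fun n => ‖cutoff m n x‖ₑ := by
  intro n k hnk
  have h1 : (n : ℝ) ≤ k := by exact_mod_cast hnk
  by_cases h : |x| ≤ n ∧ ‖m x‖ ≤ n
  · simp only [cutoff_of_mem h, cutoff_of_mem (n := k) ⟨h.1.trans h1, h.2.trans h1⟩, le_refl]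
  · simp [cutoff_of_not_mem h]

lemma memLp_cutoff (hm : Measurable m) (n : ℕ) : MemLp (cutoff m n) 2 volume := by
  refine MemLp.of_le (g := (Icc (-(n : ℝ)) n).indicator fun _ => (1 : ℂ)) ?_
    (measurable_cutoff hm n).aestronglyMeasurable (Eventually.of_forall fun x => ?_)
  · exact memLp_indicator_const 2 measurableSet_Icc 1 (Or.inr (by simp))
  · by_cases h : |x| ≤ n ∧ ‖m x‖ ≤ n
    · rw [cutoff_of_mem h, indicator_of_mem (mem_Icc.2 (abs_le.1 h.1))]
    · simp [cutoff_of_not_mem h]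

/-- `p` is bounded by `1` and `p m` is bounded and square integrable. -/
structure IsTruncation (m p : ℝ → ℂ) : Prop where
  measurable : Measurable p
  norm_le : ∀ x, ‖p x‖ ≤ 1
  bound : ∃ C : ℝ, ∀ x, ‖p x * m x‖ ≤ C
  memLp : MemLp (fun x => p x * m x) 2 volume

lemma isTruncation_cutoff (hm : Measurable m) (n : ℕ) : IsTruncation m (cutoff m n) := by
  have hb : ∀ x, ‖cutoff m n x * m x‖ ≤ n * ‖cutoff m n x‖ := fun x => by
    by_cases h : |x| ≤ n ∧ ‖m x‖ ≤ n
    · simpa [cutoff_of_mem h] using h.2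
    · simp [cutoff_of_not_mem h]
  refine ⟨measurable_cutoff hm n, norm_cutoff_le m n, ⟨n, fun x => (hb x).trans ?_⟩,
    (memLp_cutoff hm n).of_le_mul ((measurable_cutoff hm n).mul hm).aestronglyMeasurable
      (Eventually.of_forall hb)⟩
  exact mul_le_of_le_one_right n.cast_nonneg (norm_cutoff_le m n x)

lemma iSup_lintegral_cutoff (hm : Measurable m) {k : ℝ → ℝ≥0∞} (hk : Measurable k) (d : ℕ) :
    ⨆ n, ∫⁻ x, ‖cutoff m n x‖ₑ ^ d * k x = ∫⁻ x, k x := by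
  have hmono : ∀ x, Monotone fun n => ‖cutoff m n x‖ₑ ^ d * k x := fun x n l hnl => by
    have := monotone_enorm_cutoff m x hnl
    dsimp only at this ⊢
    gcongr
  rw [← lintegral_iSup (f := fun n x => ‖cutoff m n x‖ₑ ^ d * k x)
    (fun n => ((measurable_cutoff hm n).enorm.pow_const d).mul hk) fun n l hnl x => hmono x hnl]
  refine lintegral_congr fun x => iSup_eq_of_tendsto (hmono x) ?_
  refine tendsto_const_nhds.congr' ((eventually_cutoff_eq m x).mono fun n h => ?_)
  simp [h]

lemma tendsto_boundedMul_cutoff (hm : Measurable m) (φ : LineL2) :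
    Tendsto (fun n => boundedMul volume (cutoff m n) φ) atTop (𝓝 φ) := by
  have h := tendsto_boundedMul (μ := volume) (measurable_cutoff hm) (m' := fun _ => 1)
    measurable_const (norm_cutoff_le m) (C := 1) (by simp) (tendsto_cutoff m) φ
  rwa [boundedMul_eq_of_ae (χ := φ) measurable_const (C := 1) (by simp) (by simp)] at h

lemma tendsto_fourierMul_cutoff (hm : Measurable m) (φ : LineL2) :
    Tendsto (fun n => fourierMul (cutoff m n) φ) atTop (𝓝 φ) := by
  have h := (lineFourier.symm.continuous.tendsto _).comp
    (tendsto_boundedMul_cutoff hm (lineFourier φ))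
  rw [LinearIsometryEquiv.symm_apply_apply] at h
  exact h

end Truncation

/-! ### The bounded closure of the product -/

section ProductClosure

/-- The graph of the product `G · 𝓕⁻¹ h 𝓕` on its natural domain. -/
def ProductGraph (G h : ℝ → ℂ) (φ χ : LineL2) : Prop :=
  ∃ y : LineL2, lineFourier y =ᵐ[volume] (fun ξ => h ξ * lineFourier φ ξ) ∧
    χ =ᵐ[volume] fun x => G x * y x

/-- `B` is the bounded closure of the densely defined product `G · 𝓕⁻¹ h 𝓕`. -/
structure IsProductClosure (G h : ℝ → ℂ) (B : LineL2 →L[ℂ] LineL2) : Prop where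
  dense : Dense {φ | ∃ χ, ProductGraph G h φ χ}
  eq : ∀ φ χ, ProductGraph G h φ χ → χ = B φ

variable {G h : ℝ → ℂ} {B : LineL2 →L[ℂ] LineL2}

lemma kernelOp_eq_of_ae {k l φ y χ : LineL2}
    (hy : lineFourier y =ᵐ[volume] fun ξ => l ξ * lineFourier φ ξ)
    (hχ : χ =ᵐ[volume] fun x => k x * y x) : kernelOp k l φ = χ := by
  refine Lp.ext ?_
  filter_upwards [coeFn_kernelOp k l φ, ae_eq_inner_kernelVec hy, hχ] with x e1 e2 e3
  rw [e1, e3, e2]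

/-- Multiplication by `G` is defined on all bounded square integrable functions. -/
def MulBoundedMemLp (G : ℝ → ℂ) : Prop :=
  ∀ (y : LineL2) (C : ℝ), (∀ᵐ x, ‖y x‖ ≤ C) → MemLp (fun x => G x * y x) 2 volume

lemma mulBoundedMemLp_of_memLp (hG : MemLp G 2 volume) : MulBoundedMemLp G := by
  intro y C hy
  refine hG.of_le_mul (c := C) (hG.aestronglyMeasurable.mul (Lp.aestronglyMeasurable y)) ?_
  filter_upwards [hy] with x hx
  rw [norm_mul, mul_comm]
  exact mul_le_mul_of_nonneg_right hx (norm_nonneg _)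

lemma mulBoundedMemLp_of_bound (hG : Measurable G) {C : ℝ} (hC : ∀ x, ‖G x‖ ≤ C) :
    MulBoundedMemLp G :=
  fun y _ _ => memLp_mul_of_bound hG hC y

/-- A truncated Fourier multiplier maps into the domain of the product. -/
lemma exists_productGraph_fourierMul (hG : MulBoundedMemLp G) {q : ℝ → ℂ} (hq : IsTruncation h q)
    (φ : LineL2) : ∃ y χ : LineL2,
      lineFourier y =ᵐ[volume] (fun ξ => hq.memLp.toLp _ ξ * lineFourier φ ξ) ∧
      χ =ᵐ[volume] (fun x => G x * y x) ∧ ProductGraph G h (fourierMul q φ) χ := by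
  obtain ⟨C, hC⟩ := hq.bound
  have hm : MemLp (fun ξ => hq.memLp.toLp _ ξ * lineFourier φ ξ) 2 volume := by
    refine (Lp.memLp (lineFourier φ)).of_le_mul (c := C)
      ((Lp.aestronglyMeasurable _).mul (Lp.aestronglyMeasurable _)) ?_
    filter_upwards [hq.memLp.coeFn_toLp] with ξ e
    rw [e, norm_mul]
    exact mul_le_mul_of_nonneg_right (hC ξ) (norm_nonneg _)
  set y : LineL2 := lineFourier.symm (hm.toLp _) with hy
  have hy1 : lineFourier y =ᵐ[volume] fun ξ => hq.memLp.toLp _ ξ * lineFourier φ ξ := by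
    rw [hy, LinearIsometryEquiv.apply_symm_apply]
    exact hm.coeFn_toLp
  have hGy : MemLp (fun x => G x * y x) 2 volume := by
    refine hG y (‖hq.memLp.toLp _‖ * ‖φ‖) ?_
    filter_upwards [ae_eq_inner_kernelVec hy1] with x e
    rw [e]
    exact norm_inner_kernelVec_le _ _ _
  refine ⟨y, hGy.toLp _, hy1, hGy.coeFn_toLp, y, ?_, hGy.coeFn_toLp⟩
  rw [lineFourier_fourierMul]
  filter_upwards [hy1, hq.memLp.coeFn_toLp, coeFn_boundedMul hq.measurable hq.norm_le
    (lineFourier φ)] with ξ e1 e2 e3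
  rw [e1, e2, e3]
  ring

lemma dense_productGraph (hG : MulBoundedMemLp G) (hh : Measurable h) :
    Dense {φ | ∃ χ, ProductGraph G h φ χ} := by
  intro φ
  refine mem_closure_of_tendsto (tendsto_fourierMul_cutoff hh φ) (Eventually.of_forall fun n => ?_)
  obtain ⟨_, χ, -, -, h1⟩ := exists_productGraph_fourierMul hG (isTruncation_cutoff hh n) φ
  exact ⟨χ, h1⟩

/-- If two bounded operators agree on the domain of the product, they are equal. -/
lemma IsProductClosure.ext (hB : IsProductClosure G h B) {S T : LineL2 →L[ℂ] LineL2}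
    (hST : ∀ φ χ, ProductGraph G h φ χ → S φ = T φ) (φ : LineL2) : S φ = T φ :=
  congrFun (S.continuous.ext_on hB.dense T.continuous fun φ ⟨χ, hχ⟩ => hST φ χ hχ) φ

/-- The truncation of `B` on the left is a kernel operator when `h` is square integrable. -/
lemma IsProductClosure.boundedMul_apply (hB : IsProductClosure G h B) (hh : MemLp h 2 volume)
    {p : ℝ → ℂ} (hp : IsTruncation G p) (φ : LineL2) :
    boundedMul volume p (B φ) = kernelOp (hp.memLp.toLp _) (hh.toLp _) φ := by
  refine hB.ext (S := boundedMul volume p ∘L B) (fun φ χ hχ => ?_) φ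
  have h1 := hB.eq φ χ hχ
  obtain ⟨y, hy, hχ⟩ := hχ
  refine (kernelOp_eq_of_ae (y := y) ?_ ?_).symm
  · filter_upwards [hy, hh.coeFn_toLp] with ξ e1 e2
    rw [e1, e2]
  · rw [ContinuousLinearMap.comp_apply, ← h1]
    filter_upwards [hχ, hp.memLp.coeFn_toLp, coeFn_boundedMul hp.measurable hp.norm_le χ]
      with x e1 e2 e3
    rw [e3, e1, e2]
    ring

lemma IsProductClosure.truncate_of_memLp_right (hB : IsProductClosure G h B)
    (hh : MemLp h 2 volume) {p q : ℝ → ℂ} (hp : IsTruncation G p) (hq : IsTruncation h q)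
    (φ : LineL2) : boundedMul volume p (B (fourierMul q φ)) =
      kernelOp (hp.memLp.toLp _) (hq.memLp.toLp _) φ := by
  rw [hB.boundedMul_apply hh hp]
  refine Lp.ext ?_
  filter_upwards [coeFn_kernelOp (hp.memLp.toLp _) (hh.toLp _) (fourierMul q φ),
    coeFn_kernelOp (hp.memLp.toLp _) (hq.memLp.toLp _) φ] with x e1 e2
  rw [e1, e2, ← fourierInv_mul_eq_inner, ← fourierInv_mul_eq_inner, lineFourier_fourierMul]
  congr 1
  refine congrFun (funext fun x => Real.fourierInv_congr_ae ?_ x) x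
  filter_upwards [hh.coeFn_toLp, hq.memLp.coeFn_toLp,
    coeFn_boundedMul hq.measurable hq.norm_le (lineFourier φ)] with ξ e1 e2 e3
  rw [e1, e2, e3]
  ring

/-- When `G` can be applied to bounded functions, truncating `h` leads into the domain of the product. -/
lemma IsProductClosure.truncate_of_mulBoundedMemLp (hB : IsProductClosure G h B)
    (hG : MulBoundedMemLp G) {p q : ℝ → ℂ} (hp : IsTruncation G p) (hq : IsTruncation h q)
    (φ : LineL2) : boundedMul volume p (B (fourierMul q φ)) =
      kernelOp (hp.memLp.toLp _) (hq.memLp.toLp _) φ := by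
  obtain ⟨y, χ, hy, hχ, h1⟩ := exists_productGraph_fourierMul hG hq φ
  rw [← hB.eq _ _ h1]
  refine (kernelOp_eq_of_ae hy ?_).symm
  filter_upwards [hχ, hp.memLp.coeFn_toLp, coeFn_boundedMul hp.measurable hp.norm_le χ]
    with x e1 e2 e3
  rw [e3, e1, e2]
  ring

/-- For bounded `h` the operator `p B` is the everywhere defined product `p G · 𝓕⁻¹ h 𝓕`. -/
lemma IsProductClosure.truncate_of_bound_right (hB : IsProductClosure G h B) (hGm : Measurable G)
    (hh : Measurable h) {C : ℝ} (hC : ∀ ξ, ‖h ξ‖ ≤ C) {p q : ℝ → ℂ} (hp : IsTruncation G p)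
    (hq : IsTruncation h q) (φ : LineL2) : boundedMul volume p (B (fourierMul q φ)) =
      kernelOp (hp.memLp.toLp _) (hq.memLp.toLp _) φ := by
  obtain ⟨D, hD⟩ := hp.bound
  have hpm : Measurable fun x => p x * G x := hp.measurable.mul hGm
  have hkey : ∀ φ, boundedMul volume p (B φ) =
      boundedMul volume (fun x => p x * G x) (fourierMul h φ) := fun φ => by
    refine hB.ext (S := boundedMul volume p ∘L B)
      (T := boundedMul volume (fun x => p x * G x) ∘L fourierMul h) (fun φ χ hχ => ?_) φ
    have h1 := hB.eq φ χ hχ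
    obtain ⟨y, hy, hχ⟩ := hχ
    have h2 : fourierMul h φ = y := by
      apply lineFourier.injective
      rw [lineFourier_fourierMul, boundedMul_eq_of_ae hh hC hy]
    rw [ContinuousLinearMap.comp_apply, ContinuousLinearMap.comp_apply, ← h1, h2]
    refine (boundedMul_eq_of_ae hpm hD ?_).symm
    filter_upwards [hχ, coeFn_boundedMul hp.measurable hp.norm_le χ] with x e1 e3
    rw [e3, e1]
    ring
  rw [hkey]
  refine (kernelOp_eq_of_ae (y := fourierMul h (fourierMul q φ)) ?_ ?_).symm
  · rw [lineFourier_fourierMul, lineFourier_fourierMul]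
    filter_upwards [hq.memLp.coeFn_toLp, coeFn_boundedMul hq.measurable hq.norm_le (lineFourier φ),
      coeFn_boundedMul hh hC (boundedMul volume q (lineFourier φ))] with ξ e1 e2 e3
    rw [e3, e2, e1]
    ring
  · filter_upwards [hp.memLp.coeFn_toLp, coeFn_boundedMul hpm hD (fourierMul h (fourierMul q φ))]
      with x e1 e2
    rw [e2, e1]

lemma MemLp.enorm_toLp_sq {X : Type} [MeasurableSpace X] {μ : Measure X} {u : X → ℂ}
    (hu : MemLp u 2 μ) : ‖hu.toLp u‖ₑ ^ 2 = ∫⁻ x, ‖u x‖ₑ ^ 2 ∂μ := by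
  rw [Lp_two_enorm_sq]
  refine lintegral_congr_ae ?_
  filter_upwards [hu.coeFn_toLp] with x e
  rw [e]

/-- If all truncations of `B` are the expected kernel operators, the Hilbert-Schmidt norm of `B`
is at least the product of the `L²` norms. -/
lemma lintegral_mul_le_of_truncate {ι : Type} (b : HilbertBasis ι ℂ LineL2) (hG : Measurable G)
    (hh : Measurable h)
    (hB : ∀ {p q : ℝ → ℂ} (hp : IsTruncation G p) (hq : IsTruncation h q) (φ : LineL2),
      boundedMul volume p (B (fourierMul q φ)) =
        kernelOp (hp.memLp.toLp _) (hq.memLp.toLp _) φ) :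
    (∫⁻ x, ‖G x‖ₑ ^ 2) * ∫⁻ ξ, ‖h ξ‖ₑ ^ 2 ≤ ∑' i, ‖B (b i)‖ₑ ^ 2 := by
  rw [← iSup_lintegral_cutoff hG (hG.enorm.pow_const 2) 2,
    ← iSup_lintegral_cutoff hh (hh.enorm.pow_const 2) 2, ENNReal.iSup_mul]
  refine iSup_le fun n => ?_
  rw [ENNReal.mul_iSup]
  refine iSup_le fun k => ?_
  have hp := isTruncation_cutoff hG n
  have hq := isTruncation_cutoff hh k
  have h1 := tsum_enorm_sq_kernelOp b (hp.memLp.toLp _) (hq.memLp.toLp _)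
  rw [MemLp.enorm_toLp_sq, MemLp.enorm_toLp_sq] at h1
  simp_rw [enorm_mul, mul_pow] at h1
  rw [← h1]
  refine le_trans (ENNReal.tsum_le_tsum fun i => ?_)
    (tsum_enorm_sq_comp_le b B (norm_fourierMul_le hq.measurable hq.norm_le))
  rw [← hB hp hq]
  gcongr
  exact enorm_apply_le_of_norm_le_one (norm_boundedMul_le hp.measurable hp.norm_le) _

lemma isProductClosure_kernelOp (hG : MemLp G 2 volume) (hh : MemLp h 2 volume)
    (hm : Measurable h) : IsProductClosure G h (kernelOp (hG.toLp _) (hh.toLp _)) := by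
  refine ⟨dense_productGraph (mulBoundedMemLp_of_memLp hG) hm, fun φ χ ⟨y, hy, hχ⟩ => ?_⟩
  refine (kernelOp_eq_of_ae (y := y) ?_ ?_).symm
  · filter_upwards [hy, hh.coeFn_toLp] with ξ e1 e2
    rw [e1, e2]
  · filter_upwards [hχ, hG.coeFn_toLp] with ξ e1 e2
    rw [e1, e2]

lemma isProductClosure_zero_of_left (hG : G =ᵐ[volume] 0) (hm : Measurable h) :
    IsProductClosure G h 0 := by
  refine ⟨dense_productGraph (mulBoundedMemLp_of_memLp ((memLp_congr_ae hG).2 MemLp.zero)) hm,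
    fun φ χ ⟨y, _, hχ⟩ => Lp.ext ?_⟩
  filter_upwards [hχ, hG, Lp.coeFn_zero ℂ 2 volume] with ξ e1 e2 e3
  rw [e1, e2, zero_apply, e3]
  simp

lemma isProductClosure_zero_of_right (hh : h =ᵐ[volume] 0) : IsProductClosure G h 0 := by
  have hz := Lp.coeFn_zero ℂ 2 (volume : Measure ℝ)
  refine ⟨dense_univ.mono fun φ _ => ⟨0, 0, ?_, ?_⟩, fun φ χ ⟨y, hy, hχ⟩ => Lp.ext ?_⟩
  · rw [map_zero]
    filter_upwards [hh] with ξ e1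
    simp [e1]
  · exact Eventually.of_forall fun x => by simp
  · have h1 : y = 0 := by
      apply lineFourier.injective
      rw [map_zero]
      refine Lp.ext ?_
      filter_upwards [hh, hy] with ξ e1 e2
      simp [e1, e2]
    rw [h1] at hχ
    filter_upwards [hχ, hz] with ξ e1 e2
    rw [e1, zero_apply, e2]
    simp

/-- When the product of the two `L²` norms is finite, the product operator has a bounded closure
with this Hilbert-Schmidt norm. -/
lemma exists_isProductClosure {ι : Type} (b : HilbertBasis ι ℂ LineL2) (hG : Measurable G)
    (hh : Measurable h) (hfin : (∫⁻ x, ‖G x‖ₑ ^ 2) * ∫⁻ ξ, ‖h ξ‖ₑ ^ 2 < ∞) :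
    ∃ B, IsProductClosure G h B ∧
      ∑' i, ‖B (b i)‖ₑ ^ 2 = (∫⁻ x, ‖G x‖ₑ ^ 2) * ∫⁻ ξ, ‖h ξ‖ₑ ^ 2 := by
  have hzero : ∀ {u : ℝ → ℂ}, Measurable u → ∫⁻ x, ‖u x‖ₑ ^ 2 = 0 → u =ᵐ[volume] 0 := by
    intro u hu h0
    filter_upwards [(lintegral_eq_zero_iff (hu.enorm.pow_const 2)).1 h0] with x hx
    simpa using hx
  rcases ENNReal.mul_lt_top_iff.1 hfin with ⟨h1, h2⟩ | h1 | h1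
  · have hG2 : MemLp G 2 volume := (memLp_two_iff_lintegral hG.aestronglyMeasurable).2 h1
    have hh2 : MemLp h 2 volume := (memLp_two_iff_lintegral hh.aestronglyMeasurable).2 h2
    refine ⟨_, isProductClosure_kernelOp hG2 hh2 hh, ?_⟩
    rw [tsum_enorm_sq_kernelOp, MemLp.enorm_toLp_sq, MemLp.enorm_toLp_sq]
  · refine ⟨0, isProductClosure_zero_of_left (hzero hG h1) hh, ?_⟩
    simp [h1]
  · refine ⟨0, isProductClosure_zero_of_right (hzero hh h1), ?_⟩
    simp [h1]

end ProductClosure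

/-! ### The trace of the product -/

section Trace

variable {G h : ℝ → ℂ} {B : LineL2 →L[ℂ] LineL2}

lemma memLp_cutoff_mul {m u : ℝ → ℂ} (hm : Measurable m) (hu : Measurable u) (hu1 : ∀ x, ‖u x‖ ≤ 1)
    (n : ℕ) : MemLp (fun x => cutoff m n x * u x) 2 volume :=
  (memLp_cutoff hm n).of_le ((measurable_cutoff hm n).mul hu).aestronglyMeasurable
    (Eventually.of_forall fun x => by
      rw [norm_mul]
      exact mul_le_of_le_one_right (norm_nonneg _) (hu1 x))

lemma norm_cutoff_mul_le {u : ℝ → ℂ} (m : ℝ → ℂ) (hu1 : ∀ x, ‖u x‖ ≤ 1) (n : ℕ) (x : ℝ) :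
    ‖cutoff m n x * u x‖ ≤ 1 := by
  rw [norm_mul]
  exact mul_le_one₀ (norm_cutoff_le m n x) (norm_nonneg _) (hu1 x)

lemma integrable_cutoff_mul {m : ℝ → ℂ} (hm : Measurable m) (n : ℕ) :
    Integrable fun x => cutoff m n x * m x := by
  refine ((memLp_cutoff hm n).integrable_mul (isTruncation_cutoff hm n).memLp).congr
    (Eventually.of_forall fun x => ?_)
  change cutoff m n x * (cutoff m n x * m x) = _
  rw [← mul_assoc, cutoff_mul_self]

/-- The trace of `X* B`, where `X` is the product of the truncated multipliers `c u` and `c v`. -/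
lemma IsProductClosure.hasSum_inner_truncated {ι : Type} (b : HilbertBasis ι ℂ LineL2)
    (hB : IsProductClosure G h B) (hG : Measurable G) (hh : Measurable h)
    (hh2 : MemLp h 2 volume) {u v : ℝ → ℂ} (hu : Measurable u) (hv : Measurable v)
    (hu1 : ∀ x, ‖u x‖ ≤ 1) (hv1 : ∀ x, ‖v x‖ ≤ 1) (n k : ℕ) :
    HasSum (fun i => inner ℂ ((boundedMul volume (fun x => cutoff G n x * u x) ∘L
        fourierMul (fun x => cutoff h k x * v x)) (b i)) (B (b i)))
      ((∫ x, starRingEnd ℂ (u x) * (cutoff G n x * G x)) *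
        ∫ ξ, starRingEnd ℂ (v ξ) * (cutoff h k ξ * h ξ)) := by
  have hP := memLp_cutoff_mul hG hu hu1 n
  have hQ := memLp_cutoff_mul hh hv hv1 k
  have hp := isTruncation_cutoff hG n
  have hP1 := norm_cutoff_mul_le G hu1 n
  have hQ1 := norm_cutoff_mul_le h hv1 k
  have hPm : Measurable fun x => cutoff G n x * u x := (measurable_cutoff hG n).mul hu
  have hQm : Measurable fun x => cutoff h k x * v x := (measurable_cutoff hh k).mul hv
  set X := boundedMul volume (fun x => cutoff G n x * u x) ∘L
    fourierMul (fun x => cutoff h k x * v x) with hX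
  have hXk : ∀ φ, kernelOp (hP.toLp _) (hQ.toLp _) φ = X φ := fun φ => by
    refine kernelOp_eq_of_ae (y := fourierMul (fun x => cutoff h k x * v x) φ) ?_ ?_
    · rw [lineFourier_fourierMul]
      filter_upwards [hQ.coeFn_toLp, coeFn_boundedMul hQm hQ1 (lineFourier φ)] with ξ e1 e2
      rw [e1, e2]
    · filter_upwards [hP.coeFn_toLp, coeFn_boundedMul hPm hP1
        (fourierMul (fun x => cutoff h k x * v x) φ)] with x e1 e2
      rw [hX, ContinuousLinearMap.comp_apply, e1, e2]
  -- the cutoff is idempotent, so it can be moved to the other side of the inner product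
  have hXc : ∀ φ, boundedMul volume (cutoff G n) (X φ) = X φ := fun φ => by
    refine boundedMul_eq_of_ae hp.measurable hp.norm_le ?_
    filter_upwards [coeFn_boundedMul hPm hP1 (fourierMul (fun x => cutoff h k x * v x) φ)]
      with x e
    rw [hX, ContinuousLinearMap.comp_apply, e, ← mul_assoc, ← mul_assoc, cutoff_mul_self]
  have hterm : ∀ φ, inner ℂ (X φ) (B φ) = inner ℂ (kernelOp (hP.toLp _) (hQ.toLp _) φ)
      (kernelOp (hp.memLp.toLp _) (hh2.toLp _) φ) := fun φ => by
    rw [hXk, ← hB.boundedMul_apply hh2 hp]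
    conv_lhs => rw [← hXc φ, inner_boundedMul_left hp.measurable hp.norm_le]
    simp_rw [conj_cutoff]
  simp_rw [hterm]
  have hsum := hasSum_inner_kernelOp b (hP.toLp _) (hQ.toLp _) (hp.memLp.toLp _) (hh2.toLp _)
  convert hsum using 2
  · rw [L2.inner_def]
    refine integral_congr_ae ?_
    filter_upwards [hP.coeFn_toLp, hp.memLp.coeFn_toLp] with x e1 e2
    rw [e1, e2, RCLike.inner_apply, map_mul, conj_cutoff]
    linear_combination (-starRingEnd ℂ (u x) * G x) * cutoff_mul_self G n x
  · rw [L2.inner_def]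
    refine integral_congr_ae ?_
    filter_upwards [hQ.coeFn_toLp, hh2.coeFn_toLp] with x e1 e2
    rw [e1, e2, RCLike.inner_apply, map_mul, conj_cutoff]
    ring

/-- Testing `B` against the product of the phases of `G` and `h` bounds the product of their `L¹`
norms. -/
lemma IsProductClosure.lintegral_mul_lt_top {ι : Type} (b : HilbertBasis ι ℂ LineL2)
    {R S : LineL2 →L[ℂ] LineL2} (hB : IsProductClosure G h (R ∘L S)) (hG : Measurable G)
    (hh : Measurable h) (hh2 : MemLp h 2 volume) (hR : Summable fun i => ‖R (b i)‖ ^ 2)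
    (hS : Summable fun i => ‖S (b i)‖ ^ 2) : (∫⁻ x, ‖G x‖ₑ) * ∫⁻ ξ, ‖h ξ‖ₑ < ∞ := by
  obtain ⟨C, hC⟩ := exists_norm_tsum_inner_le b hR hS
  -- the phase of `m`, which is `0` where `m` vanishes
  have hphase : ∀ {m : ℝ → ℂ}, Measurable m → Measurable (fun x => m x / ‖m x‖) ∧
      (∀ x, ‖m x / ‖m x‖‖ ≤ 1) ∧ ∀ n, ENNReal.ofReal
        ‖∫ x, starRingEnd ℂ (m x / ‖m x‖) * (cutoff m n x * m x)‖ =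
          ∫⁻ x, ‖cutoff m n x‖ₑ ^ 1 * ‖m x‖ₑ := by
    intro m hm
    refine ⟨by fun_prop, fun x => ?_, fun n => ?_⟩
    · rw [norm_div, Complex.norm_real, norm_norm]
      exact div_self_le_one _
    · have h1 : ∀ x, starRingEnd ℂ (m x / ‖m x‖) * (cutoff m n x * m x) =
          (‖cutoff m n x * m x‖ : ℝ) := fun x => by
        rcases cutoff_eq_zero_or_one m n x with h0 | h0
        · simp [h0]
        · rcases eq_or_ne (m x) 0 with hx | hx
          · simp [hx]
          · have hx' : (‖m x‖ : ℂ) ≠ 0 := by simpa using hx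
            rw [h0, one_mul, map_div₀, Complex.conj_ofReal, div_mul_eq_mul_div, mul_comm,
              Complex.mul_conj, Complex.normSq_eq_norm_sq, div_eq_iff hx']
            push_cast
            ring
      simp_rw [h1]
      rw [integral_complex_ofReal, Complex.norm_real, Real.norm_of_nonneg
        (integral_nonneg fun x => norm_nonneg _),
        ofReal_integral_norm_eq_lintegral_enorm (integrable_cutoff_mul hm n)]
      simp_rw [enorm_mul, pow_one]
  refine lt_of_le_of_lt ?_ (ENNReal.ofReal_lt_top (r := C))
  rw [← iSup_lintegral_cutoff hG hG.enorm 1, ← iSup_lintegral_cutoff hh hh.enorm 1,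
    ENNReal.iSup_mul]
  refine iSup_le fun n => ?_
  rw [ENNReal.mul_iSup]
  refine iSup_le fun k => ?_
  obtain ⟨hu, hu1, hun⟩ := hphase hG
  obtain ⟨hv, hv1, hvn⟩ := hphase hh
  rw [← hun, ← hvn, ← ENNReal.ofReal_mul (norm_nonneg _), ← norm_mul,
    ← (hB.hasSum_inner_truncated b hG hh hh2 hu hv hu1 hv1 n k).tsum_eq]
  refine ENNReal.ofReal_le_ofReal (hC _ ?_)
  refine (ContinuousLinearMap.opNorm_comp_le _ _).trans (mul_le_one₀ ?_ (norm_nonneg _) ?_)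
  · exact norm_boundedMul_le ((measurable_cutoff hG n).mul hu) (norm_cutoff_mul_le G hu1 n)
  · exact norm_fourierMul_le ((measurable_cutoff hh k).mul hv) (norm_cutoff_mul_le h hv1 k)

lemma tendsto_integral_cutoff {m : ℝ → ℂ} (hm : Measurable m) (hi : Integrable m) :
    Tendsto (fun n => ∫ x, cutoff m n x * m x) atTop (𝓝 (∫ x, m x)) := by
  refine tendsto_integral_of_dominated_convergence (fun x => ‖m x‖)
    (fun n => ((measurable_cutoff hm n).mul hm).aestronglyMeasurable) hi.norm
    (fun n => Eventually.of_forall fun x => ?_) (Eventually.of_forall fun x => ?_)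
  · rw [norm_mul]
    exact mul_le_of_le_one_left (norm_nonneg _) (norm_cutoff_le m n x)
  · simpa using (tendsto_cutoff m x).mul_const (m x)

lemma integral_cutoff_of_ae_zero {m : ℝ → ℂ} (h0 : m =ᵐ[volume] 0) (n : ℕ) :
    ∫ x, cutoff m n x * m x = 0 := by
  refine integral_eq_zero_of_ae ?_
  filter_upwards [h0] with x hx
  simp [hx]

lemma tendsto_adjoint_cutoff (hG : Measurable G) (hh : Measurable h) (φ : LineL2) :
    Tendsto (fun n => ContinuousLinearMap.adjoint (boundedMul volume (cutoff G n) ∘L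
      fourierMul (cutoff h n)) φ) atTop (𝓝 φ) := by
  have h1 : ∀ n, ContinuousLinearMap.adjoint (boundedMul volume (cutoff G n) ∘L
      fourierMul (cutoff h n)) φ =
        fourierMul (cutoff h n) (boundedMul volume (cutoff G n) φ) := fun n => by
    refine ext_inner_left ℂ fun ψ => ?_
    rw [ContinuousLinearMap.adjoint_inner_right, ContinuousLinearMap.comp_apply,
      inner_boundedMul_left (measurable_cutoff hG n) (norm_cutoff_le G n),
      inner_fourierMul_left (measurable_cutoff hh n) (norm_cutoff_le h n)]
    simp_rw [conj_cutoff]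
  simp_rw [h1]
  have h2 : ∀ n, fourierMul (cutoff h n) (boundedMul volume (cutoff G n) φ) =
      fourierMul (cutoff h n) (boundedMul volume (cutoff G n) φ - φ) + fourierMul (cutoff h n) φ :=
    fun n => by rw [← map_add, sub_add_cancel]
  simp_rw [h2]
  have h3 : Tendsto (fun n => fourierMul (cutoff h n) (boundedMul volume (cutoff G n) φ - φ))
      atTop (𝓝 0) := by
    refine squeeze_zero_norm (fun n => ?_)
      (tendsto_iff_norm_sub_tendsto_zero.1 (tendsto_boundedMul_cutoff hG φ))
    simpa using ContinuousLinearMap.le_of_opNorm_le _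
      (norm_fourierMul_le (measurable_cutoff hh n) (norm_cutoff_le h n))
      (boundedMul volume (cutoff G n) φ - φ)
  simpa using h3.add (tendsto_fourierMul_cutoff hh φ)

lemma IsProductClosure.hasSum_trace {ι : Type} (b : HilbertBasis ι ℂ LineL2)
    {R S : LineL2 →L[ℂ] LineL2} (hB : IsProductClosure G h (R ∘L S)) (hG : Measurable G)
    (hh : Measurable h) (hh2 : MemLp h 2 volume) (hR : Summable fun i => ‖R (b i)‖ ^ 2)
    (hS : Summable fun i => ‖S (b i)‖ ^ 2)
    (hGh : G =ᵐ[volume] 0 ∨ h =ᵐ[volume] 0 ∨ Integrable G ∧ Integrable h) :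
    HasSum (fun i => inner ℂ (b i) ((R ∘L S) (b i))) ((∫ x, G x) * ∫ ξ, h ξ) := by
  refine hasSum_inner_comp_of_tendsto b hR hS (X := fun n =>
    boundedMul volume (cutoff G n) ∘L fourierMul (cutoff h n)) (fun n => ?_)
    (tendsto_adjoint_cutoff hG hh)
    (s := fun n => (∫ x, cutoff G n x * G x) * ∫ ξ, cutoff h n ξ * h ξ) (fun n => ?_) ?_
  · exact (ContinuousLinearMap.opNorm_comp_le _ _).trans (mul_le_one₀
      (norm_boundedMul_le (measurable_cutoff hG n) (norm_cutoff_le G n)) (norm_nonneg _)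
      (norm_fourierMul_le (measurable_cutoff hh n) (norm_cutoff_le h n)))
  · have h1 := hB.hasSum_inner_truncated b hG hh hh2 (u := fun _ => 1) (v := fun _ => 1)
      measurable_const measurable_const (by simp) (by simp) n n
    simpa only [mul_one, map_one, one_mul] using h1
  · rcases hGh with h0 | h0 | ⟨h1, h2⟩
    · simp [integral_cutoff_of_ae_zero h0, integral_eq_zero_of_ae h0]
    · simp [integral_cutoff_of_ae_zero h0, integral_eq_zero_of_ae h0]
    · exact (tendsto_integral_cutoff hG h1).mul (tendsto_integral_cutoff hh h2)

end Trace

/-! ### Change of variables -/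

section ChangeOfVariables

/-- The function `g` of the energy `E = (2π exp y)²`. -/
def energySymbol (g : ℝ → ℂ) (y : ℝ) : ℂ := g ((2 * Real.pi * Real.exp y) ^ 2)

/-- The function `f` of `a = -2πξ`, the generator of dilations in Fourier space. -/
def dilationSymbol (f : ℝ → ℂ) (ξ : ℝ) : ℂ := f (-(2 * Real.pi * ξ))

lemma measurable_energySymbol {g : ℝ → ℂ} (hg : Measurable g) : Measurable (energySymbol g) :=
  hg.comp (by fun_prop)

lemma measurable_dilationSymbol {f : ℝ → ℂ} (hf : Measurable f) : Measurable (dilationSymbol f) :=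
  hf.comp (by fun_prop)

lemma energy_pos (y : ℝ) : 0 < (2 * Real.pi * Real.exp y) ^ 2 := by positivity

lemma hasDerivAt_energy (y : ℝ) : HasDerivAt (fun y => (2 * Real.pi * Real.exp y) ^ 2)
    (2 * (2 * Real.pi * Real.exp y) ^ 2) y := by
  have h := ((Real.hasDerivAt_exp y).const_mul (2 * Real.pi)).pow 2
  have h1 : ((2 : ℕ) : ℝ) * (2 * Real.pi * Real.exp y) ^ (2 - 1) * (2 * Real.pi * Real.exp y) =
      2 * (2 * Real.pi * Real.exp y) ^ 2 := by
    norm_num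
    ring
  exact h1 ▸ h

lemma energy_injective : Function.Injective fun y => (2 * Real.pi * Real.exp y) ^ 2 := by
  intro x y hxy
  have h1 := (sq_eq_sq₀ (by positivity) (by positivity)).1 hxy
  exact Real.exp_injective (mul_left_cancel₀ (by positivity) h1)

lemma range_energy : (fun y => (2 * Real.pi * Real.exp y) ^ 2) '' univ = Ioi 0 := by
  ext E
  simp only [image_univ, mem_range, mem_Ioi]
  constructor
  · rintro ⟨y, rfl⟩
    exact energy_pos y
  · intro hE
    refine ⟨Real.log (√E / (2 * Real.pi)), ?_⟩
    rw [Real.exp_log (by positivity), mul_div_cancel₀ _ (by positivity), Real.sq_sqrt hE.le]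

lemma abs_two_mul_energy (y : ℝ) : |2 * (2 * Real.pi * Real.exp y) ^ 2| =
    2 * (2 * Real.pi * Real.exp y) ^ 2 := abs_of_pos (by positivity)

lemma lintegral_energy (k : ℝ → ℝ≥0∞) :
    ∫⁻ E in Ioi (0 : ℝ), k E / ENNReal.ofReal (2 * E) =
      ∫⁻ y, k ((2 * Real.pi * Real.exp y) ^ 2) := by
  rw [← range_energy, lintegral_image_eq_lintegral_abs_deriv_mul MeasurableSet.univ
    (fun y _ => (hasDerivAt_energy y).hasDerivWithinAt) energy_injective.injOn,
    Measure.restrict_univ]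
  refine lintegral_congr fun y => ?_
  rw [abs_two_mul_energy]
  exact ENNReal.mul_div_cancel (ENNReal.ofReal_pos.2 (by positivity)).ne' ENNReal.ofReal_ne_top

lemma integral_energy (g : ℝ → ℂ) :
    ∫ E in Ioi (0 : ℝ), g E / (2 * E) = ∫ y, energySymbol g y := by
  rw [← range_energy, integral_image_eq_integral_abs_deriv_smul MeasurableSet.univ
    (fun y _ => (hasDerivAt_energy y).hasDerivWithinAt) energy_injective.injOn,
    Measure.restrict_univ]
  refine integral_congr_ae (Eventually.of_forall fun y => ?_)
  have h1 : ((2 * Real.pi * Real.exp y : ℝ) : ℂ) ≠ 0 := by exact_mod_cast (by positivity)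
  simp only [abs_two_mul_energy, energySymbol, Complex.real_smul]
  push_cast at h1 ⊢
  field_simp

lemma integrableOn_energy (g : ℝ → ℂ) :
    IntegrableOn (fun E : ℝ => g E / (2 * E)) (Ioi 0) ↔ Integrable (energySymbol g) := by
  rw [← range_energy, integrableOn_image_iff_integrableOn_abs_deriv_smul MeasurableSet.univ
    (fun y _ => (hasDerivAt_energy y).hasDerivWithinAt) energy_injective.injOn, integrableOn_univ]
  refine integrable_congr (Eventually.of_forall fun y => ?_)
  have h1 : ((2 * Real.pi * Real.exp y : ℝ) : ℂ) ≠ 0 := by exact_mod_cast (by positivity)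
  simp only [abs_two_mul_energy, energySymbol, Complex.real_smul]
  push_cast at h1 ⊢
  field_simp

lemma lintegral_dilation (k : ℝ → ℝ≥0∞) :
    ∫⁻ a, k a = ENNReal.ofReal (2 * Real.pi) * ∫⁻ ξ, k (-(2 * Real.pi * ξ)) := by
  have h0 : (0 : ℝ) < 2 * Real.pi := by positivity
  have h1 : ∀ ξ : ℝ, HasDerivAt (fun ξ => -(2 * Real.pi * ξ)) (-(2 * Real.pi)) ξ := fun ξ => by
    have := ((hasDerivAt_id ξ).const_mul (2 * Real.pi)).neg
    rwa [mul_one] at this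
  have h2 : Function.Injective fun ξ : ℝ => -(2 * Real.pi * ξ) := fun x y hxy =>
    mul_left_cancel₀ h0.ne' (neg_injective hxy)
  have h3 : (fun ξ : ℝ => -(2 * Real.pi * ξ)) '' univ = univ := by
    rw [image_univ, range_eq_univ]
    intro a
    refine ⟨-(a / (2 * Real.pi)), ?_⟩
    change -(2 * Real.pi * -(a / (2 * Real.pi))) = a
    field_simp
  have h4 := lintegral_image_eq_lintegral_abs_deriv_mul MeasurableSet.univ
    (fun ξ _ => (h1 ξ).hasDerivWithinAt) h2.injOn k
  rw [h3, Measure.restrict_univ, abs_neg, abs_of_pos h0,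
    lintegral_const_mul' _ _ ENNReal.ofReal_ne_top] at h4
  exact h4

lemma integral_dilation (f : ℝ → ℂ) :
    ∫ ξ, dilationSymbol f ξ = 1 / (2 * Real.pi) * ∫ a, f a := by
  have h1 := Measure.integral_comp_mul_left f (-(2 * Real.pi))
  rw [← neg_inv, abs_neg, abs_of_pos (by positivity), Complex.real_smul] at h1
  simpa [dilationSymbol, neg_mul] using h1

lemma integrable_dilationSymbol (f : ℝ → ℂ) : Integrable (dilationSymbol f) ↔ Integrable f := by
  have h1 := integrable_comp_mul_left_iff f (R := -(2 * Real.pi)) (by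
    have := Real.pi_pos
    linarith)
  simp_rw [neg_mul] at h1
  exact h1

lemma energyNorm_eq (g : ℝ → ℂ) :
    energyNorm g = (∫⁻ y, ‖energySymbol g y‖ₑ ^ 2) ^ (1 / 2 : ℝ) := by
  rw [energyNorm, lintegral_energy fun E => ‖g E‖ₑ ^ 2]
  rfl

lemma lineNorm_eq (f : ℝ → ℂ) : lineNorm f =
    (ENNReal.ofReal (2 * Real.pi) * ∫⁻ ξ, ‖dilationSymbol f ξ‖ₑ ^ 2) ^ (1 / 2 : ℝ) := by
  rw [lineNorm, lintegral_dilation fun a => ‖f a‖ₑ ^ 2]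
  rfl

lemma memLp_energySymbol {g : ℝ → ℂ} (hg : Measurable g) (h : energyNorm g < ∞) :
    MemLp (energySymbol g) 2 volume := by
  refine (memLp_two_iff_lintegral (measurable_energySymbol hg).aestronglyMeasurable).2 ?_
  rw [energyNorm_eq] at h
  exact (ENNReal.rpow_lt_top_iff_of_pos (by norm_num)).1 h

lemma memLp_dilationSymbol {f : ℝ → ℂ} (hf : Measurable f) (h : ∫⁻ a, ‖f a‖ₑ ^ 2 < ∞) :
    MemLp (dilationSymbol f) 2 volume := by
  refine (memLp_two_iff_lintegral (measurable_dilationSymbol hf).aestronglyMeasurable).2 ?_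
  rw [lintegral_dilation fun a => ‖f a‖ₑ ^ 2] at h
  exact ENNReal.lt_top_of_mul_ne_top_right h.ne (ENNReal.ofReal_pos.2 (by positivity)).ne'

lemma norm_mul_norm_eq (f g : ℝ → ℂ) :
    ENNReal.ofReal ((2 * Real.pi) ^ (-(1 / 2) : ℝ)) * energyNorm g * lineNorm f =
      ((∫⁻ y, ‖energySymbol g y‖ₑ ^ 2) * ∫⁻ ξ, ‖dilationSymbol f ξ‖ₑ ^ 2) ^ (1 / 2 : ℝ) := by
  have h0 : (0 : ℝ) < 2 * Real.pi := by positivity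
  rw [energyNorm_eq, lineNorm_eq, ENNReal.mul_rpow_of_nonneg _ _ (by norm_num),
    ENNReal.mul_rpow_of_nonneg _ _ (by norm_num), ENNReal.ofReal_rpow_of_pos h0]
  have h1 : ENNReal.ofReal ((2 * Real.pi) ^ (-(1 / 2) : ℝ)) *
      ENNReal.ofReal ((2 * Real.pi) ^ (1 / 2 : ℝ)) = 1 := by
    rw [← ENNReal.ofReal_mul (by positivity), ← Real.rpow_add h0]
    norm_num
  rw [← mul_assoc, mul_right_comm (ENNReal.ofReal _) _ (ENNReal.ofReal _), h1, one_mul]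

end ChangeOfVariables

/-! ### Transport to the energy representation -/

section Transport

/-- The operator `V B V⁻¹` on the line. -/
def energyConj (B : HalfLineL2 →L[ℂ] HalfLineL2) : LineL2 →L[ℂ] LineL2 :=
  (energyUnitary : HalfLineL2 →L[ℂ] LineL2) ∘L B ∘L (energyUnitary.symm : LineL2 →L[ℂ] HalfLineL2)

lemma energyConj_apply (B : HalfLineL2 →L[ℂ] HalfLineL2) (ψ : HalfLineL2) :
    energyConj B (energyUnitary ψ) = energyUnitary (B ψ) := by
  change energyUnitary (B (energyUnitary.symm (energyUnitary ψ))) = _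
  rw [LinearIsometryEquiv.symm_apply_apply]

lemma exists_energyConj_eq (B : LineL2 →L[ℂ] LineL2) : ∃ B', energyConj B' = B := by
  refine ⟨(energyUnitary.symm : LineL2 →L[ℂ] HalfLineL2) ∘L B ∘L
    (energyUnitary : HalfLineL2 →L[ℂ] LineL2), ?_⟩
  ext1 φ
  rw [← energyUnitary.apply_symm_apply φ, energyConj_apply]
  exact energyUnitary.apply_symm_apply _

/-- The image of an orthonormal basis of `L²(ℝ₊)`. -/
def energyBasis {ι : Type} (b : HilbertBasis ι ℂ HalfLineL2) : HilbertBasis ι ℂ LineL2 :=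
  HilbertBasis.ofRepr (energyUnitary.symm.trans b.repr)

lemma energyBasis_apply {ι : Type} (b : HilbertBasis ι ℂ HalfLineL2) (i : ι) :
    energyBasis b i = energyUnitary (b i) := rfl

lemma tsum_enorm_sq_energyConj {ι : Type} (b : HilbertBasis ι ℂ HalfLineL2)
    (B : HalfLineL2 →L[ℂ] HalfLineL2) :
    ∑' i, ‖energyConj B (energyBasis b i)‖ₑ ^ 2 = ∑' i, ‖B (b i)‖ₑ ^ 2 := by
  refine tsum_congr fun i => ?_
  rw [energyBasis_apply, energyConj_apply, LinearIsometryEquiv.enorm_map]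

lemma isBoundedClosure_energyDilationProduct_iff {f g : ℝ → ℂ} (hf : Measurable f)
    (hg : Measurable g) (B : HalfLineL2 →L[ℂ] HalfLineL2) :
    IsBoundedClosure (energyDilationProduct g f) B ↔
      IsProductClosure (energySymbol g) (dilationSymbol f) (energyConj B) := by
  have hgraph : ∀ ψ η, (ψ, η) ∈ (energyDilationProduct g f).graph ↔
      ProductGraph (energySymbol g) (dilationSymbol f) (energyUnitary ψ) (energyUnitary η) :=
    fun ψ η => by
      have h := mem_graph_energyDilationProduct hf hg (energyUnitary ψ) (energyUnitary η)
      rwa [LinearIsometryEquiv.symm_apply_apply, LinearIsometryEquiv.symm_apply_apply] at h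
  have hset : {ψ | ∃ η, (ψ, η) ∈ (energyDilationProduct g f).graph} = energyUnitary ⁻¹'
      {φ | ∃ χ, ProductGraph (energySymbol g) (dilationSymbol f) φ χ} := by
    ext ψ
    simp only [mem_ofPred_eq, mem_preimage, hgraph]
    exact energyUnitary.surjective.exists.symm
  rw [isBoundedClosure_iff, hset]
  constructor
  · rintro ⟨h1, h2⟩
    refine ⟨?_, fun φ χ h => ?_⟩
    · have := h1.preimage energyUnitary.symm.toHomeomorph.isOpenMap
      convert this using 1
      ext φ
      simp
    · obtain ⟨ψ, rfl⟩ := energyUnitary.surjective φ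
      obtain ⟨η, rfl⟩ := energyUnitary.surjective χ
      rw [energyConj_apply, h2 ψ η ((hgraph _ _).2 h)]
  · rintro ⟨h1, h2⟩
    refine ⟨h1.preimage energyUnitary.toHomeomorph.isOpenMap, fun ψ η h => ?_⟩
    apply energyUnitary.injective
    rw [h2 _ _ ((hgraph _ _).1 h), energyConj_apply]

/-- Every bounded closure has at least the asserted Hilbert-Schmidt norm, and when that is finite there
is a bounded closure with exactly this norm. -/
lemma partialHilbertSchmidtNorm_energyDilationProduct {f g : ℝ → ℂ} (hf : Measurable f)
    (hg : Measurable g)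
    (h : lineNorm f < ∞ ∨ energyNorm g < ∞ ∨ (∃ C : ℝ, ∀ a, ‖f a‖ ≤ C) ∨
        (∃ C : ℝ, ∀ E > 0, ‖g E‖ ≤ C)) :
    partialHilbertSchmidtNorm (energyDilationProduct g f) =
      ENNReal.ofReal ((2 * Real.pi) ^ (-(1 / 2) : ℝ)) * energyNorm g * lineNorm f := by
  have hG := measurable_energySymbol hg
  have hh := measurable_dilationSymbol hf
  set b := someBasis HalfLineL2
  rw [norm_mul_norm_eq]
  refine le_antisymm ?_ (le_iInf fun B => le_iInf fun hB => ?_)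
  · rcases eq_or_ne ((∫⁻ y, ‖energySymbol g y‖ₑ ^ 2) * ∫⁻ ξ, ‖dilationSymbol f ξ‖ₑ ^ 2) ∞ with
      htop | htop
    · rw [htop, ENNReal.top_rpow_of_pos (by norm_num)]
      exact le_top
    · obtain ⟨B', hB', hs⟩ := exists_isProductClosure (energyBasis b) hG hh htop.lt_top
      obtain ⟨B, rfl⟩ := exists_energyConj_eq B'
      refine (iInf₂_le B ((isBoundedClosure_energyDilationProduct_iff hf hg B).2 hB')).trans ?_
      rw [hilbertSchmidtNorm_eq b, ← hs, tsum_enorm_sq_energyConj]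
  · rw [hilbertSchmidtNorm_eq b, ← tsum_enorm_sq_energyConj]
    refine ENNReal.rpow_le_rpow ?_ (by norm_num)
    have hB' := (isBoundedClosure_energyDilationProduct_iff hf hg B).1 hB
    refine lintegral_mul_le_of_truncate _ hG hh fun hp hq φ => ?_
    rcases h with h | h | ⟨C, hC⟩ | ⟨C, hC⟩
    · exact hB'.truncate_of_memLp_right (memLp_dilationSymbol hf
        ((ENNReal.rpow_lt_top_iff_of_pos (by norm_num)).1 h)) hp hq φ
    · exact hB'.truncate_of_mulBoundedMemLp (mulBoundedMemLp_of_memLp (memLp_energySymbol hg h))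
        hp hq φ
    · exact hB'.truncate_of_bound_right hG hh (fun ξ => hC _) hp hq φ
    · exact hB'.truncate_of_mulBoundedMemLp
        (mulBoundedMemLp_of_bound hG fun y => hC _ (energy_pos y)) hp hq φ

/-- The symbols are integrable unless one of them vanishes, and in every case the trace is the
product of their integrals. -/
lemma trace_energyDilationProduct {f g : ℝ → ℂ} (hf : Measurable f) (hg : Measurable g)
    (hf2 : MemLp f 2 volume) {B : HalfLineL2 →L[ℂ] HalfLineL2}
    (hB : IsBoundedClosure (energyDilationProduct g f) B) (hBt : IsTraceClass B) :
    (g =ᵐ[volume.restrict (Ioi 0)] 0 ∨ f =ᵐ[volume] 0 ∨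
      (IntegrableOn (fun E : ℝ => g E / (2 * E)) (Ioi 0) ∧ Integrable f)) ∧
    HasTrace B (1 / (2 * Real.pi) * (∫ E in Ioi (0 : ℝ), g E / (2 * E)) * ∫ a, f a) := by
  have hG := measurable_energySymbol hg
  have hh := measurable_dilationSymbol hf
  have hh2 := memLp_dilationSymbol hf ((memLp_two_iff_lintegral hf2.1).1 hf2)
  have hB' := (isBoundedClosure_energyDilationProduct_iff hf hg B).1 hB
  have hfac : ∀ {ι : Type} (b : HilbertBasis ι ℂ HalfLineL2), ∃ R S : LineL2 →L[ℂ] LineL2,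
      energyConj B = R ∘L S ∧ (Summable fun i => ‖R (energyBasis b i)‖ ^ 2) ∧
        Summable fun i => ‖S (energyBasis b i)‖ ^ 2 := fun b => by
    obtain ⟨R, S, rfl, hR, hS⟩ := hBt.exists_factorization b
    refine ⟨energyConj R, energyConj S, ?_, ?_, ?_⟩
    · ext1 φ
      rw [← energyUnitary.apply_symm_apply φ, energyConj_apply, ContinuousLinearMap.comp_apply,
        ContinuousLinearMap.comp_apply, energyConj_apply, energyConj_apply]
    · simpa only [energyBasis_apply, energyConj_apply, LinearIsometryEquiv.norm_map] using hR
    · simpa only [energyBasis_apply, energyConj_apply, LinearIsometryEquiv.norm_map] using hS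
  have hzero : ∀ {u : ℝ → ℂ}, Measurable u → ∫⁻ x, ‖u x‖ₑ = 0 → u =ᵐ[volume] 0 := by
    intro u hu h0
    filter_upwards [(lintegral_eq_zero_iff hu.enorm).1 h0] with x hx
    simpa using hx
  obtain ⟨R, S, hRS, hR, hS⟩ := hfac (someBasis HalfLineL2)
  have hfin := (hRS ▸ hB').lintegral_mul_lt_top _ hG hh hh2 hR hS
  have hcases : (g =ᵐ[volume.restrict (Ioi 0)] 0 ∧ energySymbol g =ᵐ[volume] 0) ∨
      (f =ᵐ[volume] 0 ∧ dilationSymbol f =ᵐ[volume] 0) ∨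
        Integrable (energySymbol g) ∧ Integrable (dilationSymbol f) := by
    rcases ENNReal.mul_lt_top_iff.1 hfin with ⟨h1, h2⟩ | h1 | h1
    · exact Or.inr (Or.inr ⟨⟨hG.aestronglyMeasurable, h1⟩, ⟨hh.aestronglyMeasurable, h2⟩⟩)
    · refine Or.inl ⟨?_, hzero hG h1⟩
      have h2 := lintegral_energy fun E => ‖g E‖ₑ
      rw [show ∫⁻ y, ‖g ((2 * Real.pi * Real.exp y) ^ 2)‖ₑ = 0 from h1,
        lintegral_eq_zero_iff (by fun_prop)] at h2
      filter_upwards [h2] with E hE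
      simpa [ENNReal.div_eq_zero_iff, ENNReal.mul_eq_top] using hE
    · refine Or.inr (Or.inl ⟨?_, hzero hh h1⟩)
      refine hzero hf ?_
      rw [lintegral_dilation fun a => ‖f a‖ₑ,
        show ∫⁻ ξ, ‖f (-(2 * Real.pi * ξ))‖ₑ = 0 from h1, mul_zero]
  refine ⟨?_, fun ι b => ?_⟩
  · rw [integrableOn_energy, ← integrable_dilationSymbol f]
    exact hcases.imp And.left (Or.imp_left And.left)
  · obtain ⟨R, S, hRS, hR, hS⟩ := hfac b
    have hsum := (hRS ▸ hB').hasSum_trace _ hG hh hh2 hR hS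
      (hcases.imp And.right (Or.imp_left And.right))
    rw [← hRS, ← integral_energy, integral_dilation] at hsum
    simp only [energyBasis_apply, energyConj_apply, LinearIsometryEquiv.inner_map_map] at hsum
    convert hsum using 1
    ring

end Transport

end

theorem mainTheorem7 :
    (∀ f g : ℝ → ℂ, Measurable f → Measurable g →
      (lineNorm f < ∞ ∨ energyNorm g < ∞ ∨ (∃ C : ℝ, ∀ a, ‖f a‖ ≤ C) ∨
        (∃ C : ℝ, ∀ E > 0, ‖g E‖ ≤ C)) →
      partialHilbertSchmidtNorm (energyDilationProduct g f) =
        ENNReal.ofReal ((2 * Real.pi) ^ (-(1 / 2) : ℝ)) * energyNorm g * lineNorm f) ∧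
    (∀ (f g : ℝ → ℂ) (_ : Measurable f) (_ : Measurable g) (hf : MemLp f 2 volume),
      ContinuousOn g (Ioi 0) →
      (∃ φ : ℝ → ℂ, Continuous φ ∧ hatL2 f hf =ᵐ[volume] φ) →
      ∀ B : HalfLineL2 →L[ℂ] HalfLineL2, IsBoundedClosure (energyDilationProduct g f) B →
        IsTraceClass B →
        (g =ᵐ[volume.restrict (Ioi 0)] 0 ∨ f =ᵐ[volume] 0 ∨
          (IntegrableOn (fun E : ℝ => g E / (2 * E)) (Ioi 0) ∧ Integrable f)) ∧
        HasTrace B (1 / (2 * Real.pi) * (∫ E in Ioi (0 : ℝ), g E / (2 * E)) * ∫ a, f a)) := by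
  refine ⟨fun f g hf hg h => partialHilbertSchmidtNorm_energyDilationProduct hf hg h, ?_⟩
  intro f g hf hg hf2 _ _ B hB hBt
  exact trace_energyDilationProduct hf hg hf2 hB hBt
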